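/- Setting. Let $D$ be a finite set with $|D|\ge 2$, let $k$ be a positive semidefinite kernel on $D$ with $k(x,x)=1$ for all $x\in D$, let $\sigma>0$, and let $f$ be a Gaussian process on $D$ with mean zero and covariance $k$. At time $t=1,2,\dots$ a point $x_t\in D$ is chosen and $y_t=f(x_t)+z_t$ is observed, where the $z_t$ are i.i.d. $N(0,\sigma^2)$ and independent of $f$; each sample has unit cost. Let $\mu_t(x)$ and $\sigma_t^2(x)$ be the posterior mean and variance of $f(x)$ given $(x_1,y_1),\dots,(x_t,y_t)$, and let $\sigma^2_{t|S}(x)$ be the posterior variance after additionally sampling the points of a finite collection $S$ (repetitions allowed). Assume that for all $t$, all $x_1,\dots,x_t$ and all $x$ the function $S\mapsto\sigma_t^2(x)-\sigma_{t|S}^2(x)$ is submodular. Algorithm (TruVaR). Given $\overline\delta>0$, parameters $\beta_{(i)}$ ($i\ge1$) and $\eta_{(i)}=2^{-(i-1)}$ (that is, $\eta_{(1)}=1$ and $r=\tfrac12$), start with $i=1$, $M_0=D$, $H_0=L_0=\emptyset$. At time $t$ choose $$x_t\in\arg\max_{x\in D}\Big(\sum_{\bar x\in M_{t-1}}\max\{\beta_{(i)}\sigma_{t-1}^2(\bar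 x),\eta_{(i)}^2\}-\sum_{\bar x\in M_{t-1}}\max\{\beta_{(i)}\sigma_{t-1|x}^2(\bar x),\eta_{(i)}^2\}\Big)$$ with any fixed tie-breaking rule, observe $y_t$, and put $u_t=\mu_t+\beta_{(i)}^{1/2}\sigma_t$, $\ell_t=\mu_t-\beta_{(i)}^{1/2}\sigma_t$. For Bayesian optimization (BO) set $M_t=\{x\in M_{t-1}:u_t(x)\ge\max_{\bar x\in M_{t-1}}\ell_t(\bar x)\}$. For level-set estimation (LSE) with threshold $h\in\mathbb R$ set $M_t=\{x\in M_{t-1}:\ell_t(x)\le h\le u_t(x)\}$, $H_t=H_{t-1}\cup\{x\in M_{t-1}:\ell_t(x)>h\}$, $L_t=L_{t-1}\cup\{x\in M_{t-1}:u_t(x)<h\}$. Then, as long as $M_t\neq\emptyset$ and $\max_{x\in M_t}\beta_{(i)}^{1/2}\sigma_t(x)\le(1+\overline\delta)\eta_{(i)}$, increase $i$ by one. For BO, $\epsilon$-accuracy at time $t$ means that $M_t$ contains every maximizer $x^*$ of $f$ and that $f(x^*)-f(x)\le\epsilon$ for all $x\in M_t$. For LSE it means that $f>h$ on $H_t$,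 $f<h$ on $L_t$ and $|f-h|\le\epsilon/2$ on $M_t$. Claim. Fix $\delta\in(0,1)$ and $0<\epsilon<4(1+\overline\delta)$. For $T\ge1$ put $$\gamma_T=\max_{x_1,\dots,x_T\in D}\tfrac12\log\det\big(I_T+\sigma^{-2}[k(x_i,x_j)]_{i,j}\big),\qquad\beta_T=2\log\frac{|D|T^2\pi^2}{6\delta},\qquad C_1=\frac1{\log(1+\sigma^{-2})},$$ and $\Lambda_T=\log\frac{16(1+\overline\delta)^2|D|\beta_T}{\overline\delta^2\epsilon^2}$. There exist $\beta_{(i)}>1$, not depending on $T$, such that for BO, and for LSE with every threshold $h$, the following holds. For every integer $T\ge1$ with $$T\ \ge\ B_T:=\bigg(2\sigma^2\gamma_T\beta_T\frac{96(1+\overline\delta)^2}{\epsilon^2}+C_1\gamma_T\beta_T\frac{6(1+\overline\delta)^2}{\sigma^2}+2\max\Big\{1,\Big\lceil\log_2\frac{32(1+\overline\delta)^2}{\epsilon\sigma}\Big\rceil\Big\}\bigg)\Lambda_T,$$ with probability at least $1-\delta$ we have $\epsilon$-accuracy at all times $t\ge T$. Moreover, up to logarithmic factors and constants depending only on $\overline\delta$,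 this condition is of the form $T\ge\Omega^*\big(\frac{\sigma^2\gamma_T\beta_T}{\epsilon^2}+\frac{C_1\gamma_T\beta_T}{\sigma^2}+1\big)$: with $X_T=\frac{\sigma^2\gamma_T\beta_T}{\epsilon^2}+\frac{C_1\gamma_T\beta_T}{\sigma^2}+1$, for every $T\ge1$ with $\Lambda_T\ge0$, $$2X_T\Lambda_T\ \le\ B_T\ \le\ 192(1+\overline\delta)^2X_T\Big(1+\Big|\log_2\frac{32(1+\overline\delta)^2}{\epsilon\sigma}\Big|\Big)\Lambda_T.$$ -/

import Mathlib

open MeasureTheory ProbabilityTheory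

noncomputable section

namespace TruVaR

/-! ### Gaussian-process posterior with homoscedastic noise of variance `s` -/

section Posterior

/-- The kernel matrix `[k(xᵢ, xⱼ)]` of a finite family of points (repetitions allowed). -/
def gram {D ι : Type*} (k : D → D → ℝ) (p : ι → D) : Matrix ι ι ℝ :=
  Matrix.of fun i j => k (p i) (p j)

/-- `K + Σ`, with `Σ = s • I`. -/
def noisyGram {D ι : Type*} [DecidableEq ι] (k : D → D → ℝ) (s : ℝ) (p : ι → D) :
    Matrix ι ι ℝ :=
  gram k p + Matrix.diagonal fun _ => s

/-- Posterior mean at `x` after observing the values `y` at the points `p`. -/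
def postMean {D ι : Type*} [Fintype ι] [DecidableEq ι] (k : D → D → ℝ) (s : ℝ)
    (p : ι → D) (y : ι → ℝ) (x : D) : ℝ :=
  (fun i => k (p i) x) ⬝ᵥ ((noisyGram k s p)⁻¹).mulVec y

/-- Posterior variance at `x` after sampling at the points `p`. -/
def postVar {D ι : Type*} [Fintype ι] [DecidableEq ι] (k : D → D → ℝ) (s : ℝ)
    (p : ι → D) (x : D) : ℝ :=
  k x x - (fun i => k (p i) x) ⬝ᵥ ((noisyGram k s p)⁻¹).mulVec (fun i => k (p i) x)

/-- The variance reduction `ψ_{t,x}(S) = σ_t²(x) - σ_{t|S}²(x)`, where the points `p` have been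
sampled and `S` is a collection of additional points. Collections with duplicates are sets in the
expanded ground set `D × {1, …, N}`. -/
def varReduction {D : Type*} [DecidableEq D] (k : D → D → ℝ) (s : ℝ) {t N : ℕ}
    (p : Fin t → D) (x : D) (S : Finset (D × Fin N)) : ℝ :=
  postVar k s p x -
    postVar k s (Sum.elim p (fun a : {a : D × Fin N // a ∈ S} => a.1.1)) x

/-- The variance reduction function is submodular, for any time, any previously selected points
and any query point. -/
def SubmodularVarReduction {D : Type*} [DecidableEq D] (k : D → D → ℝ) (s : ℝ) : Prop :=
  ∀ (t : ℕ) (p : Fin t → D) (x : D) (N : ℕ) (A B : Finset (D × Fin N)),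
    varReduction k s p x (A ∪ B) + varReduction k s p x (A ∩ B) ≤
      varReduction k s p x A + varReduction k s p x B

/-- The maximum information gain
`γ_T = max_{x₁,…,x_T} ½ log det (I + σ⁻² K)`, with `s = σ²`. -/
def infoGain {D : Type*} (k : D → D → ℝ) (s : ℝ) (T : ℕ) : ℝ :=
  ⨆ p : Fin T → D, (1 / 2) * Real.log ((1 + s⁻¹ • gram k p).det)

end Posterior

/-! ### The algorithm (noise variance `s`, unit costs) -/

section Algorithm

/-- Bayesian optimization, or level-set estimation with threshold `h`. -/
inductive Task : Type
  | bo : Task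
  | lse (h : ℝ) : Task

/-- The inputs of the algorithm. Epochs are numbered from `1`. -/
structure Params (D : Type*) where
  /-- the kernel -/
  k : D → D → ℝ
  /-- the noise variance -/
  s : ℝ
  /-- the slack `δ̄` -/
  dbar : ℝ
  /-- the factor `r` -/
  r : ℝ
  /-- the initial target `η₍₁₎` -/
  eta1 : ℝ
  /-- the confidence parameters `β₍ᵢ₎`, `i ≥ 1` -/
  beta : ℕ → ℝ

/-- `η₍ᵢ₎ = η₍₁₎ r^(i-1)`. -/
def Params.eta {D : Type*} (P : Params D) (i : ℕ) : ℝ := P.eta1 * P.r ^ (i - 1)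

/-- The state after some time step. `hist` lists the pairs `(x_t, y_t)`, latest first. -/
structure State (D : Type*) where
  /-- points and observations so far -/
  hist : List (D × ℝ)
  /-- potential maximizers, or unclassified points -/
  M : Finset D
  /-- points classified as above the threshold -/
  H : Finset D
  /-- points classified as below the threshold -/
  L : Finset D
  /-- the current epoch -/
  epoch : ℕ

/-- The sampled points of a history. -/
def pts {D : Type*} (l : List (D × ℝ)) : Fin l.length → D := fun i => (l.get i).1

/-- The observed values of a history. -/
def vals {D : Type*} (l : List (D × ℝ)) : Fin l.length → ℝ := fun i => (l.get i).2

/-- `μ_t(x)`. -/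
def Params.mean {D : Type*} (P : Params D) (l : List (D × ℝ)) (x : D) : ℝ :=
  postMean P.k P.s (pts l) (vals l) x

/-- `σ_t²(x)`. -/
def Params.var {D : Type*} (P : Params D) (l : List (D × ℝ)) (x : D) : ℝ :=
  postVar P.k P.s (pts l) x

/-- `σ²_{t|x'}(x)`: the posterior variance at `x` if `x'` is sampled in addition. -/
def Params.varAfter {D : Type*} (P : Params D) (l : List (D × ℝ)) (x' x : D) : ℝ :=
  postVar P.k P.s (Sum.elim (pts l) (fun _ : Fin 1 => x')) x

/-- `u_t(x)`, with the confidence parameter of epoch `i`. -/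
def Params.upper {D : Type*} (P : Params D) (l : List (D × ℝ)) (i : ℕ) (x : D) : ℝ :=
  P.mean l x + Real.sqrt (P.beta i) * Real.sqrt (P.var l x)

/-- `ℓ_t(x)`, with the confidence parameter of epoch `i`. -/
def Params.lower {D : Type*} (P : Params D) (l : List (D × ℝ)) (i : ℕ) (x : D) : ℝ :=
  P.mean l x - Real.sqrt (P.beta i) * Real.sqrt (P.var l x)

/-- The initial state: `M = D`, epoch `1`. -/
def State.init (D : Type*) [Fintype D] : State D :=
  { hist := [], M := Finset.univ, H := ∅, L := ∅, epoch := 1 }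

/-- The acquisition function: the reduction of the sum of truncated variances over the current
`M` obtained by sampling `x`. -/
def Params.acq {D : Type*} (P : Params D) (S : State D) (x : D) : ℝ :=
  (∑ y ∈ S.M, max (P.beta S.epoch * P.var S.hist y) (P.eta S.epoch ^ 2)) -
    ∑ y ∈ S.M, max (P.beta S.epoch * P.varAfter S.hist x y) (P.eta S.epoch ^ 2)

open Classical in
/-- The maximizers of the acquisition function. -/
def Params.argmaxAcq {D : Type*} [Fintype D] (P : Params D) (S : State D) : Finset D :=
  Finset.univ.filter fun x => ∀ x', P.acq S x' ≤ P.acq S x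

/-- Epoch `j` is complete: `max_{x ∈ M} β₍ⱼ₎^{1/2} σ_t(x) ≤ (1 + δ̄) η₍ⱼ₎`. -/
def Params.EpochDone {D : Type*} (P : Params D) (l : List (D × ℝ)) (M : Finset D) (j : ℕ) :
    Prop :=
  ∀ x ∈ M, Real.sqrt (P.beta j) * Real.sqrt (P.var l x) ≤ (1 + P.dbar) * P.eta j

open Classical in
/-- The loop that increments the epoch as long as the current epoch is complete. If no point
is left in `M`, the loop would never stop, and the epoch is left unchanged. For nonempty `M` and
`1 < β₍ⱼ₎` for all `j` it always stops, because `η₍ⱼ₎ → 0` and `σ_t > 0`. -/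
def Params.nextEpoch {D : Type*} (P : Params D) (l : List (D × ℝ)) (M : Finset D) (i : ℕ) : ℕ :=
  if h : ∃ j, i ≤ j ∧ ¬ P.EpochDone l M j then Nat.find h else i

open Classical in
/-- The update of `M`. -/
def Params.newM {D : Type*} (P : Params D) (task : Task) (S : State D) (l : List (D × ℝ)) :
    Finset D :=
  match task with
  | Task.bo => S.M.filter fun x => ∀ x' ∈ S.M, P.lower l S.epoch x' ≤ P.upper l S.epoch x
  | Task.lse h => S.M.filter fun x => h ≤ P.upper l S.epoch x ∧ P.lower l S.epoch x ≤ h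

open Classical in
/-- The update of `H` (only used for level-set estimation). -/
def Params.newH {D : Type*} (P : Params D) (task : Task) (S : State D) (l : List (D × ℝ)) :
    Finset D :=
  match task with
  | Task.bo => S.H
  | Task.lse h => S.H ∪ S.M.filter fun x => h < P.lower l S.epoch x

open Classical in
/-- The update of `L` (only used for level-set estimation). -/
def Params.newL {D : Type*} (P : Params D) (task : Task) (S : State D) (l : List (D × ℝ)) :
    Finset D :=
  match task with
  | Task.bo => S.L
  | Task.lse h => S.L ∪ S.M.filter fun x => P.upper l S.epoch x < h

/-- The state after observing `y` at the point `x`. -/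
def Params.update {D : Type*} (P : Params D) (task : Task) (S : State D) (x : D) (y : ℝ) :
    State D :=
  { hist := (x, y) :: S.hist
    M := P.newM task S ((x, y) :: S.hist)
    H := P.newH task S ((x, y) :: S.hist)
    L := P.newL task S ((x, y) :: S.hist)
    epoch := P.nextEpoch ((x, y) :: S.hist) (P.newM task S ((x, y) :: S.hist)) S.epoch }

/-- The state after time step `t`, when the reward function is `f`, the noise in the `t`-th
observation is `z (t - 1)`, and ties in the `argmax` are broken by `sel`. -/
def Params.run {D : Type*} [Fintype D] (P : Params D) (task : Task) (sel : ℕ → Finset D → D)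
    (f : D → ℝ) (z : ℕ → ℝ) : ℕ → State D
  | 0 => State.init D
  | t + 1 =>
    let S := P.run task sel f z t
    let x := sel t (P.argmaxAcq S)
    P.update task S x (f x + z t)

/-- `ε`-accuracy of a state, for the reward function `f`. -/
def Accurate {D : Type*} (task : Task) (f : D → ℝ) (ε : ℝ) (S : State D) : Prop :=
  match task with
  | Task.bo =>
      ∀ xs, (∀ x, f x ≤ f xs) → xs ∈ S.M ∧ ∀ x ∈ S.M, f xs - f x ≤ ε
  | Task.lse h =>
      (∀ x ∈ S.H, h < f x) ∧ (∀ x ∈ S.L, f x < h) ∧ (∀ x ∈ S.M, |f x - h| ≤ ε / 2)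

end Algorithm

/-! ### The quantities in the sampling bound -/

section Bound

/-- `β_T = 2 log (|D| T² π² / (6 δ))`, with `n = |D|`. -/
def betaT (n : ℕ) (δ : ℝ) (T : ℕ) : ℝ :=
  2 * Real.log ((n : ℝ) * (T : ℝ) ^ 2 * Real.pi ^ 2 / (6 * δ))

/-- `C₁ = 1 / log (1 + σ⁻²)`. -/
def C1 (σ : ℝ) : ℝ := 1 / Real.log (1 + (σ ^ 2)⁻¹)

/-- The logarithmic factor `log (16 (1 + δ̄)² |D| β / (δ̄² ε²))`. -/
def logFactor (n : ℕ) (dbar ε β : ℝ) : ℝ :=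
  Real.log (16 * (1 + dbar) ^ 2 * (n : ℝ) * β / (dbar ^ 2 * ε ^ 2))

/-- The right-hand side of the condition on `T`, in terms of `γ = γ_T` and `β = β_T`. -/
def improvedBound (n : ℕ) (σ dbar ε γ β : ℝ) : ℝ :=
  (2 * σ ^ 2 * γ * β * (96 * (1 + dbar) ^ 2 / ε ^ 2)
    + C1 σ * γ * β * (6 * (1 + dbar) ^ 2 / σ ^ 2)
    + 2 * ((max 1 ⌈Real.logb 2 (32 * (1 + dbar) ^ 2 / (ε * σ))⌉ : ℤ) : ℝ))
    * logFactor n dbar ε β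

/-- The leading-order expression `σ² γ β / ε² + C₁ γ β / σ² + 1`. -/
def leadingOrder (σ ε γ β : ℝ) : ℝ :=
  σ ^ 2 * γ * β / ε ^ 2 + C1 σ * γ * β / σ ^ 2 + 1

end Bound

end TruVaR

end

/-!
The second claim, on the order of the bound, is elementary. The first one combines a deterministic
bound on the number of time steps with a union bound over time.

*Posterior variance.* `postVar` is the least mean squared error of a linear predictor
(`postVar_le_sqErr`). Hence it decreases under additional samples, and `m` samples of a point bring
it down to `s / m` there. By the chain rule for determinants, sampling greedily where the variance
exceeds `v` accumulates information at rate `log (1 + v / s) / 2`; so `K ≤ T` samples with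
`K log (1 + v / s) > 2 γ_T` exist that bring all variances down to `v` (`exists_postVar_le`).

*Greedy progress.* Submodularity survives truncation in the form of subadditivity
(`max_sub_le_sum_max_sub`). If `K` samples reach the target of an epoch, each step made in that
epoch thus shrinks the sum of the excesses of the truncated variances over `η₍ᵢ₎²` by the factor
`1 - 1 / K`, while an unfinished epoch has a definite amount of excess left. This bounds the number
of steps in an epoch by `⌈K Λ⌉` (`Params.stepCount_lt`). The epoch lengths form geometric sums,
which add up to at most `T` under the sampling bound (`sum_epochLength_le`); the steps with target
variance below and above the noise level give its first and its second term, and rounding the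
third. So all half-widths on `M` are at most `ε / 4` at time `T`, whatever has been observed.

*Confidence parameters.* Let `T` be the least time that satisfies the sampling bound. The epochs
that matter for accuracy `ε` get the parameter `β_T`, and they are over by time `T²`: the slack
between `Λ` and `3 Λ` covers the rest of the last one. The parameter `b` of each later epoch is
chosen recursively so large that it dominates `2 log (5 |D| t² / δ)` up to the end of the epoch;
this is possible since the length of the epoch is at most polynomial in `b`
(`exists_late_beta`, `exists_schedule`).

*Probability.* For deterministic points the error of the posterior mean is Gaussian and uncorrelated
with the observations, hence independent of them. The event that the run samples given points is
determined by the observations at these points, so that the Gaussian tail bound `exp (-b / 2)` holds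
along the run (`GPModel.measure_error_le`). Up to time `T²` the failures sum up to at most
`T² · |D| exp (-β_T / 2) = 6 δ / π²`, and later ones to at most `∑ δ / (5 t²) = δ π² / 30`; the sum
is below `δ`. If all confidence intervals are valid, half-widths `ε / 4` imply `ε`-accuracy from
then on (`Params.Confident.accurate`).
-/

namespace TruVaR

/-! ### The posterior variance as an optimal prediction error -/

open Matrix in
/-- The mean squared error of the linear predictor of `f x` with weights `w` on the noisy
observations at the points `p`. -/
def sqErr {D ι : Type*} [Fintype ι] [DecidableEq ι] (k : D → D → ℝ) (s : ℝ) (p : ι → D) (x : D)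
    (w : ι → ℝ) : ℝ :=
  k x x - 2 * (w ⬝ᵥ fun i => k (p i) x) + w ⬝ᵥ (noisyGram k s p *ᵥ w)

/-- The weights of the posterior mean. -/
noncomputable def postWeights {D ι : Type*} [Fintype ι] [DecidableEq ι] (k : D → D → ℝ) (s : ℝ)
    (p : ι → D) (x : D) : ι → ℝ :=
  ((noisyGram k s p)⁻¹).mulVec fun i => k (p i) x

section

variable {D ι κ : Type*} [DecidableEq ι] [DecidableEq κ]
  {k : D → D → ℝ} {s : ℝ}

lemma kernel_symm (hk : (Matrix.of k).PosSemidef) (x y : D) : k x y = k y x := by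
  simpa using (hk.1.apply x y).symm

lemma noisyGram_posDef (hk : (Matrix.of k).PosSemidef) (hs : 0 < s) (p : ι → D) :
    (noisyGram k s p).PosDef :=
  Matrix.PosDef.posSemidef_add (hk.submatrix p) (Matrix.PosDef.diagonal fun _ => hs)

lemma noisyGram_transpose (hk : (Matrix.of k).PosSemidef) (p : ι → D) :
    (noisyGram k s p).transpose = noisyGram k s p := by
  ext i j
  simp only [noisyGram, gram, Matrix.transpose_apply, Matrix.add_apply, Matrix.of_apply,
    Matrix.diagonal_apply, kernel_symm hk (p j) (p i), eq_comm (a := j)]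

lemma one_add_smul_gram (hs : 0 < s) (p : ι → D) :
    1 + s⁻¹ • gram k p = s⁻¹ • noisyGram k s p := by
  ext i j
  simp only [noisyGram, Matrix.add_apply, Matrix.smul_apply, smul_eq_mul, Matrix.one_apply,
    Matrix.diagonal_apply]
  split_ifs <;> field_simp <;> ring

variable [Fintype ι] [Fintype κ]

/-- The normal equations. -/
lemma noisyGram_mulVec_postWeights (hk : (Matrix.of k).PosSemidef) (hs : 0 < s) (p : ι → D)
    (x : D) : (noisyGram k s p).mulVec (postWeights k s p x) = fun i => k (p i) x := by
  have h := (noisyGram_posDef hk hs p).isUnit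
  rw [postWeights, Matrix.mulVec_mulVec,
    Matrix.mul_nonsing_inv _ ((Matrix.isUnit_iff_isUnit_det _).1 h), Matrix.one_mulVec]

lemma postVar_eq (p : ι → D) (x : D) :
    postVar k s p x = k x x - (fun i => k (p i) x) ⬝ᵥ postWeights k s p x := rfl

lemma postMean_eq (hk : (Matrix.of k).PosSemidef) (p : ι → D) (y : ι → ℝ) (x : D) :
    postMean k s p y x = postWeights k s p x ⬝ᵥ y := by
  rw [postMean, postWeights, Matrix.dotProduct_mulVec, ← Matrix.mulVec_transpose,
    Matrix.transpose_nonsing_inv, noisyGram_transpose hk]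

/-- Completing the square: the posterior weights are optimal. -/
lemma sqErr_eq (hk : (Matrix.of k).PosSemidef) (hs : 0 < s) (p : ι → D) (x : D) (w : ι → ℝ) :
    sqErr k s p x w = postVar k s p x +
      (w - postWeights k s p x) ⬝ᵥ (noisyGram k s p).mulVec (w - postWeights k s p x) := by
  have h1 := noisyGram_mulVec_postWeights hk hs p x
  have h2 : postWeights k s p x ⬝ᵥ (noisyGram k s p).mulVec w = w ⬝ᵥ fun i => k (p i) x := by
    rw [Matrix.dotProduct_mulVec, ← Matrix.mulVec_transpose, noisyGram_transpose hk, h1,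
      dotProduct_comm]
  rw [sqErr, postVar_eq, Matrix.mulVec_sub, h1, sub_dotProduct, dotProduct_sub, dotProduct_sub, h2,
    dotProduct_comm _ (postWeights k s p x)]
  ring

lemma sqErr_postWeights (hk : (Matrix.of k).PosSemidef) (hs : 0 < s) (p : ι → D) (x : D) :
    sqErr k s p x (postWeights k s p x) = postVar k s p x := by
  rw [sqErr_eq hk hs]; simp

lemma postVar_le_sqErr (hk : (Matrix.of k).PosSemidef) (hs : 0 < s) (p : ι → D) (x : D)
    (w : ι → ℝ) : postVar k s p x ≤ sqErr k s p x w := by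
  rw [sqErr_eq hk hs]
  have := (noisyGram_posDef hk hs p).posSemidef.dotProduct_mulVec_nonneg
    (w - postWeights k s p x)
  simp only [star_trivial] at this
  linarith

lemma noisyGram_quadForm (p : ι → D) (w : ι → ℝ) :
    w ⬝ᵥ (noisyGram k s p).mulVec w =
      ∑ i, ∑ j, w i * w j * k (p i) (p j) + s * ∑ i, w i ^ 2 := by
  rw [noisyGram, Matrix.add_mulVec, dotProduct_add]
  congr 1
  · simp only [dotProduct, Matrix.mulVec, gram, Matrix.of_apply, Finset.mul_sum]
    exact Finset.sum_congr rfl fun i _ => Finset.sum_congr rfl fun j _ => by ring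
  · simp only [dotProduct, Matrix.mulVec_diagonal, Finset.mul_sum]
    exact Finset.sum_congr rfl fun i _ => by ring

/-- The error of a linear predictor is the contribution of the noise plus a value of the positive
semidefinite form of `k`. -/
lemma sum_sq_le_sqErr (hk : (Matrix.of k).PosSemidef) (p : ι → D) (x : D) (w : ι → ℝ) :
    s * ∑ i, w i ^ 2 ≤ sqErr k s p x w := by
  have h := (hk.submatrix (Sum.elim p fun _ : Unit => x)).dotProduct_mulVec_nonneg
    (Sum.elim (-w) fun _ => 1)
  simp only [dotProduct, Matrix.mulVec, Fintype.sum_sum_type, star_trivial, Matrix.submatrix_apply,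
    Sum.elim_inl, Sum.elim_inr, Matrix.of_apply, Pi.neg_apply, Finset.univ_unique,
    Finset.sum_singleton, mul_one, one_mul] at h
  have e1 : ∑ i, -w i * (∑ j, k (p i) (p j) * -w j + k (p i) x) =
      ∑ i, ∑ j, w i * w j * k (p i) (p j) - w ⬝ᵥ fun i => k (p i) x := by
    rw [dotProduct, ← Finset.sum_sub_distrib]
    refine Finset.sum_congr rfl fun i _ => ?_
    rw [mul_add, Finset.mul_sum, sub_eq_add_neg, neg_mul]
    congr 1
    exact Finset.sum_congr rfl fun j _ => by ring
  have e2 : ∑ j, k x (p j) * -w j = -(w ⬝ᵥ fun i => k (p i) x) := by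
    rw [dotProduct, ← Finset.sum_neg_distrib]
    exact Finset.sum_congr rfl fun j _ => by rw [kernel_symm hk x]; ring
  rw [e1, e2] at h
  rw [sqErr, noisyGram_quadForm]
  linarith

lemma postVar_pos (hk : (Matrix.of k).PosSemidef) (hk1 : ∀ x, k x x = 1) (hs : 0 < s)
    (p : ι → D) (x : D) : 0 < postVar k s p x := by
  rw [← sqErr_postWeights hk hs]
  set w := postWeights k s p x
  by_cases hw : w = 0
  · simp [sqErr, hw, hk1]
  · refine lt_of_lt_of_le (mul_pos hs ?_) (sum_sq_le_sqErr hk p x w)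
    obtain ⟨i, hi⟩ := Function.ne_iff.1 hw
    exact Finset.sum_pos' (fun j _ => sq_nonneg _) ⟨i, Finset.mem_univ _, by
      have : w i ≠ 0 := hi
      positivity⟩

lemma postVar_le_one (hk : (Matrix.of k).PosSemidef) (hk1 : ∀ x, k x x = 1) (hs : 0 < s)
    (p : ι → D) (x : D) : postVar k s p x ≤ 1 :=
  (postVar_le_sqErr hk hs p x 0).trans (by simp [sqErr, hk1])

/-- Extra samples do not increase the posterior variance: put weight zero on them. -/
lemma postVar_mono (hk : (Matrix.of k).PosSemidef) (hs : 0 < s) {p : ι → D} {q : κ → D}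
    {g : ι → κ} (hg : Function.Injective g) (hpq : ∀ i, q (g i) = p i) (x : D) :
    postVar k s q x ≤ postVar k s p x := by
  classical
  rw [← sqErr_postWeights hk hs p]
  set w := postWeights k s p x
  refine (postVar_le_sqErr hk hs q x (Function.extend g w 0)).trans (le_of_eq ?_)
  have hsum : ∀ F : κ → ℝ, (∀ j, j ∉ Set.range g → F j = 0) → ∑ j, F j = ∑ i, F (g i) := by
    intro F hF
    rw [← Finset.sum_image (s := (Finset.univ : Finset ι)) (g := g) (f := F) hg.injOn]
    refine (Finset.sum_subset (Finset.subset_univ _) fun j _ hj => hF j ?_).symm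
    simpa using hj
  have h0 : ∀ j, j ∉ Set.range g → Function.extend g w 0 j = 0 := fun j hj =>
    Function.extend_apply' _ _ _ hj
  have h1 : ∀ (c : ℝ) (y : D), ∑ j, c * Function.extend g w 0 j * k y (q j) =
      ∑ i, c * w i * k y (p i) := fun c y => by
    rw [hsum _ fun j hj => by simp [h0 j hj]]
    simp only [hg.extend_apply, hpq]
  rw [sqErr, sqErr, noisyGram_quadForm, noisyGram_quadForm]
  simp only [dotProduct, h1]
  rw [hsum _ fun j hj => by rw [h0 j hj, zero_mul], hsum _ fun j hj => by simp [h0 j hj],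
    hsum _ fun j hj => by simp [h0 j hj]]
  simp only [hg.extend_apply, hpq]

lemma postVar_equiv (hk : (Matrix.of k).PosSemidef) (hs : 0 < s) {p : ι → D} {q : κ → D}
    (e : ι ≃ κ) (hpq : ∀ i, q (e i) = p i) (x : D) : postVar k s q x = postVar k s p x :=
  le_antisymm (postVar_mono hk hs e.injective hpq x)
    (postVar_mono hk hs e.symm.injective (fun j => by rw [← hpq, e.apply_symm_apply]) x)

/-- If `x` occurs `m` times among the points, averaging the `m` observations at `x` predicts `f x`
with squared error `s / m`. -/
lemma postVar_le_of_repeat (hk : (Matrix.of k).PosSemidef) (hs : 0 < s) {m : ℕ} (hm : 0 < m)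
    {p : ι → D} {g : Fin m → ι} (hg : Function.Injective g) {x : D} (hx : ∀ i, p (g i) = x) :
    postVar k s p x ≤ s / m := by
  refine (postVar_mono hk hs (p := fun _ : Fin m => x) hg hx x).trans ?_
  refine (postVar_le_sqErr hk hs _ x fun _ => (m : ℝ)⁻¹).trans (le_of_eq ?_)
  have : (m : ℝ) ≠ 0 := by positivity
  rw [sqErr, noisyGram_quadForm]
  simp [dotProduct]
  field_simp
  ring

open Matrix in
lemma det_noisyGram_cons (p : ι → D) (x : D) (hk : (Matrix.of k).PosSemidef) (hs : 0 < s) :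
    (noisyGram k s (Sum.elim p fun _ : Fin 1 => x)).det =
      (noisyGram k s p).det * (s + postVar k s p x) := by
  have h : noisyGram k s (Sum.elim p fun _ : Fin 1 => x) =
      Matrix.fromBlocks (noisyGram k s p) (Matrix.of fun i _ => k (p i) x)
        (Matrix.of fun _ i => k (p i) x) (Matrix.of fun _ _ => k x x + s) := by
    ext i j
    rcases i with i | i <;> rcases j with j | j
    · simp [noisyGram, gram, Matrix.diagonal_apply]
    · simp [noisyGram, gram]
    · simp [noisyGram, gram, kernel_symm hk x]
    · simp [noisyGram, gram, Subsingleton.elim i j]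
  have hu := (noisyGram_posDef hk hs p).isUnit
  let := hu.invertible
  rw [h, Matrix.det_fromBlocks₁₁]
  congr 1
  rw [Matrix.det_fin_one, Matrix.sub_apply, Matrix.mul_assoc, Matrix.mul_apply, postVar_eq,
    postWeights, dotProduct, Matrix.invOf_eq_nonsing_inv]
  simp only [Matrix.of_apply, Matrix.mul_apply, Matrix.mulVec, dotProduct]
  ring

/-- Chain rule for the information gain. -/
lemma det_gram_cons (hk : (Matrix.of k).PosSemidef) (hs : 0 < s) (p : ι → D) (x : D) :
    (1 + s⁻¹ • gram k (Sum.elim p fun _ : Fin 1 => x)).det =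
      (1 + s⁻¹ • gram k p).det * (1 + postVar k s p x / s) := by
  rw [one_add_smul_gram hs, one_add_smul_gram hs, Matrix.det_smul, Matrix.det_smul,
    det_noisyGram_cons p x hk hs]
  simp only [Fintype.card_sum, Fintype.card_fin, pow_succ]
  field_simp

lemma det_gram_equiv (p : ι → D) (q : κ → D) (e : ι ≃ κ) (hpq : ∀ i, q (e i) = p i) :
    (1 + s⁻¹ • gram k q).det = (1 + s⁻¹ • gram k p).det := by
  rw [← Matrix.det_submatrix_equiv_self e]
  congr 1
  ext i j
  simp [gram, hpq, Matrix.one_apply]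

end

/-! ### Uncertainty sampling and the information gain -/

section InfoGain

variable {D : Type*} {k : D → D → ℝ} {s : ℝ}

lemma det_gram_pos (hk : (Matrix.of k).PosSemidef) (hs : 0 < s) {n : ℕ} (p : Fin n → D) :
    0 < (1 + s⁻¹ • gram k p).det := by
  rw [one_add_smul_gram hs, Matrix.det_smul]
  exact mul_pos (by positivity) (noisyGram_posDef hk hs p).det_pos

lemma exists_det_gram_succ (hk : (Matrix.of k).PosSemidef) (hs : 0 < s) {n : ℕ} (p : Fin n → D)
    (x : D) : ∃ q : Fin (n + 1) → D,
      (1 + s⁻¹ • gram k q).det = (1 + s⁻¹ • gram k p).det * (1 + postVar k s p x / s) := by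
  refine ⟨Sum.elim p (fun _ : Fin 1 => x) ∘ finSumFinEquiv.symm, ?_⟩
  rw [← det_gram_cons hk hs]
  exact det_gram_equiv _ _ finSumFinEquiv fun i => by simp

lemma det_gram_le_of_le [Nonempty D] (hk : (Matrix.of k).PosSemidef) (hk1 : ∀ x, k x x = 1)
    (hs : 0 < s) {n m : ℕ} (hnm : n ≤ m) (p : Fin n → D) :
    ∃ q : Fin m → D, (1 + s⁻¹ • gram k p).det ≤ (1 + s⁻¹ • gram k q).det := by
  induction m, hnm using Nat.le_induction with
  | base => exact ⟨p, le_rfl⟩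
  | succ m _ ih =>
    obtain ⟨q, hq⟩ := ih
    obtain ⟨q', hq'⟩ := exists_det_gram_succ hk hs q (Classical.arbitrary D)
    refine ⟨q', hq.trans ?_⟩
    rw [hq']
    have := postVar_pos hk hk1 hs q (Classical.arbitrary D)
    exact le_mul_of_one_le_right (det_gram_pos hk hs q).le (by
      have : 0 < postVar k s q (Classical.arbitrary D) / s := by positivity
      linarith)

lemma log_det_gram_le_infoGain [Fintype D] [Nonempty D] (hk : (Matrix.of k).PosSemidef)
    (hk1 : ∀ x, k x x = 1) (hs : 0 < s) {n T : ℕ} (hn : n ≤ T) (p : Fin n → D) :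
    Real.log (1 + s⁻¹ • gram k p).det ≤ 2 * infoGain k s T := by
  obtain ⟨q, hq⟩ := det_gram_le_of_le hk hk1 hs hn p
  have h1 := Real.log_le_log (det_gram_pos hk hs p) hq
  have h2 : (1 / 2) * Real.log (1 + s⁻¹ • gram k q).det ≤ infoGain k s T :=
    le_ciSup (f := fun p : Fin T → D => (1 / 2) * Real.log ((1 + s⁻¹ • gram k p).det))
      (Set.finite_range _).bddAbove q
  linarith

/-- Sampling, as long as possible, a point of posterior variance larger than `v` either reaches
uniformly small variance or accumulates information. -/
lemma exists_postVar_le_or_pow_le_det [Nonempty D] (hk : (Matrix.of k).PosSemidef)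
    (hs : 0 < s) {v : ℝ} (hv : 0 ≤ v) (n : ℕ) :
    (∃ p : Fin n → D, ∀ x, postVar k s p x ≤ v) ∨
      ∃ p : Fin n → D, (1 + v / s) ^ n ≤ (1 + s⁻¹ • gram k p).det := by
  induction n with
  | zero => right; exact ⟨Fin.elim0, by simp⟩
  | succ n ih =>
    have extend : ∀ p : Fin n → D, (∀ x, postVar k s p x ≤ v) →
        ∃ p : Fin (n + 1) → D, ∀ x, postVar k s p x ≤ v := fun p hp =>
      ⟨Fin.snoc p (Classical.arbitrary D), fun x =>
        (postVar_mono hk hs (Fin.castSucc_injective n) (fun i => by simp) x).trans (hp x)⟩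
    rcases ih with ⟨p, hp⟩ | ⟨p, hp⟩
    · exact Or.inl (extend p hp)
    by_cases h : ∀ x, postVar k s p x ≤ v
    · exact Or.inl (extend p h)
    push Not at h
    obtain ⟨x, hx⟩ := h
    obtain ⟨q, hq⟩ := exists_det_gram_succ hk hs p x
    refine Or.inr ⟨q, ?_⟩
    rw [hq, pow_succ]
    have h1 : 0 ≤ v / s := by positivity
    have h2 := (det_gram_pos hk hs p).le
    gcongr

/-- If `K ≤ T` exceeds `2 γ_T / log (1 + v / s)`, some `K` samples bring all posterior variances
down to `v`. -/
lemma exists_postVar_le [Fintype D] [Nonempty D] (hk : (Matrix.of k).PosSemidef)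
    (hk1 : ∀ x, k x x = 1) (hs : 0 < s) {v : ℝ} (hv : 0 ≤ v) {K T : ℕ} (hKT : K ≤ T)
    (hK : 2 * infoGain k s T < K * Real.log (1 + v / s)) :
    ∃ p : Fin K → D, ∀ x, postVar k s p x ≤ v := by
  rcases exists_postVar_le_or_pow_le_det hk hs hv K with h | ⟨p, hp⟩
  · exact h
  have h1 : 0 ≤ v / s := by positivity
  have h2 := Real.log_le_log (by positivity) hp
  rw [Real.log_pow] at h2
  have h3 := log_det_gram_le_infoGain hk hk1 hs hKT p
  linarith

lemma log_one_add_inv_le_infoGain [Fintype D] [Nonempty D] (hk : (Matrix.of k).PosSemidef)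
    (hk1 : ∀ x, k x x = 1) (hs : 0 < s) {T : ℕ} (hT : 1 ≤ T) :
    Real.log (1 + s⁻¹) ≤ 2 * infoGain k s T := by
  obtain ⟨q, hq⟩ := exists_det_gram_succ hk hs Fin.elim0 (Classical.arbitrary D)
  have h := log_det_gram_le_infoGain hk hk1 hs hT q
  rw [hq] at h
  simpa [postVar, hk1] using h

/-- Sampling every point `m` times brings all posterior variances down to `s / m`. -/
lemma exists_postVar_le_div [Fintype D] (hk : (Matrix.of k).PosSemidef) (hs : 0 < s) {m : ℕ}
    (hm : 0 < m) : ∃ p : Fin (Fintype.card D * m) → D, ∀ x, postVar k s p x ≤ s / m := by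
  let e : Fin (Fintype.card D * m) ≃ D × Fin m :=
    finProdFinEquiv.symm.trans ((Fintype.equivFin D).symm.prodCongr (Equiv.refl _))
  refine ⟨fun i => (e i).1, fun x => ?_⟩
  refine postVar_le_of_repeat hk hs hm (g := fun j => e.symm (x, j)) ?_ fun j => by simp
  intro a b hab
  simpa using hab

end InfoGain

/-! ### Greedy reduction of the truncated variances -/

section Greedy

variable {D : Type*} [DecidableEq D]

lemma varReduction_empty {k : D → D → ℝ} {s : ℝ} (hk : (Matrix.of k).PosSemidef) (hs : 0 < s)
    {t N : ℕ} (p : Fin t → D) (x : D) :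
    varReduction k s p x (∅ : Finset (D × Fin N)) = 0 := by
  rw [varReduction, sub_eq_zero]
  exact (postVar_equiv hk hs (p := p) (q := Sum.elim p fun a => a.1.1)
    (Equiv.sumEmpty (Fin t) {a : D × Fin N // a ∈ (∅ : Finset (D × Fin N))}).symm
    (fun _ => rfl) x).symm

/-- Submodularity gives subadditivity, because the variance reduction by the empty set is zero. -/
lemma varReduction_le_sum {k : D → D → ℝ} {s : ℝ} (hk : (Matrix.of k).PosSemidef) (hs : 0 < s)
    (hsub : SubmodularVarReduction k s) {t N : ℕ} (p : Fin t → D) (x : D)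
    (S : Finset (D × Fin N)) :
    varReduction k s p x S ≤ ∑ a ∈ S, varReduction k s p x {a} := by
  induction S using Finset.induction_on with
  | empty => rw [varReduction_empty hk hs, Finset.sum_empty]
  | insert a S ha ih =>
    have h := hsub t p x N {a} S
    rw [Finset.singleton_inter_of_notMem ha, varReduction_empty hk hs, ← Finset.insert_eq] at h
    rw [Finset.sum_insert ha]
    linarith

lemma varReduction_singleton {k : D → D → ℝ} {s : ℝ} (hk : (Matrix.of k).PosSemidef) (hs : 0 < s)
    {t N : ℕ} (p : Fin t → D) (x : D) (a : D × Fin N) :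
    varReduction k s p x {a} =
      postVar k s p x - postVar k s (Sum.elim p fun _ : Fin 1 => a.1) x := by
  rw [varReduction]
  congr 1
  let e : Fin 1 ≃ {b : D × Fin N // b ∈ ({a} : Finset (D × Fin N))} :=
    { toFun := fun _ => ⟨a, by simp⟩
      invFun := fun _ => 0
      left_inv := fun i => Subsingleton.elim _ _
      right_inv := fun b => Subtype.ext (Finset.mem_singleton.1 b.2).symm }
  refine postVar_equiv hk hs (Equiv.sumCongr (Equiv.refl (Fin t)) e) (fun i => ?_) x
  rcases i with i | i <;> simp [e]

/-- The `j`-th point of `q` becomes the element `(q j, j)` of the expanded ground set, which keeps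
repeated points apart. -/
lemma postVar_sub_le_sum {k : D → D → ℝ} {s : ℝ} (hk : (Matrix.of k).PosSemidef) (hs : 0 < s)
    (hsub : SubmodularVarReduction k s) {t K : ℕ} (p : Fin t → D) (q : Fin K → D) (x : D) :
    postVar k s p x - postVar k s q x ≤
      ∑ j, (postVar k s p x - postVar k s (Sum.elim p fun _ : Fin 1 => q j) x) := by
  have hinj : Function.Injective fun j : Fin K => (q j, j) := fun a b h => (Prod.ext_iff.1 h).2
  have h := varReduction_le_sum hk hs hsub p x (Finset.univ.image fun j : Fin K => (q j, j))
  rw [Finset.sum_image hinj.injOn] at h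
  simp only [varReduction_singleton hk hs] at h
  refine le_trans ?_ h
  rw [varReduction]
  refine sub_le_sub_left ?_ _
  let g : Fin K → Fin t ⊕ {a : D × Fin K // a ∈ Finset.univ.image fun j : Fin K => (q j, j)} :=
    fun j => Sum.inr ⟨(q j, j), by simp⟩
  refine postVar_mono hk hs (g := g) ?_ (fun j => rfl) x
  intro a b hab
  have h : q a = q b ∧ a = b := by simpa [g] using hab
  exact h.2

lemma min_sum_le {ι : Type*} (S : Finset ι) (g : ι → ℝ) (hg : ∀ i, 0 ≤ g i) {c : ℝ} (hc : 0 ≤ c) :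
    min c (∑ i ∈ S, g i) ≤ ∑ i ∈ S, min c (g i) := by
  classical
  induction S using Finset.induction_on with
  | empty => simp
  | insert a S ha ih =>
    rw [Finset.sum_insert ha, Finset.sum_insert ha]
    have h1 := hg a
    have h2 : 0 ≤ ∑ i ∈ S, min c (g i) := Finset.sum_nonneg fun i _ => le_min hc (hg i)
    rcases le_total c (g a) with h | h
    · rw [min_eq_left h]
      linarith [min_le_left c (g a + ∑ i ∈ S, g i)]
    · rw [min_eq_right h]
      rcases le_total c (∑ i ∈ S, g i) with h' | h'
      · rw [min_eq_left h'] at ih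
        linarith [min_le_left c (g a + ∑ i ∈ S, g i)]
      · rw [min_eq_right h'] at ih
        linarith [min_le_right c (g a + ∑ i ∈ S, g i)]

/-- Truncation preserves subadditivity: if the points `q` bring the variance at `x` down to the
truncation level, then one-point extensions by the points of `q` account together for the whole
excess of the truncated variance over that level. -/
lemma max_sub_le_sum_max_sub {k : D → D → ℝ} {s : ℝ} (hk : (Matrix.of k).PosSemidef) (hs : 0 < s)
    (hsub : SubmodularVarReduction k s) {t K : ℕ} (p : Fin t → D) (q : Fin K → D) (x : D)
    {b e : ℝ} (hb : 0 ≤ b) (hq : b * postVar k s q x ≤ e) :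
    max (b * postVar k s p x) e - e ≤
      ∑ j, (max (b * postVar k s p x) e -
        max (b * postVar k s (Sum.elim p fun _ : Fin 1 => q j) x) e) := by
  have hmono : ∀ j, postVar k s (Sum.elim p fun _ : Fin 1 => q j) x ≤ postVar k s p x := fun j =>
    postVar_mono hk hs Sum.inl_injective (fun _ => rfl) x
  rcases le_total (b * postVar k s p x) e with h | h
  · rw [max_eq_right h, sub_self]
    refine Finset.sum_nonneg fun j _ => ?_
    rw [max_eq_right ((mul_le_mul_of_nonneg_left (hmono j) hb).trans h), sub_self]
  · have h1 : ∀ j, max (b * postVar k s p x) e -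
        max (b * postVar k s (Sum.elim p fun _ : Fin 1 => q j) x) e =
        min (b * postVar k s p x - e)
          (b * (postVar k s p x - postVar k s (Sum.elim p fun _ : Fin 1 => q j) x)) := fun j => by
      rw [max_eq_left h, mul_sub, ← min_sub_sub_left, min_comm]
    simp only [h1]
    refine le_trans ?_ (min_sum_le _ _
      (fun j => mul_nonneg hb (sub_nonneg.2 (hmono j))) (sub_nonneg.2 h))
    rw [max_eq_left h, ← Finset.mul_sum]
    refine le_min le_rfl ?_
    have := mul_le_mul_of_nonneg_left (postVar_sub_le_sum hk hs hsub p q x) hb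
    linarith

end Greedy

/-! ### Deterministic analysis of a run -/

section Step

variable {D : Type*} {P : Params D}

lemma Params.var_cons (hk : (Matrix.of P.k).PosSemidef) (hs : 0 < P.s) (l : List (D × ℝ))
    (x : D) (y : ℝ) (u : D) : P.var ((x, y) :: l) u = P.varAfter l x u := by
  let e : Fin l.length ⊕ Fin 1 ≃ Fin ((x, y) :: l).length :=
    (Equiv.sumComm _ _).trans (finSumFinEquiv.trans (finCongr (by simp [add_comm])))
  refine postVar_equiv hk hs e (fun i => ?_) u
  rcases i with i | i
  · have h : e (Sum.inl i) = i.succ := by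
      apply Fin.ext; simp [e]
    rw [h]; rfl
  · have h : e (Sum.inr i) = (0 : Fin (l.length + 1)) := by
      apply Fin.ext; simp [e]
    rw [h]; rfl

lemma Params.varAfter_le (hk : (Matrix.of P.k).PosSemidef) (hs : 0 < P.s) (l : List (D × ℝ))
    (x u : D) : P.varAfter l x u ≤ P.var l u :=
  postVar_mono hk hs Sum.inl_injective (fun _ => rfl) u

lemma Params.var_pos (hk : (Matrix.of P.k).PosSemidef) (hk1 : ∀ x, P.k x x = 1) (hs : 0 < P.s)
    (l : List (D × ℝ)) (u : D) : 0 < P.var l u :=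
  postVar_pos hk hk1 hs _ u

lemma Params.var_le_one (hk : (Matrix.of P.k).PosSemidef) (hk1 : ∀ x, P.k x x = 1) (hs : 0 < P.s)
    (l : List (D × ℝ)) (u : D) : P.var l u ≤ 1 :=
  postVar_le_one hk hk1 hs _ u

lemma Params.newM_subset (P : Params D) (task : Task) (S : State D) (l : List (D × ℝ)) :
    P.newM task S l ⊆ S.M := by
  cases task <;> exact Finset.filter_subset _ _

lemma Params.le_nextEpoch (P : Params D) (l : List (D × ℝ)) (M : Finset D) (i : ℕ) :
    i ≤ P.nextEpoch l M i := by
  classical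
  rw [Params.nextEpoch]
  split_ifs with h
  · exact (Nat.find_spec h).1
  · exact le_rfl

lemma Params.epochDone_of_lt_nextEpoch {l : List (D × ℝ)} {M : Finset D} {i j : ℕ} (hij : i ≤ j)
    (hj : j < P.nextEpoch l M i) : P.EpochDone l M j := by
  classical
  rw [Params.nextEpoch] at hj
  split_ifs at hj with h
  · by_contra hc
    exact Nat.find_min h hj ⟨hij, hc⟩
  · omega

lemma Params.not_epochDone_nextEpoch {l : List (D × ℝ)} {M : Finset D} {i : ℕ}
    (h : ∃ j, i ≤ j ∧ ¬ P.EpochDone l M j) : ¬ P.EpochDone l M (P.nextEpoch l M i) := by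
  classical
  rw [Params.nextEpoch, dif_pos h]
  exact (Nat.find_spec h).2

/-- The total excess of the truncated variances over the truncation level `η₍ᵢ₎²`. -/
noncomputable def Params.excess (P : Params D) (S : State D) (i : ℕ) : ℝ :=
  ∑ y ∈ S.M, (max (P.beta i * P.var S.hist y) (P.eta i ^ 2) - P.eta i ^ 2)

lemma Params.excess_nonneg (P : Params D) (S : State D) (i : ℕ) : 0 ≤ P.excess S i :=
  Finset.sum_nonneg fun _ _ => sub_nonneg.2 (le_max_right _ _)

lemma Params.le_excess {S : State D} {i : ℕ} {u : D} (hu : u ∈ S.M) :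
    P.beta i * P.var S.hist u - P.eta i ^ 2 ≤ P.excess S i :=
  (sub_le_sub_right (le_max_left _ _) _).trans
    (Finset.single_le_sum (f := fun y => max (P.beta i * P.var S.hist y) (P.eta i ^ 2) -
      P.eta i ^ 2) (fun _ _ => sub_nonneg.2 (le_max_right _ _)) hu)

lemma Params.excess_update_le (hk : (Matrix.of P.k).PosSemidef) (hs : 0 < P.s) (task : Task)
    (S : State D) (x : D) (y : ℝ) (i : ℕ) :
    P.excess (P.update task S x y) i ≤
      ∑ u ∈ S.M, (max (P.beta i * P.varAfter S.hist x u) (P.eta i ^ 2) - P.eta i ^ 2) := by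
  refine (Finset.sum_le_sum_of_subset_of_nonneg (P.newM_subset task S _) fun u _ _ =>
    sub_nonneg.2 (le_max_right _ _)).trans (le_of_eq ?_)
  refine Finset.sum_congr rfl fun u _ => ?_
  rw [← Params.var_cons hk hs S.hist x y u]
  rfl

lemma Params.excess_update_le_self (hk : (Matrix.of P.k).PosSemidef) (hs : 0 < P.s) (task : Task)
    (S : State D) (x : D) (y : ℝ) (i : ℕ) (hb : 0 ≤ P.beta i) :
    P.excess (P.update task S x y) i ≤ P.excess S i := by
  refine (Params.excess_update_le hk hs task S x y i).trans (Finset.sum_le_sum fun u _ => ?_)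
  have := mul_le_mul_of_nonneg_left (Params.varAfter_le hk hs S.hist x u) hb
  exact sub_le_sub_right (max_le_max this le_rfl) _

/-- If `K` samples would remove the whole excess, the best single sample removes a fraction
`1 / K` of it. -/
lemma Params.excess_update_le_mul [Fintype D] [DecidableEq D]
    (hk : (Matrix.of P.k).PosSemidef) (hs : 0 < P.s) (hsub : SubmodularVarReduction P.k P.s)
    (task : Task) (S : State D) {x : D} (hx : x ∈ P.argmaxAcq S) (y : ℝ)
    (hb : 0 ≤ P.beta S.epoch) {K : ℕ} (hK : 0 < K) (q : Fin K → D)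
    (hq : ∀ u, P.beta S.epoch * postVar P.k P.s q u ≤ P.eta S.epoch ^ 2) :
    P.excess (P.update task S x y) S.epoch ≤ (1 - 1 / (K : ℝ)) * P.excess S S.epoch := by
  have hK' : (0 : ℝ) < K := by exact_mod_cast hK
  have hmax : ∀ x', P.acq S x' ≤ P.acq S x := by
    classical
    exact (Finset.mem_filter.1 hx).2
  have h1 : P.excess S S.epoch ≤ ∑ j, P.acq S (q j) := by
    simp only [Params.acq, ← Finset.sum_sub_distrib]
    rw [Finset.sum_comm]
    exact Finset.sum_le_sum fun u _ => max_sub_le_sum_max_sub hk hs hsub _ q u hb (hq u)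
  have h2 : P.excess S S.epoch ≤ K * P.acq S x :=
    h1.trans ((Finset.sum_le_sum fun j _ => hmax (q j)).trans (by simp))
  have h3 : P.excess (P.update task S x y) S.epoch ≤ P.excess S S.epoch - P.acq S x := by
    refine (Params.excess_update_le hk hs task S x y _).trans (le_of_eq ?_)
    simp only [Params.excess, Params.acq, Finset.sum_sub_distrib]
    ring
  have h4 : P.excess S S.epoch / K ≤ P.acq S x := by
    rw [div_le_iff₀ hK']; linarith
  have h5 : (1 - 1 / (K : ℝ)) * P.excess S S.epoch =
      P.excess S S.epoch - P.excess S S.epoch / K := by ring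
  linarith

lemma Params.argmaxAcq_nonempty [Fintype D] [Nonempty D] (P : Params D) (S : State D) :
    (P.argmaxAcq S).Nonempty := by
  classical
  obtain ⟨x, -, hx⟩ := Finset.exists_max_image Finset.univ (P.acq S) Finset.univ_nonempty
  exact ⟨x, Finset.mem_filter.2 ⟨Finset.mem_univ _, fun x' => hx x' (Finset.mem_univ _)⟩⟩

end Step

section Run

variable {D : Type*} [Fintype D] {P : Params D} {task : Task} {sel : ℕ → Finset D → D}
  {f : D → ℝ} {z : ℕ → ℝ}

lemma Params.run_succ (P : Params D) (task : Task) (sel : ℕ → Finset D → D) (f : D → ℝ)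
    (z : ℕ → ℝ) (t : ℕ) : P.run task sel f z (t + 1) =
      P.update task (P.run task sel f z t) (sel t (P.argmaxAcq (P.run task sel f z t)))
        (f (sel t (P.argmaxAcq (P.run task sel f z t))) + z t) := rfl

lemma Params.run_M_antitone (P : Params D) (task : Task) (sel : ℕ → Finset D → D) (f : D → ℝ)
    (z : ℕ → ℝ) : Antitone fun t => (P.run task sel f z t).M :=
  antitone_nat_of_succ_le fun t => by
    rw [Params.run_succ]; exact P.newM_subset task _ _

lemma Params.run_epoch_monotone (P : Params D) (task : Task) (sel : ℕ → Finset D → D) (f : D → ℝ)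
    (z : ℕ → ℝ) : Monotone fun t => (P.run task sel f z t).epoch :=
  monotone_nat_of_le_succ fun t => by
    rw [Params.run_succ]; exact P.le_nextEpoch _ _ _

lemma Params.one_le_run_epoch (P : Params D) (task : Task) (sel : ℕ → Finset D → D) (f : D → ℝ)
    (z : ℕ → ℝ) (t : ℕ) : 1 ≤ (P.run task sel f z t).epoch :=
  P.run_epoch_monotone task sel f z (Nat.zero_le t)

lemma Params.run_var_antitone (hk : (Matrix.of P.k).PosSemidef) (hs : 0 < P.s) (task : Task)
    (sel : ℕ → Finset D → D) (f : D → ℝ) (z : ℕ → ℝ) (u : D) :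
    Antitone fun t => P.var (P.run task sel f z t).hist u :=
  antitone_nat_of_succ_le fun t => by
    rw [Params.run_succ]
    exact (Params.var_cons hk hs _ _ _ u).trans_le (Params.varAfter_le hk hs _ _ u)

/-- The number of time steps before `t` that start in epoch `j`. -/
noncomputable def Params.stepCount (P : Params D) (task : Task) (sel : ℕ → Finset D → D) (f : D → ℝ)
    (z : ℕ → ℝ) (j t : ℕ) : ℕ :=
  ((Finset.range t).filter fun r => (P.run task sel f z r).epoch = j).card

lemma Params.stepCount_succ (P : Params D) (task : Task) (sel : ℕ → Finset D → D) (f : D → ℝ)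
    (z : ℕ → ℝ) (j t : ℕ) : P.stepCount task sel f z j (t + 1) =
      P.stepCount task sel f z j t + if (P.run task sel f z t).epoch = j then 1 else 0 := by
  rw [Params.stepCount, Finset.range_add_one, Finset.filter_insert]
  split_ifs with h
  · rw [Finset.card_insert_of_notMem (by simp)]; rfl
  · rfl

/-- The excess for epoch `j` decays exponentially in the number of steps in that epoch. -/
lemma Params.excess_run_le [DecidableEq D] [Nonempty D]
    (hk : (Matrix.of P.k).PosSemidef) (hk1 : ∀ x, P.k x x = 1)
    (hs : 0 < P.s) (hsub : SubmodularVarReduction P.k P.s)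
    (hsel : ∀ t A, A.Nonempty → sel t A ∈ A) {j : ℕ} (hb : 0 ≤ P.beta j) {K : ℕ} (hK : 0 < K)
    (q : Fin K → D) (hq : ∀ u, P.beta j * postVar P.k P.s q u ≤ P.eta j ^ 2) (t : ℕ) :
    P.excess (P.run task sel f z t) j ≤
      Real.exp (-(P.stepCount task sel f z j t / K : ℝ)) * (Fintype.card D * P.beta j) := by
  have hK' : (0 : ℝ) < K := by exact_mod_cast hK
  induction t with
  | zero =>
    have : P.excess (P.run task sel f z 0) j ≤ ∑ _u : D, P.beta j := by
      refine Finset.sum_le_sum fun u _ => ?_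
      have h1 := mul_le_mul_of_nonneg_left (Params.var_le_one hk hk1 hs
        (P.run task sel f z 0).hist u) hb
      have h2 := sq_nonneg (P.eta j)
      rcases max_cases (P.beta j * P.var (P.run task sel f z 0).hist u) (P.eta j ^ 2) with h | h <;>
        linarith [h.1]
    simpa [Params.stepCount] using this
  | succ t ih =>
    rw [Params.stepCount_succ, Params.run_succ]
    set S := P.run task sel f z t
    split_ifs with h
    · subst h
      have h1 := Params.excess_update_le_mul hk hs hsub task S
        (hsel t _ (P.argmaxAcq_nonempty S)) (f (sel t (P.argmaxAcq S)) + z t) hb hK q hq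
      refine h1.trans ?_
      have h2 : 1 - 1 / (K : ℝ) ≤ Real.exp (-(1 / K)) := by
        have := Real.add_one_le_exp (-(1 / (K : ℝ)))
        linarith
      have h3 : -(((P.stepCount task sel f z S.epoch t + 1 : ℕ) : ℝ) / K) =
          -(1 / K) + -((P.stepCount task sel f z S.epoch t : ℝ) / K) := by
        push_cast; ring
      rw [h3, Real.exp_add, mul_assoc]
      exact mul_le_mul h2 ih (P.excess_nonneg _ _) (Real.exp_pos _).le
    · exact (Params.excess_update_le_self hk hs task S _ _ j hb).trans ih

/-- If some excess for epoch `j` is left, the number of steps made in that epoch is bounded. -/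
lemma Params.stepCount_lt [DecidableEq D] [Nonempty D]
    (hk : (Matrix.of P.k).PosSemidef) (hk1 : ∀ x, P.k x x = 1)
    (hs : 0 < P.s) (hsub : SubmodularVarReduction P.k P.s)
    (hsel : ∀ t A, A.Nonempty → sel t A ∈ A) {j : ℕ} (hb : 0 < P.beta j) {K : ℕ} (hK : 0 < K)
    (q : Fin K → D) (hq : ∀ u, P.beta j * postVar P.k P.s q u ≤ P.eta j ^ 2) {t : ℕ} {Λ : ℝ}
    (hΛ : Fintype.card D * P.beta j < Real.exp Λ * P.excess (P.run task sel f z t) j) :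
    (P.stepCount task sel f z j t : ℝ) < K * Λ := by
  have hK' : (0 : ℝ) < K := by exact_mod_cast hK
  have h1 := Params.excess_run_le (task := task) (f := f) (z := z) hk hk1 hs hsub hsel hb.le hK
    q hq t
  have hn : (0 : ℝ) < Fintype.card D * P.beta j :=
    mul_pos (by exact_mod_cast Fintype.card_pos) hb
  have h2 := hΛ.trans_le (mul_le_mul_of_nonneg_left h1 (Real.exp_pos Λ).le)
  rw [← mul_assoc, ← Real.exp_add] at h2
  have h3 := (lt_mul_iff_one_lt_left hn).1 h2
  rw [Real.one_lt_exp_iff] at h3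
  rw [mul_comm, ← div_lt_iff₀ hK']
  linarith

/-- Bounding a time by the number of steps made in each epoch; the steps in epochs up to `i₀` are
bounded together by `N₀`. -/
lemma Params.le_add_sum_of_stepCount_lt (P : Params D) (task : Task) (sel : ℕ → Finset D → D)
    (f : D → ℝ) (z : ℕ → ℝ) {t m i₀ N₀ : ℕ} (cap : ℕ → ℕ)
    (hm : ∀ r < t, (P.run task sel f z r).epoch ≤ m)
    (hlow : ∀ r < t, (P.run task sel f z r).epoch ≤ i₀ → r < N₀)
    (hcap : ∀ r < t, i₀ < (P.run task sel f z r).epoch →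
      P.stepCount task sel f z (P.run task sel f z r).epoch r <
        cap (P.run task sel f z r).epoch) : t ≤ N₀ + ∑ j ∈ Finset.Ioc i₀ m, cap j := by
  have h1 : ∀ j, i₀ < j → P.stepCount task sel f z j t ≤ cap j := by
    intro j hj
    induction t with
    | zero => simp [Params.stepCount]
    | succ t ih =>
      rw [Params.stepCount_succ]
      split_ifs with h
      · have := hcap t (Nat.lt_succ_self t) (h ▸ hj)
        rw [h] at this
        omega
      · exact ih (fun r hr => hm r (by omega)) (fun r hr => hlow r (by omega))
          fun r hr => hcap r (by omega)
  have h2 : ((Finset.range t).filter fun r => (P.run task sel f z r).epoch ≤ i₀).card ≤ N₀ := by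
    rw [← Finset.card_range N₀]
    refine Finset.card_le_card fun r hr => ?_
    obtain ⟨hr1, hr2⟩ := Finset.mem_filter.1 hr
    exact Finset.mem_range.2 (hlow r (Finset.mem_range.1 hr1) hr2)
  have h3 : ((Finset.range t).filter fun r => ¬ (P.run task sel f z r).epoch ≤ i₀).card ≤
      ∑ j ∈ Finset.Ioc i₀ m, cap j := by
    rw [Finset.card_eq_sum_card_fiberwise (f := fun r => (P.run task sel f z r).epoch)
      (t := Finset.Ioc i₀ m)]
    · refine Finset.sum_le_sum fun j hj => le_trans (Finset.card_le_card ?_)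
        (h1 j (Finset.mem_Ioc.1 hj).1)
      exact Finset.filter_subset_filter _ (Finset.filter_subset _ _)
    · intro r hr
      obtain ⟨hr1, hr2⟩ := Finset.mem_filter.1 hr
      simp only [Finset.coe_Ioc, Set.mem_Ioc]
      exact ⟨not_le.1 hr2, hm r (Finset.mem_range.1 hr1)⟩
  have h4 := Finset.card_filter_add_card_filter_not (s := Finset.range t)
    (fun r => (P.run task sel f z r).epoch ≤ i₀)
  rw [Finset.card_range] at h4
  omega

end Run

/-! ### Epochs of a run -/

section Epochs

variable {D : Type*} {P : Params D}

/-- The targets tend to zero, while the posterior variance stays positive. -/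
lemma Params.exists_not_epochDone (hk : (Matrix.of P.k).PosSemidef) (hk1 : ∀ x, P.k x x = 1)
    (hs : 0 < P.s) (hbeta : ∀ i, 1 < P.beta i) (heta : ∀ i, P.eta i = (1 / 2) ^ (i - 1))
    {l : List (D × ℝ)} {M : Finset D} (hM : M.Nonempty) (i : ℕ) :
    ∃ j, i ≤ j ∧ ¬ P.EpochDone l M j := by
  obtain ⟨u, hu⟩ := hM
  have hv := Real.sqrt_pos.2 (Params.var_pos hk hk1 hs l u)
  have hlim : Filter.Tendsto (fun n : ℕ => (1 + P.dbar) * (1 / 2 : ℝ) ^ n) Filter.atTop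
      (nhds 0) := by
    simpa using (tendsto_pow_atTop_nhds_zero_of_lt_one (by norm_num) (by norm_num :
      (1 / 2 : ℝ) < 1)).const_mul (1 + P.dbar)
  obtain ⟨n, hn, hin⟩ := ((hlim.eventually (gt_mem_nhds hv)).and
    (Filter.eventually_ge_atTop i)).exists
  refine ⟨n + 1, by omega, fun hdone => ?_⟩
  have h1 := hdone u hu
  rw [heta, Nat.add_sub_cancel] at h1
  have h2 : 1 ≤ Real.sqrt (P.beta (n + 1)) := Real.one_le_sqrt.2 (hbeta _).le
  have h3 := le_mul_of_one_le_left hv.le h2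
  exact absurd (h3.trans h1) (not_le.2 hn)

lemma sq_lt_mul_of_lt_sqrt_mul_sqrt {a b c : ℝ} (ha : 0 ≤ a) (hb : 0 ≤ b) (hc : 0 ≤ c)
    (h : a < Real.sqrt b * Real.sqrt c) : a ^ 2 < b * c := by
  have h1 := pow_lt_pow_left₀ h ha two_ne_zero
  rwa [mul_pow, Real.sq_sqrt hb, Real.sq_sqrt hc] at h1

/-- An unfinished epoch has a definite amount of excess left, thanks to the slack `δ̄`. -/
lemma Params.lt_excess_of_not_epochDone (hk : (Matrix.of P.k).PosSemidef)
    (hk1 : ∀ x, P.k x x = 1) (hs : 0 < P.s) (hd : 0 ≤ P.dbar) {S : State D} {j : ℕ}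
    (hb : 0 ≤ P.beta j) (heta : 0 ≤ P.eta j) (h : ¬ P.EpochDone S.hist S.M j) :
    (P.dbar ^ 2 + 2 * P.dbar) * P.eta j ^ 2 < P.excess S j := by
  rw [Params.EpochDone] at h
  push Not at h
  obtain ⟨u, hu, hlt⟩ := h
  have h1 := sq_lt_mul_of_lt_sqrt_mul_sqrt (by positivity) hb
    (Params.var_pos hk hk1 hs S.hist u).le hlt
  have h2 := Params.le_excess (P := P) (i := j) hu
  nlinarith

variable [Fintype D] {task : Task} {sel : ℕ → Finset D → D} {f : D → ℝ} {z : ℕ → ℝ}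

/-- After the first step, the current epoch is not complete, unless all later ones are. -/
lemma Params.run_not_epochDone {t : ℕ} (ht : 1 ≤ t)
    (h : ∃ j, (P.run task sel f z t).epoch ≤ j ∧
      ¬ P.EpochDone (P.run task sel f z t).hist (P.run task sel f z t).M j) :
    ¬ P.EpochDone (P.run task sel f z t).hist (P.run task sel f z t).M
      (P.run task sel f z t).epoch := by
  obtain ⟨t, rfl⟩ : ∃ r, t = r + 1 := ⟨t - 1, by omega⟩
  obtain ⟨j, hj, hd⟩ := h
  exact Params.not_epochDone_nextEpoch
    ⟨j, (P.run_epoch_monotone task sel f z (Nat.le_succ t)).trans hj, hd⟩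

/-- Once epoch `m` has been left, its target is met. -/
lemma Params.run_epochDone_of_lt (hk : (Matrix.of P.k).PosSemidef) (hs : 0 < P.s) {m : ℕ}
    (hm : 1 ≤ m) {t : ℕ} (h : m < (P.run task sel f z t).epoch) :
    P.EpochDone (P.run task sel f z t).hist (P.run task sel f z t).M m := by
  induction t with
  | zero => exact absurd h (not_lt.2 hm)
  | succ t ih =>
    by_cases h' : m < (P.run task sel f z t).epoch
    · intro u hu
      refine le_trans ?_ (ih h' u (P.run_M_antitone task sel f z (Nat.le_succ t) hu))
      exact mul_le_mul_of_nonneg_left (Real.sqrt_le_sqrt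
        (Params.run_var_antitone hk hs task sel f z u (Nat.le_succ t))) (Real.sqrt_nonneg _)
    · exact Params.epochDone_of_lt_nextEpoch (not_lt.1 h') h

/-- A bound on the number of steps made in an epoch that is not yet complete. -/
lemma Params.stepCount_lt_of_nonempty [DecidableEq D] [Nonempty D]
    (hk : (Matrix.of P.k).PosSemidef) (hk1 : ∀ x, P.k x x = 1) (hs : 0 < P.s)
    (hsub : SubmodularVarReduction P.k P.s) (hsel : ∀ t A, A.Nonempty → sel t A ∈ A)
    (hd : 0 < P.dbar) (hbeta : ∀ i, 1 < P.beta i) (heta : ∀ i, P.eta i = (1 / 2) ^ (i - 1))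
    {t : ℕ} (ht : 1 ≤ t) (hM : (P.run task sel f z t).M.Nonempty) {K : ℕ} (hK : 0 < K)
    {j : ℕ} (hj : (P.run task sel f z t).epoch = j)
    (q : Fin K → D) (hq : ∀ u, P.beta j * postVar P.k P.s q u ≤ P.eta j ^ 2) {Λ : ℝ}
    (hΛ : Fintype.card D * P.beta j ≤
      Real.exp Λ * ((P.dbar ^ 2 + 2 * P.dbar) * P.eta j ^ 2)) :
    (P.stepCount task sel f z j t : ℝ) < K * Λ := by
  have hb : 0 < P.beta j := zero_lt_one.trans (hbeta j)
  refine Params.stepCount_lt hk hk1 hs hsub hsel hb hK q hq (hΛ.trans_lt ?_)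
  refine mul_lt_mul_of_pos_left ?_ (Real.exp_pos Λ)
  subst hj
  exact Params.lt_excess_of_not_epochDone hk hk1 hs hd.le hb.le
    (by rw [heta]; positivity)
    (Params.run_not_epochDone ht (Params.exists_not_epochDone hk hk1 hs hbeta heta hM _))

/-- A bound on the number of steps made in an epoch up to `m` as long as some width
`√β σ` exceeds `ε / 4`, where `ε / 4` is at least the target of epoch `m`. -/
lemma Params.stepCount_lt_of_wide [DecidableEq D] [Nonempty D]
    (hk : (Matrix.of P.k).PosSemidef) (hk1 : ∀ x, P.k x x = 1) (hs : 0 < P.s)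
    (hsub : SubmodularVarReduction P.k P.s) (hsel : ∀ t A, A.Nonempty → sel t A ∈ A)
    (hd : 0 < P.dbar) (heta : ∀ i, P.eta i = (1 / 2) ^ (i - 1))
    {β ε : ℝ} (hβ : 0 < β) (hε : 0 < ε) {m : ℕ} (hbase : ∀ j, j ≤ m → P.beta j = β)
    (hmε : (1 + P.dbar) * P.eta m ≤ ε / 4)
    {t j : ℕ} (hj : (P.run task sel f z t).epoch = j) (hjm : j ≤ m)
    {u : D} (hu : u ∈ (P.run task sel f z t).M)
    (hwide : ε / 4 < Real.sqrt β * Real.sqrt (P.var (P.run task sel f z t).hist u))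
    {K : ℕ} (hK : 0 < K) (q : Fin K → D)
    (hq : ∀ u, β * postVar P.k P.s q u ≤ P.eta j ^ 2) {Λ : ℝ} (hΛ0 : 0 < Λ)
    (hΛj : j < m → Fintype.card D * β ≤
      Real.exp Λ * ((P.dbar ^ 2 + 2 * P.dbar) * P.eta j ^ 2))
    (hΛm : Fintype.card D * β ≤ Real.exp Λ * ((ε / 4) ^ 2 - P.eta m ^ 2)) :
    (P.stepCount task sel f z j t : ℝ) < K * Λ := by
  have hK' : (0 : ℝ) < K := by exact_mod_cast hK
  rcases Nat.eq_zero_or_pos t with rfl | ht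
  · simpa [Params.stepCount] using mul_pos hK' hΛ0
  have hbj := hbase j hjm
  refine Params.stepCount_lt hk hk1 hs hsub hsel (hbj.symm ▸ hβ) hK q (by rwa [hbj]) ?_
  rw [hbj]
  rcases hjm.lt_or_eq with hlt | rfl
  · refine (hΛj hlt).trans_lt (mul_lt_mul_of_pos_left ?_ (Real.exp_pos Λ))
    have hnd : ¬ P.EpochDone (P.run task sel f z t).hist (P.run task sel f z t).M m := by
      intro h
      have h1 := h u hu
      rw [hbase m le_rfl] at h1
      linarith
    subst hj
    exact Params.lt_excess_of_not_epochDone hk hk1 hs hd.le (hbj.symm ▸ hβ).le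
      (by rw [heta]; positivity) (Params.run_not_epochDone ht ⟨m, hjm, hnd⟩)
  · refine hΛm.trans_lt (mul_lt_mul_of_pos_left ?_ (Real.exp_pos Λ))
    have h1 := sq_lt_mul_of_lt_sqrt_mul_sqrt (by positivity) hβ.le
      (Params.var_pos hk hk1 hs _ u).le hwide
    have h2 := Params.le_excess (P := P) (i := j) hu
    rw [hbj] at h2
    linarith

end Epochs

/-! ### Correctness of the classification under valid confidence bounds -/

section Correctness

variable {D : Type*} {P : Params D}

lemma Params.mem_newM_bo {S : State D} {l : List (D × ℝ)} {x : D} :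
    x ∈ P.newM Task.bo S l ↔
      x ∈ S.M ∧ ∀ x' ∈ S.M, P.lower l S.epoch x' ≤ P.upper l S.epoch x := by
  simp [Params.newM]

lemma Params.mem_newM_lse {τ : ℝ} {S : State D} {l : List (D × ℝ)} {x : D} :
    x ∈ P.newM (Task.lse τ) S l ↔
      x ∈ S.M ∧ τ ≤ P.upper l S.epoch x ∧ P.lower l S.epoch x ≤ τ := by
  simp [Params.newM]

variable [Fintype D] {task : Task} {sel : ℕ → Finset D → D} {f : D → ℝ} {z : ℕ → ℝ}

/-- All confidence intervals that the run uses to shrink a nonempty `M` contain the true values. -/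
def Params.Confident (P : Params D) (task : Task) (sel : ℕ → Finset D → D) (f : D → ℝ)
    (z : ℕ → ℝ) : Prop :=
  ∀ t, (P.run task sel f z t).M.Nonempty → ∀ x,
    P.lower (P.run task sel f z (t + 1)).hist (P.run task sel f z t).epoch x ≤ f x ∧
      f x ≤ P.upper (P.run task sel f z (t + 1)).hist (P.run task sel f z t).epoch x

/-- A maximizer is never discarded while the confidence intervals are valid. -/
lemma Params.Confident.mem_M (h : P.Confident Task.bo sel f z) {xs : D} (hxs : ∀ x, f x ≤ f xs)
    (t : ℕ) : xs ∈ (P.run Task.bo sel f z t).M := by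
  induction t with
  | zero => exact Finset.mem_univ _
  | succ t ih =>
    refine Params.mem_newM_bo.2 ⟨ih, fun x' _ => ?_⟩
    have hc := h t ⟨xs, ih⟩
    exact (hc x').1.trans ((hxs x').trans (hc xs).2)

lemma Params.Confident.lt_of_mem_H {τ : ℝ} (h : P.Confident (Task.lse τ) sel f z) (t : ℕ) :
    ∀ x ∈ (P.run (Task.lse τ) sel f z t).H, τ < f x := by
  classical
  induction t with
  | zero => intro x hx; exact absurd hx (Finset.notMem_empty x)
  | succ t ih =>
    intro x hx
    rcases Finset.mem_union.1 hx with hx | hx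
    · exact ih x hx
    · obtain ⟨hxM, hlt⟩ := Finset.mem_filter.1 hx
      exact lt_of_lt_of_le hlt (h t ⟨x, hxM⟩ x).1

lemma Params.Confident.lt_of_mem_L {τ : ℝ} (h : P.Confident (Task.lse τ) sel f z) (t : ℕ) :
    ∀ x ∈ (P.run (Task.lse τ) sel f z t).L, f x < τ := by
  classical
  induction t with
  | zero => intro x hx; exact absurd hx (Finset.notMem_empty x)
  | succ t ih =>
    intro x hx
    rcases Finset.mem_union.1 hx with hx | hx
    · exact ih x hx
    · obtain ⟨hxM, hlt⟩ := Finset.mem_filter.1 hx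
      exact lt_of_le_of_lt (h t ⟨x, hxM⟩ x).2 hlt

/-- Valid confidence intervals of half-width at most `ε / 4` on `M` give `ε`-accuracy from then
on. -/
lemma Params.Confident.accurate (h : P.Confident task sel f z) {ε : ℝ} {t₀ t : ℕ}
    (hw : ∀ u ∈ (P.run task sel f z (t₀ + 1)).M,
      Real.sqrt (P.beta (P.run task sel f z t₀).epoch) *
        Real.sqrt (P.var (P.run task sel f z (t₀ + 1)).hist u) ≤ ε / 4)
    (ht : t₀ + 1 ≤ t) : Accurate task f ε (P.run task sel f z t) := by
  have hwidth : ∀ u ∈ (P.run task sel f z (t₀ + 1)).M,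
      P.upper (P.run task sel f z (t₀ + 1)).hist (P.run task sel f z t₀).epoch u -
        P.lower (P.run task sel f z (t₀ + 1)).hist (P.run task sel f z t₀).epoch u ≤ ε / 2 := by
    intro u hu
    have := hw u hu
    rw [Params.upper, Params.lower]
    linarith
  have hsubs := P.run_M_antitone task sel f z ht
  cases task with
  | bo =>
    intro xs hxs
    refine ⟨h.mem_M hxs t, fun x hx => ?_⟩
    have hx1 := hsubs hx
    obtain ⟨hx0, hcmp⟩ := Params.mem_newM_bo.1 hx1
    have hc := h t₀ ⟨x, hx0⟩
    have h1 := hcmp xs (h.mem_M hxs t₀)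
    have h2 := hwidth x hx1
    have h3 := hwidth xs (h.mem_M hxs _)
    have h4 := (hc x).1
    have h5 := (hc xs).2
    change P.lower (P.run Task.bo sel f z (t₀ + 1)).hist (P.run Task.bo sel f z t₀).epoch xs ≤
      P.upper (P.run Task.bo sel f z (t₀ + 1)).hist (P.run Task.bo sel f z t₀).epoch x at h1
    linarith
  | lse τ =>
    refine ⟨h.lt_of_mem_H t, h.lt_of_mem_L t, fun x hx => ?_⟩
    have hx1 := hsubs hx
    obtain ⟨hx0, hcmp⟩ := Params.mem_newM_lse.1 hx1
    obtain ⟨h4, h5⟩ := h t₀ ⟨x, hx0⟩ x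
    have h2 := hwidth x hx1
    change τ ≤ P.upper (P.run (Task.lse τ) sel f z (t₀ + 1)).hist
        (P.run (Task.lse τ) sel f z t₀).epoch x ∧
      P.lower (P.run (Task.lse τ) sel f z (t₀ + 1)).hist
        (P.run (Task.lse τ) sel f z t₀).epoch x ≤ τ at hcmp
    rw [abs_le]
    constructor <;> linarith [hcmp.1, hcmp.2]

end Correctness

/-! ### Summing the epoch lengths -/

section Budget

lemma one_div_log_one_add_inv_le {x : ℝ} (hx : 0 < x) : 1 / Real.log (1 + 1 / x) ≤ x + 1 / 2 := by
  have h := Real.le_log_one_add_of_nonneg (x := 1 / x) (by positivity)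
  have h2 : 2 * (1 / x) / (1 / x + 2) = 1 / (x + 1 / 2) := by
    field_simp
    ring
  rw [h2] at h
  rw [div_le_iff₀ (lt_of_lt_of_le (by positivity) h)]
  rwa [div_le_iff₀ (by positivity), mul_comm] at h

/-- Concavity of the logarithm on `[0, 1]`. -/
lemma one_div_log_one_add_div_le {v s : ℝ} (hv : 0 < v) (hv1 : v ≤ 1) (hs : 0 < s) :
    1 / Real.log (1 + v / s) ≤ 1 / Real.log (1 + s⁻¹) / v := by
  have h0 : 0 < Real.log (1 + s⁻¹) := Real.log_pos (by have := inv_pos.2 hs; linarith)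
  have h1 := rpow_one_add_le_one_add_mul_self (s := s⁻¹) (by have := inv_pos.2 hs; linarith)
    hv.le hv1
  have h2 := Real.log_le_log (by positivity) h1
  rw [Real.log_rpow (by positivity), ← div_eq_mul_inv] at h2
  rw [div_div, mul_comm (Real.log _)]
  exact one_div_le_one_div_of_le (by positivity) h2

/-- A geometric sum, cut off at the level `1` from above. -/
lemma sum_small_le {b : ℝ} (hb : 0 < b) (m : ℕ) :
    ∑ i ∈ Finset.range m, (if 4 ^ i * b < 1 then 4 ^ i * b else 0) ≤ 4 / 3 := by
  suffices h : (∑ i ∈ Finset.range m, (if 4 ^ i * b < 1 then 4 ^ i * b else 0) ≤ 4 / 3) ∧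
      ∑ i ∈ Finset.range m, (if 4 ^ i * b < 1 then 4 ^ i * b else 0) ≤ 4 ^ m * b / 3 from h.1
  induction m with
  | zero =>
    refine ⟨by norm_num, ?_⟩
    simp only [Finset.range_zero, Finset.sum_empty]
    positivity
  | succ m ih =>
    rw [Finset.sum_range_succ, pow_succ]
    have : 0 < (4 : ℝ) ^ m * b := by positivity
    split_ifs with h <;> constructor <;> linarith [ih.1, ih.2]

/-- A geometric sum, cut off at the level `1` from below; the extra `1 / 2` in each term is covered
by replacing the factor `4 / 3` with `3 / 2`. -/
lemma sum_large_le {b : ℝ} (hb : 0 < b) (m : ℕ) :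
    ∑ i ∈ Finset.range (m + 1), (if 4 ^ i * b < 1 then 0 else 4 ^ i * b + 1 / 2) ≤
      3 / 2 * (4 ^ m * b) := by
  suffices h : (∑ i ∈ Finset.range (m + 1), (if 4 ^ i * b < 1 then 0 else 4 ^ i * b + 1 / 2) ≤
      3 / 2 * (4 ^ m * b)) ∧ (4 ^ m * b < 1 →
      ∑ i ∈ Finset.range (m + 1), (if 4 ^ i * b < 1 then 0 else 4 ^ i * b + 1 / 2) ≤ 0) from h.1
  induction m with
  | zero =>
    simp only [zero_add, Finset.range_one, Finset.sum_singleton, pow_zero, one_mul]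
    split_ifs with h
    · exact ⟨by linarith, fun _ => le_rfl⟩
    · exact ⟨by linarith, fun h' => absurd h' h⟩
  | succ m ih =>
    rw [Finset.sum_range_succ, pow_succ]
    have h0 : 0 < (4 : ℝ) ^ m * b := by positivity
    have h4 : (4 : ℝ) ^ m * 4 * b = 4 * (4 ^ m * b) := by ring
    rw [h4]
    split_ifs with h
    · have := ih.2 (by linarith)
      exact ⟨by linarith, fun _ => by linarith⟩
    · refine ⟨?_, fun h' => absurd h' h⟩
      by_cases h1 : (4 : ℝ) ^ m * b < 1
      · linarith [ih.2 h1]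
      · linarith [ih.1]

lemma sum_all_eq (b : ℝ) (m : ℕ) :
    ∑ i ∈ Finset.range m, (4 ^ i * b + 1 / 2) = b * (4 ^ m - 1) / 3 + m / 2 := by
  induction m with
  | zero => simp
  | succ m ih => rw [Finset.sum_range_succ, ih]; push_cast; ring

lemma linear_le_four_pow (m : ℕ) : 12 * (m : ℝ) - 8 ≤ 4 ^ m := by
  rcases m with _ | m
  · norm_num
  induction m with
  | zero => norm_num
  | succ m ih => push_cast at ih ⊢; rw [pow_succ]; nlinarith [(Nat.cast_nonneg m : (0 : ℝ) ≤ m)]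

/-- The number of samples needed to reach the variances `4⁻ⁱ / β`, summed over the epochs. Targets
above the noise level are handled by concavity, those below it by `1 / log (1 + 1 / x) ≤ x + 1 / 2`,
and both sums are geometric. -/
lemma sum_one_div_log_le {β s : ℝ} (hβ : 1 ≤ β) (hs : 0 < s) (m : ℕ) :
    ∑ i ∈ Finset.range (m + 1), 1 / Real.log (1 + 1 / (4 ^ i * (β * s))) ≤
      3 / 2 * (4 ^ m * (β * s)) + 1 / Real.log (1 + s⁻¹) * (4 / 3 / s) := by
  have hβ0 : 0 < β := by linarith
  have hC : 0 < 1 / Real.log (1 + s⁻¹) :=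
    one_div_pos.2 (Real.log_pos (by have := inv_pos.2 hs; linarith))
  have hb : 0 < β * s := by positivity
  have h1 : ∀ i : ℕ, 1 / Real.log (1 + 1 / (4 ^ i * (β * s))) ≤
      (if 4 ^ i * (β * s) < 1 then 0 else 4 ^ i * (β * s) + 1 / 2) +
        1 / Real.log (1 + s⁻¹) / s * (if 4 ^ i * (β * s) < 1 then 4 ^ i * (β * s) else 0) := by
    intro i
    split_ifs with h
    · have hv : 1 / (4 ^ i * β) ≤ (1 : ℝ) := by
        rw [div_le_one (by positivity)]
        exact one_le_mul_of_one_le_of_one_le (one_le_pow₀ (by norm_num)) hβ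
      have := one_div_log_one_add_div_le (v := 1 / (4 ^ i * β)) (by positivity) hv hs
      rw [div_div, mul_assoc] at this
      refine this.trans (le_of_eq ?_)
      field_simp
      ring
    · simpa using one_div_log_one_add_inv_le (x := 4 ^ i * (β * s)) (by positivity)
  refine (Finset.sum_le_sum fun i _ => h1 i).trans ?_
  rw [Finset.sum_add_distrib, ← Finset.mul_sum]
  have h2 := sum_large_le hb m
  have h3 := mul_le_mul_of_nonneg_left (sum_small_le hb (m + 1)) (div_pos hC hs).le
  have h4 : 1 / Real.log (1 + s⁻¹) / s * (4 / 3) = 1 / Real.log (1 + s⁻¹) * (4 / 3 / s) := by ring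
  linarith

/-- The case of small noise: the excess term `3 β A / s` of the second summand pays for the extra
rounding (`c = 5/2`). -/
lemma sum_add_le_of_noise_lt {g s β A Q R c : ℝ} {M : ℕ} (hs : 0 < s) (hs16 : s < 16)
    (hβ : 2 ≤ β) (hA : 1 ≤ A) (hg : Real.log (1 + s⁻¹) ≤ g) (hQ : 4 ^ M ≤ Q)
    (hR : (M : ℝ) + 1 ≤ R)
    (hc : c ≤ 2 ∨ (c ≤ 5 / 2 ∧ 49 ≤ A ∧ 4 ^ M ≤ 3 * A)) :
    g * ∑ i ∈ Finset.range (M + 1), 1 / Real.log (1 + 1 / (4 ^ i * (β * s))) + c * (M + 1) ≤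
      3 / 2 * g * s * β * Q + 3 * (1 / Real.log (1 + s⁻¹)) * g * β * A / s + 2 * R := by
  have hl : 0 < Real.log (1 + s⁻¹) := Real.log_pos (by have := inv_pos.2 hs; linarith)
  have hg0 : 0 < g := hl.trans_le hg
  have hCg : 1 ≤ 1 / Real.log (1 + s⁻¹) * g := by
    rw [one_div, inv_mul_eq_div, le_div_iff₀ hl]; linarith
  have h1 := mul_le_mul_of_nonneg_left (sum_one_div_log_le (β := β) (by linarith) hs M) hg0.le
  have h2 : 3 / 2 * g * s * β * 4 ^ M ≤ 3 / 2 * g * s * β * Q :=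
    mul_le_mul_of_nonneg_left hQ (by positivity)
  set C := 1 / Real.log (1 + s⁻¹)
  have hβA : 2 * A ≤ β * A := mul_le_mul_of_nonneg_right hβ (by linarith)
  have h3 : (3 * (β * A) - 4 / 3) / s ≤ C * g * ((3 * (β * A) - 4 / 3) / s) :=
    le_mul_of_one_le_left (div_nonneg (by linarith) hs.le) hCg
  have h4 : (3 * (β * A) - 4 / 3) / 16 ≤ (3 * (β * A) - 4 / 3) / s :=
    div_le_div_of_nonneg_left (by linarith) hs hs16.le
  have h5 : g * (3 / 2 * (4 ^ M * (β * s)) + C * (4 / 3 / s)) +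
      C * g * ((3 * (β * A) - 4 / 3) / s) =
      3 / 2 * g * s * β * 4 ^ M + 3 * C * g * β * A / s := by ring
  have hM : (0 : ℝ) ≤ M := Nat.cast_nonneg M
  have h6 : c * (M + 1) ≤ (3 * (β * A) - 4 / 3) / 16 + 2 * R := by
    rcases hc with hc | ⟨hc, hA, hP⟩
    · nlinarith
    · have := linear_le_four_pow M
      nlinarith
  linarith

/-- The case of large noise: no target is above the noise level, so that the geometric sum is
smaller by the factor `8/9`, and this pays for all roundings. -/
lemma sum_add_le_of_le_noise {g s β Q R c : ℝ} {M : ℕ} (hM1 : 1 ≤ M) (hs16 : 16 ≤ s)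
    (hβ : 2.15 ≤ β) (hg : Real.log (1 + s⁻¹) ≤ g) (hQ : 4 ^ M ≤ Q) (hR : 1 ≤ R)
    (hc : c ≤ 2 ∨ (c ≤ 5 / 2 ∧ 49 ≤ β * 4 ^ M)) :
    g * ∑ i ∈ Finset.range (M + 1), 1 / Real.log (1 + 1 / (4 ^ i * (β * s))) + c * (M + 1) ≤
      3 / 2 * g * s * β * Q + 2 * R := by
  have hs : 0 < s := by linarith
  have hgs : 32 / 33 ≤ g * s := by
    have h := Real.le_log_one_add_of_nonneg (x := s⁻¹) (by positivity)
    have h1 : 2 * s⁻¹ / (s⁻¹ + 2) * s = 2 * s / (2 * s + 1) := by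
      field_simp
      ring
    have h2 := mul_le_mul_of_nonneg_right (h.trans hg) hs.le
    rw [h1] at h2
    refine le_trans ?_ h2
    rw [div_le_div_iff₀ (by norm_num) (by positivity)]
    linarith
  have hg0 : 0 < g := by
    by_contra h
    nlinarith
  have h1 : ∑ i ∈ Finset.range (M + 1), 1 / Real.log (1 + 1 / (4 ^ i * (β * s))) ≤
      β * s * (4 ^ (M + 1) - 1) / 3 + (M + 1) / 2 := by
    refine (Finset.sum_le_sum fun i _ => one_div_log_one_add_inv_le
      (x := 4 ^ i * (β * s)) (by positivity)).trans (le_of_eq ?_)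
    rw [sum_all_eq]; push_cast; ring
  have h2 := mul_le_mul_of_nonneg_left h1 hg0.le
  have h3 : 3 / 2 * g * s * β * 4 ^ M ≤ 3 / 2 * g * s * β * Q :=
    mul_le_mul_of_nonneg_left hQ (by positivity)
  have h4 : 3 / 2 * g * s * β * 4 ^ M - g * (β * s * (4 ^ (M + 1) - 1) / 3 + (M + 1) / 2) =
      g * s * (β * 4 ^ M / 6 + β / 3) - g * s * ((M + 1) / (2 * s)) := by
    field_simp
    ring
  have hM : (1 : ℝ) ≤ M := by exact_mod_cast hM1
  have h5 : (M + 1) / (2 * s) ≤ ((M : ℝ) + 1) / 32 :=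
    div_le_div_of_nonneg_left (by positivity) (by norm_num) (by linarith)
  have hP := linear_le_four_pow M
  have hβP : 2.15 * (4 : ℝ) ^ M ≤ β * 4 ^ M := mul_le_mul_of_nonneg_right hβ (by positivity)
  have h6 : 32 / 33 * (β * 4 ^ M / 6 + β / 3 - (M + 1) / 32) ≤
      g * s * (β * 4 ^ M / 6 + β / 3) - g * s * ((M + 1) / (2 * s)) := by
    rw [← mul_sub]
    refine mul_le_mul hgs (by linarith) ?_ (by positivity)
    linarith
  have h7 : c * (M + 1) ≤ 32 / 33 * (β * 4 ^ M / 6 + β / 3 - (M + 1) / 32) + 2 * R := by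
    rcases hc with hc | ⟨hc, hβP'⟩
    · have : c * (M + 1) ≤ 2 * (M + 1) := mul_le_mul_of_nonneg_right hc (by linarith)
      linarith
    · have : c * (M + 1) ≤ 5 / 2 * (M + 1) := mul_le_mul_of_nonneg_right hc (by linarith)
      linarith
  linarith

end Budget

section Budget

lemma betaT_ge {n : ℕ} (hn : 2 ≤ n) {δ : ℝ} (hδ0 : 0 < δ) (hδ1 : δ < 1) {T : ℕ} (hT : 1 ≤ T) :
    2.15 ≤ betaT n δ T := by
  have hn' : (2 : ℝ) ≤ n := by exact_mod_cast hn
  have hT' : (1 : ℝ) ≤ T := by exact_mod_cast hT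
  have hpi := Real.pi_gt_d2
  have h1 : (3.28 : ℝ) ≤ (n : ℝ) * (T : ℝ) ^ 2 * Real.pi ^ 2 / (6 * δ) := by
    rw [le_div_iff₀ (by positivity)]
    have h2 : (2 : ℝ) * 1 ≤ n * (T : ℝ) ^ 2 :=
      mul_le_mul hn' (one_le_pow₀ hT') zero_le_one (by positivity)
    have h3 : (3.14 : ℝ) ^ 2 ≤ Real.pi ^ 2 := by gcongr
    have h4 : (2 : ℝ) * 1 * 3.14 ^ 2 ≤ n * (T : ℝ) ^ 2 * Real.pi ^ 2 :=
      mul_le_mul h2 h3 (by positivity) (by positivity)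
    linarith
  have h2 := Real.log_le_log (by norm_num) h1
  have h3 : Real.exp 1 * 1.2 ≤ 3.28 := by have := Real.exp_one_lt_d9; linarith
  have h4 := Real.log_le_log (by positivity) h3
  rw [Real.log_mul (by positivity) (by norm_num), Real.log_exp] at h4
  have h5 := Real.le_log_one_add_of_nonneg (x := 0.2) (by norm_num)
  norm_num at h5 h4 ⊢
  rw [betaT]
  linarith

lemma exp_logFactor {n : ℕ} (hn : 2 ≤ n) {d ε β : ℝ} (hd : 0 < d) (hε : 0 < ε) (hβ : 0 < β) :
    Real.exp (logFactor n d ε β) = 16 * (1 + d) ^ 2 * n * β / (d ^ 2 * ε ^ 2) := by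
  have : (0 : ℝ) < n := by exact_mod_cast (by omega : 0 < n)
  rw [logFactor, Real.exp_log (by positivity)]

lemma two_lt_exp_logFactor {n : ℕ} (hn : 2 ≤ n) {d ε β : ℝ} (hd : 0 < d) (hε : 0 < ε)
    (hβ : 0 < β) (hwide : ε ^ 2 < 16 * β) : 2 < Real.exp (logFactor n d ε β) := by
  have hn' : (2 : ℝ) ≤ n := by exact_mod_cast hn
  rw [exp_logFactor hn hd hε hβ, lt_div_iff₀ (by positivity)]
  have h1 : d ^ 2 * ε ^ 2 ≤ (1 + d) ^ 2 * ε ^ 2 := by gcongr; linarith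
  have h2 : (1 + d) ^ 2 * ε ^ 2 < (1 + d) ^ 2 * (16 * β) := by gcongr
  have h3 : (1 + d) ^ 2 * (16 * β) * 2 ≤ (1 + d) ^ 2 * (16 * β) * n := by gcongr
  nlinarith

/-- A logarithmic factor below `1` is possible only for a large slack `d` and a large `ε`. -/
lemma lt_slack_of_logFactor_lt_one {n : ℕ} (hn : 2 ≤ n) {d ε β : ℝ} (hd : 0 < d) (hε : 0 < ε)
    (hβ : 2.15 ≤ β) (hwide : ε ^ 2 < 16 * β) (h : logFactor n d ε β < 1) :
    6 < d ∧ 64 / 3 ≤ ε ^ 2 := by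
  have hn' : (2 : ℝ) ≤ n := by exact_mod_cast hn
  have hE := Real.exp_lt_exp.2 h
  rw [exp_logFactor hn hd hε (by linarith), div_lt_iff₀ (by positivity)] at hE
  have hA : d ^ 2 ≤ (1 + d) ^ 2 := by gcongr; linarith
  set A := (1 + d) ^ 2 with hAdef
  have hA0 : 0 < A := by positivity
  have hEe : 16 * A * n * β < 2.7183 * (d ^ 2 * ε ^ 2) := by
    refine hE.trans_le ?_
    have := Real.exp_one_lt_d9
    gcongr
    linarith
  have hnβ : 16 * A * 2 * β ≤ 16 * A * n * β := by gcongr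
  constructor
  · have h1 : 2 * A * ε ^ 2 < 2.7183 * d ^ 2 * ε ^ 2 := by
      have : 2 * A * ε ^ 2 < 2 * A * (16 * β) := by gcongr
      linarith
    have h2 := lt_of_mul_lt_mul_right h1 (by positivity)
    by_contra h
    push Not at h
    nlinarith
  · have h1 : d ^ 2 * ε ^ 2 ≤ A * ε ^ 2 := by gcongr
    have h2 : 16 * A * 2 * 2.15 ≤ 16 * A * 2 * β := by gcongr
    have h3 : A * 68.8 < A * (2.7183 * ε ^ 2) := by linarith
    have h4 := lt_of_mul_lt_mul_left h3 hA0.le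
    linarith

/-- The number of samples after which every posterior variance is at most `4⁻ⁱ / β`, for noise
variance `s` and information gain `γ`. -/
noncomputable def sampleCount (γ β s : ℝ) (i : ℕ) : ℕ :=
  ⌊2 * γ / Real.log (1 + 1 / (4 ^ i * (β * s)))⌋₊ + 1

set_option maxHeartbeats 800000 in
/-- The epoch lengths `⌈K Λ⌉` add up to at most `T`. When the logarithmic factor `Λ` is below `1`,
rounding up costs relatively more, but then `1 + d ≥ 7`, which leaves slack in the bound. -/
lemma sum_epochLength_le {n : ℕ} (hn : 2 ≤ n) {σ d ε γ β : ℝ} (hσ : 0 < σ) (hd : 0 < d)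
    (hε : 0 < ε) (hγ : Real.log (1 + (σ ^ 2)⁻¹) ≤ 2 * γ) (hβ : 2.15 ≤ β)
    (hwide : ε ^ 2 < 16 * β) {M : ℕ} (hM : 1 ≤ M) (hm1 : (1 + d) * (1 / 2) ^ M ≤ ε / 4)
    (hm2 : ε / 8 < (1 + d) * (1 / 2) ^ M) {T : ℕ} (hT : improvedBound n σ d ε γ β ≤ T) :
    3 ≤ T ∧ (∀ i ≤ M, sampleCount γ β (σ ^ 2) i ≤ T) ∧
      ∑ i ∈ Finset.range (M + 1), ⌈sampleCount γ β (σ ^ 2) i * logFactor n d ε β⌉₊ ≤ T := by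
  have hn' : (2 : ℝ) ≤ n := by exact_mod_cast hn
  have hE := exp_logFactor hn hd hε (by linarith : 0 < β)
  have hE2 := two_lt_exp_logFactor hn hd hε (by linarith : 0 < β) hwide
  set Λ := logFactor n d ε β with hΛdef
  have hΛ2 : 0.69 < Λ := by
    have h1 := (Real.log_lt_iff_lt_exp two_pos).2 hE2
    have h2 := Real.log_two_gt_d9
    linarith
  have hs : 0 < σ ^ 2 := by positivity
  set s := σ ^ 2 with hsdef
  set A := (1 + d) ^ 2 with hAdef
  have hA1 : 1 ≤ A := one_le_pow₀ (by linarith)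
  have hl : 0 < Real.log (1 + s⁻¹) := Real.log_pos (by have := inv_pos.2 hs; linarith)
  have hg0 : 0 < 2 * γ := hl.trans_le hγ
  set P : ℝ := 4 ^ M with hPdef
  have hP0 : 0 < P := by positivity
  have hPη : P * ((1 / 2) ^ M) ^ 2 = 1 := by
    rw [← pow_mul, mul_comm M, pow_mul, ← mul_pow]; norm_num
  have hPA1 : 16 * A ≤ P * ε ^ 2 := by
    have h1 := mul_le_mul_of_nonneg_left (pow_le_pow_left₀ (by positivity) hm1 2) hP0.le
    have h2 : P * ((1 + d) * (1 / 2) ^ M) ^ 2 = A * (P * ((1 / 2) ^ M) ^ 2) := by ring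
    rw [h2, hPη] at h1
    linarith
  have hPA2 : P * ε ^ 2 < 64 * A := by
    have h1 := mul_lt_mul_of_pos_left (pow_lt_pow_left₀ hm2 (by positivity) two_ne_zero) hP0
    have h2 : P * ((1 + d) * (1 / 2) ^ M) ^ 2 = A * (P * ((1 / 2) ^ M) ^ 2) := by ring
    rw [h2, hPη] at h1
    linarith
  have hPQ : P ≤ 64 * A / ε ^ 2 := by
    rw [le_div_iff₀ (by positivity)]; exact hPA2.le
  set R : ℝ := ((max 1 ⌈Real.logb 2 (32 * A / (ε * σ))⌉ : ℤ) : ℝ) with hRdef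
  have hR1 : 1 ≤ R := by
    rw [hRdef]; exact_mod_cast le_max_left _ _
  have hRM : s < 16 → (M : ℝ) + 1 ≤ R := by
    intro h16
    have hσ4 : σ < 4 := by nlinarith
    have h1 : (2 : ℝ) ^ M < 32 * A / (ε * σ) := by
      rw [lt_div_iff₀ (by positivity)]
      have h2 : (2 : ℝ) ^ M * (1 / 2) ^ M = 1 := by rw [← mul_pow]; norm_num
      have h3 := mul_lt_mul_of_pos_left hm2 (by positivity : (0 : ℝ) < 2 ^ M)
      have h4 : (2 : ℝ) ^ M * ((1 + d) * (1 / 2) ^ M) = 1 + d := by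
        rw [mul_left_comm, h2, mul_one]
      rw [h4] at h3
      have h5 : (2 : ℝ) ^ M * ε * σ < 8 * (1 + d) * 4 :=
        mul_lt_mul'' (by linarith) hσ4 (by positivity) hσ.le
      nlinarith
    have h2 : (M : ℝ) < Real.logb 2 (32 * A / (ε * σ)) := by
      rw [Real.lt_logb_iff_rpow_lt (by norm_num) (by positivity), Real.rpow_natCast]
      exact h1
    have h3 : (M : ℤ) + 1 ≤ ⌈Real.logb 2 (32 * A / (ε * σ))⌉ :=
      Int.add_one_le_iff.2 (Int.lt_ceil.2 (by exact_mod_cast h2))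
    have h4 := h3.trans (le_max_right 1 _)
    rw [hRdef]
    exact_mod_cast h4
  set C := 1 / Real.log (1 + s⁻¹) with hCdef
  set κ : ℕ → ℝ := fun i => 2 * γ * (1 / Real.log (1 + 1 / (4 ^ i * (β * s)))) with hκdef
  have hκ0 : ∀ i, 0 ≤ κ i := fun i =>
    mul_nonneg hg0.le (one_div_nonneg.2 (Real.log_nonneg (by
      have : 0 < 1 / (4 ^ i * (β * s)) := by positivity
      linarith)))
  have hK : ∀ i, (sampleCount γ β s i : ℝ) ≤ κ i + 1 := fun i => by
    have h1 : 2 * γ / Real.log (1 + 1 / (4 ^ i * (β * s))) = κ i := by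
      rw [hκdef, div_eq_mul_one_div]
    rw [sampleCount, h1]
    push_cast
    have := Nat.floor_le (hκ0 i)
    linarith
  set X := 3 / 2 * (2 * γ) * s * β * (64 * A / ε ^ 2) + 3 * C * (2 * γ) * β * A / s + 2 * R
    with hXdef
  have hC0 : 0 < C := one_div_pos.2 hl
  have hX0 : 0 < X := by positivity
  have hXT : X * Λ ≤ T := by
    refine le_of_eq_of_le ?_ hT
    rw [improvedBound, C1, ← hΛdef, hXdef]
    congr 1
    ring
  have hsum : ∀ c : ℝ, 2 * γ * ∑ i ∈ Finset.range (M + 1),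
        1 / Real.log (1 + 1 / (4 ^ i * (β * s))) + c * (M + 1) ≤ X →
      ∑ i ∈ Finset.range (M + 1), κ i + c * (M + 1) ≤ X := fun c h => by
    rwa [← Finset.mul_sum]
  have hle : ∀ i ≤ M, κ i ≤ ∑ i ∈ Finset.range (M + 1), κ i := fun i hi =>
    Finset.single_le_sum (fun j _ => hκ0 j) (Finset.mem_range.2 (by omega))
  have hM' : (1 : ℝ) ≤ M := by exact_mod_cast hM
  obtain ⟨c, hc2, hcΛ, hcX, hKT⟩ : ∃ c : ℝ, 2 ≤ c ∧ 1 ≤ (c - 1) * Λ ∧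
      ∑ i ∈ Finset.range (M + 1), κ i + c * (M + 1) ≤ X ∧ ∀ i ≤ M, κ i + 1 ≤ T := by
    rcases le_or_gt 1 Λ with hΛ1 | hΛ1
    · have hX := hsum 2 (by
        rcases lt_or_ge s 16 with h16 | h16
        · exact sum_add_le_of_noise_lt hs h16 (by linarith) hA1 hγ hPQ (hRM h16) (Or.inl le_rfl)
        · refine (sum_add_le_of_le_noise hM h16 hβ hγ hPQ hR1 (Or.inl le_rfl)).trans ?_
          have : 0 ≤ 3 * C * (2 * γ) * β * A / s := by positivity
          linarith)
      refine ⟨2, le_rfl, by linarith, hX, fun i hi => ?_⟩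
      have h1 := hle i hi
      nlinarith
    · obtain ⟨hd6, hε21⟩ := lt_slack_of_logFactor_lt_one hn hd hε hβ hwide hΛ1
      have hA49 : 49 ≤ A := by
        have := pow_le_pow_left₀ (by norm_num) (by linarith : (7 : ℝ) ≤ 1 + d) 2
        linarith
      have hβP : 49 ≤ β * P := by
        have := mul_lt_mul_of_pos_left hwide hP0
        linarith
      have hPA3 : P ≤ 3 * A := by
        have := mul_le_mul_of_nonneg_left hε21 hP0.le
        linarith
      have hX := hsum (5 / 2) (by
        rcases lt_or_ge s 16 with h16 | h16
        · exact sum_add_le_of_noise_lt hs h16 (by linarith) hA1 hγ hPQ (hRM h16)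
            (Or.inr ⟨le_rfl, hA49, hPA3⟩)
        · refine (sum_add_le_of_le_noise hM h16 hβ hγ hPQ hR1 (Or.inr ⟨le_rfl, hβP⟩)).trans ?_
          have : 0 ≤ 3 * C * (2 * γ) * β * A / s := by positivity
          linarith)
      refine ⟨5 / 2, by norm_num, by linarith, hX, fun i hi => ?_⟩
      -- The factor `Λ > 0.69` is harmless for a single epoch, since `3 / 2 * 0.69 > 1`.
      have h1 : κ i ≤ 2 * γ * (P * (β * s) + 1 / 2) := by
        refine mul_le_mul_of_nonneg_left ((one_div_log_one_add_inv_le (by positivity)).trans ?_)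
          hg0.le
        have : (4 : ℝ) ^ i ≤ P := pow_le_pow_right₀ (by norm_num) hi
        gcongr
      have h2 : 3 / 2 * (2 * γ) * s * β * P ≤ 3 / 2 * (2 * γ) * s * β * (64 * A / ε ^ 2) := by
        gcongr
      have h3 : s ≤ C := by
        have := Real.log_le_sub_one_of_pos (x := 1 + s⁻¹) (by positivity)
        rw [hCdef, le_div_iff₀ hl]
        calc s * Real.log (1 + s⁻¹) ≤ s * s⁻¹ := by gcongr; linarith
          _ = 1 := mul_inv_cancel₀ hs.ne'
      have h4 : 3 * (2 * γ) * (2.15 * 49) ≤ 3 * C * (2 * γ) * β * A / s := by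
        rw [le_div_iff₀ hs]
        have h5 : 2.15 * 49 ≤ β * A := by gcongr
        calc 3 * (2 * γ) * (2.15 * 49) * s ≤ 3 * (2 * γ) * (β * A) * C := by gcongr
          _ = _ := by ring
      have h5 : 0.69 * X ≤ X * Λ := by nlinarith
      have h6 : 0 < 2 * γ * (P * (β * s)) := by positivity
      have h7 : 3 / 2 * (2 * γ) * s * β * P = 3 / 2 * (2 * γ * (P * (β * s))) := by ring
      linarith
  have hκsum : 0 ≤ ∑ i ∈ Finset.range (M + 1), κ i := Finset.sum_nonneg fun i _ => hκ0 i
  refine ⟨?_, fun i hi => ?_, ?_⟩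
  · have h1 : 2 < (T : ℝ) := by nlinarith
    exact_mod_cast h1
  · exact_mod_cast (hK i).trans (hKT i hi)
  · have h1 : ∀ i, ((⌈sampleCount γ β s i * Λ⌉₊ : ℕ) : ℝ) ≤ κ i * Λ + (Λ + 1) := fun i => by
      have h2 := (Nat.ceil_lt_add_one (a := sampleCount γ β s i * Λ) (by positivity)).le
      have h3 := mul_le_mul_of_nonneg_right (hK i) (by linarith : 0 ≤ Λ)
      linarith
    have h2 : ((∑ i ∈ Finset.range (M + 1), ⌈sampleCount γ β s i * Λ⌉₊ : ℕ) : ℝ) ≤ T := by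
      push_cast
      refine (Finset.sum_le_sum fun i _ => h1 i).trans ?_
      rw [Finset.sum_add_distrib, ← Finset.sum_mul, Finset.sum_const, Finset.card_range,
        nsmul_eq_mul]
      push_cast
      have h3 : ((M : ℝ) + 1) * 1 ≤ (M + 1) * ((c - 1) * Λ) :=
        mul_le_mul_of_nonneg_left hcΛ (by linarith)
      have h4 := mul_le_mul_of_nonneg_right hcX (by linarith : 0 ≤ Λ)
      linarith
    exact_mod_cast h2

end Budget

/-! ### The choice of the confidence parameters -/

/-- The inputs of the algorithm with `η₍₁₎ = 1` and `r = 1 / 2`. -/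
noncomputable abbrev halvingParams {D : Type*} (k : D → D → ℝ) (s dbar : ℝ) (beta : ℕ → ℝ) :
    Params D :=
  { k := k, s := s, dbar := dbar, r := 1 / 2, eta1 := 1, beta := beta }

lemma halvingParams_eta {D : Type*} (k : D → D → ℝ) (s dbar : ℝ) (beta : ℕ → ℝ) (i : ℕ) :
    (halvingParams k s dbar beta).eta i = (1 / 2) ^ (i - 1) := by
  simp [Params.eta]

lemma half_pow_sq (i : ℕ) : ((1 / 2 : ℝ) ^ i) ^ 2 = 1 / 4 ^ i := by
  rw [← pow_mul, mul_comm, pow_mul, div_pow, one_pow, one_div_pow]; norm_num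

section Numeric

variable {n : ℕ} {d ε β : ℝ} {M : ℕ}

/-- The index of the last epoch that matters for accuracy `ε`. -/
lemma exists_target_index (hd : 0 < d) (hε : 0 < ε) (hε1 : ε < 4 * (1 + d)) :
    ∃ M : ℕ, 1 ≤ M ∧ (1 + d) * (1 / 2) ^ M ≤ ε / 4 ∧ ε / 8 < (1 + d) * (1 / 2) ^ M := by
  classical
  have hex : ∃ M : ℕ, (1 + d) * (1 / 2) ^ M ≤ ε / 4 := by
    obtain ⟨M, hM⟩ := exists_pow_lt_of_lt_one (y := (1 / 2 : ℝ)) (x := ε / 4 / (1 + d))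
      (by positivity) (by norm_num)
    rw [lt_div_iff₀ (by positivity)] at hM
    exact ⟨M, by linarith⟩
  have h0 : Nat.find hex ≠ 0 := by
    intro h
    have := Nat.find_spec hex
    rw [h] at this
    simp only [pow_zero, mul_one] at this
    linarith
  obtain ⟨M, hM⟩ := Nat.exists_eq_succ_of_ne_zero h0
  refine ⟨Nat.find hex, by omega, Nat.find_spec hex, ?_⟩
  have h1 := Nat.find_min hex (m := M) (by omega)
  rw [hM, Nat.succ_eq_add_one, pow_succ]
  linarith

/-- Before the last relevant epoch, `exp Λ` times the excess of an unfinished epoch exceeds the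
initial excess. -/
lemma card_mul_le_exp_of_lt (hn : 2 ≤ n) (hd : 0 < d) (hε : 0 < ε) (hβ : 0 < β)
    (hm2 : ε / 8 < (1 + d) * (1 / 2) ^ M) {i : ℕ} (hi : i < M) :
    n * β ≤ Real.exp (logFactor n d ε β) * ((d ^ 2 + 2 * d) * ((1 / 2) ^ i) ^ 2) := by
  have hn' : (0 : ℝ) < n := by exact_mod_cast (by omega : 0 < n)
  have h1 : (1 / 2 : ℝ) ^ M ≤ (1 / 2) ^ i * (1 / 2) := by
    rw [← pow_succ]; exact pow_le_pow_of_le_one (by norm_num) (by norm_num) hi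
  have h2 : ε / 4 ≤ (1 + d) * (1 / 2) ^ i := by
    have := mul_le_mul_of_nonneg_left h1 (by linarith : 0 ≤ 1 + d)
    linarith
  have h3 := pow_le_pow_left₀ (by positivity) h2 2
  rw [exp_logFactor hn hd hε hβ, div_mul_eq_mul_div, le_div_iff₀ (by positivity)]
  have h4 : n * β * d ^ 2 * ε ^ 2 ≤ n * β * d ^ 2 * (16 * ((1 + d) * (1 / 2) ^ i) ^ 2) := by
    gcongr; linarith
  have h5 : 0 ≤ n * β * (2 * d) * (16 * ((1 + d) * (1 / 2) ^ i) ^ 2) := by positivity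
  linarith

/-- In the last relevant epoch, the excess is bounded below by the width `ε / 4` rather than by the
slack. -/
lemma card_mul_le_exp_target (hn : 2 ≤ n) (hd : 0 < d) (hε : 0 < ε) (hβ : 0 < β)
    (hm1 : (1 + d) * (1 / 2) ^ M ≤ ε / 4) :
    n * β ≤ Real.exp (logFactor n d ε β) * ((ε / 4) ^ 2 - ((1 / 2) ^ M) ^ 2) := by
  have hn' : (0 : ℝ) < n := by exact_mod_cast (by omega : 0 < n)
  have h3 := pow_le_pow_left₀ (by positivity) hm1 2
  rw [exp_logFactor hn hd hε hβ, div_mul_eq_mul_div, le_div_iff₀ (by positivity)]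
  have h4 : n * β * (16 * ((1 + d) * (1 / 2) ^ M) ^ 2) ≤ n * β * (16 * (ε / 4) ^ 2) := by
    gcongr
  have h5 : 0 ≤ n * β * (2 * d) * ε ^ 2 := by positivity
  linarith

/-- With `3 Λ` in place of `Λ`, the last relevant epoch is included as well. -/
lemma card_mul_le_exp_three_mul (hn : 2 ≤ n) (hd : 0 < d) (hε : 0 < ε) (hβ : 0 < β)
    (hwide : ε ^ 2 < 16 * β) (hm2 : ε / 8 < (1 + d) * (1 / 2) ^ M) {i : ℕ} (hi : i ≤ M) :
    n * β ≤ Real.exp (3 * logFactor n d ε β) * ((d ^ 2 + 2 * d) * ((1 / 2) ^ i) ^ 2) := by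
  have hn' : (0 : ℝ) < n := by exact_mod_cast (by omega : 0 < n)
  have hE2 := two_lt_exp_logFactor hn hd hε hβ hwide
  have h1 : (1 / 2 : ℝ) ^ M ≤ (1 / 2) ^ i :=
    pow_le_pow_of_le_one (by norm_num) (by norm_num) hi
  have h2 : ε / 8 ≤ (1 + d) * (1 / 2) ^ i := by
    have := mul_le_mul_of_nonneg_left h1 (by linarith : 0 ≤ 1 + d)
    linarith
  have h3 := pow_le_pow_left₀ (by positivity) h2 2
  have h4 : 4 * Real.exp (logFactor n d ε β) ≤ Real.exp (3 * logFactor n d ε β) := by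
    have : Real.exp (3 * logFactor n d ε β) = Real.exp (logFactor n d ε β) ^ 2 *
        Real.exp (logFactor n d ε β) := by
      rw [← Real.exp_nat_mul, ← Real.exp_add]; push_cast; ring_nf
    rw [this]
    have : (2 : ℝ) ^ 2 ≤ Real.exp (logFactor n d ε β) ^ 2 := by gcongr
    gcongr
    linarith
  refine le_trans ?_ (mul_le_mul_of_nonneg_right h4 (by positivity))
  rw [exp_logFactor hn hd hε hβ, mul_div_assoc', div_mul_eq_mul_div, le_div_iff₀ (by positivity)]
  have h5 : n * β * d ^ 2 * ε ^ 2 ≤ n * β * d ^ 2 * (64 * ((1 + d) * (1 / 2) ^ i) ^ 2) := by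
    gcongr; linarith
  have h6 : 0 ≤ n * β * (2 * d) * (64 * ((1 + d) * (1 / 2) ^ i) ^ 2) := by positivity
  linarith

/-- A bound on the length of epoch `j` in terms of its confidence parameter `b`, from sampling
every point equally often. It is polynomial in `b`. -/
noncomputable def lateCap (n : ℕ) (s d : ℝ) (j : ℕ) (b : ℝ) : ℕ :=
  ⌈((n * ⌈s * b * 4 ^ (j - 1)⌉₊ : ℕ) : ℝ) *
    Real.log (1 + n * b * 4 ^ (j - 1) / (d ^ 2 + 2 * d))⌉₊ + 1

lemma lateCap_le {s : ℝ} (hs : 0 < s) (hd : 0 < d) (n j : ℕ) :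
    ∃ a : ℝ, 0 ≤ a ∧ ∀ b : ℝ, 1 ≤ b → (lateCap n s d j b : ℝ) ≤ a * b ^ 2 := by
  refine ⟨n * (s * 4 ^ (j - 1) + 1) * (n * 4 ^ (j - 1) / (d ^ 2 + 2 * d)) + 2, by positivity,
    fun b hb => ?_⟩
  have hb0 : 0 < b := by linarith
  set c : ℝ := 4 ^ (j - 1)
  have hc : 0 < c := by positivity
  have h1 : ((n * ⌈s * b * c⌉₊ : ℕ) : ℝ) ≤ n * (s * c + 1) * b := by
    push_cast
    have := (Nat.ceil_lt_add_one (by positivity : 0 ≤ s * b * c)).le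
    calc (n : ℝ) * ⌈s * b * c⌉₊ ≤ n * (s * b * c + 1) := by gcongr
      _ ≤ n * (s * b * c + b) := by gcongr
      _ = _ := by ring
  have h2 : Real.log (1 + n * b * c / (d ^ 2 + 2 * d)) ≤ n * c / (d ^ 2 + 2 * d) * b := by
    have := Real.log_le_sub_one_of_pos (x := 1 + n * b * c / (d ^ 2 + 2 * d)) (by positivity)
    calc _ ≤ n * b * c / (d ^ 2 + 2 * d) := by linarith
      _ = _ := by ring
  have h0 : 0 ≤ Real.log (1 + n * b * c / (d ^ 2 + 2 * d)) :=
    Real.log_nonneg (by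
      have : 0 ≤ n * b * c / (d ^ 2 + 2 * d) := by positivity
      linarith)
  have h3 := mul_le_mul h1 h2 h0 (by positivity)
  have h4 := (Nat.ceil_lt_add_one (mul_nonneg (Nat.cast_nonneg (n * ⌈s * b * c⌉₊)) h0)).le
  have h5 : (1 : ℝ) ≤ b ^ 2 := one_le_pow₀ hb
  rw [lateCap]
  push_cast at h3 h4 ⊢
  nlinarith

/-- The confidence parameter of a late epoch can be chosen so large that it dominates the union
bound up to the end of that epoch, because the former enters the epoch length polynomially and the
latter is logarithmic. -/
lemma exists_late_beta {s : ℝ} (hs : 0 < s) (hd : 0 < d) (n : ℕ) (hn : 0 < n) {δ : ℝ} (hδ : 0 < δ)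
    (β : ℝ) (N j : ℕ) : ∃ b : ℝ, 1 < b ∧ β ≤ b ∧
      ∀ t : ℕ, 1 ≤ t → t ≤ N + lateCap n s d j b →
        2 * Real.log (5 * n * (t : ℝ) ^ 2 / δ) ≤ b := by
  have hn' : (0 : ℝ) < n := by exact_mod_cast hn
  obtain ⟨a, ha, hcap⟩ := lateCap_le hs hd n j
  have hlog : ∀ᶠ b : ℝ in Filter.atTop, ‖Real.log b‖ ≤ (1 / 16) * ‖b‖ :=
    Real.isLittleO_log_id_atTop.bound (by norm_num)
  obtain ⟨b, hb1, hbβ, hbc, hbl⟩ := ((Filter.eventually_gt_atTop (1 : ℝ)).and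
    ((Filter.eventually_ge_atTop β).and ((Filter.eventually_ge_atTop
      (4 * Real.log (5 * n * (N + a + 1) ^ 2 / δ))).and hlog))).exists
  refine ⟨b, hb1, hbβ, fun t ht1 ht => ?_⟩
  have hb0 : 0 < b := by linarith
  have ht0 : (0 : ℝ) < t := by exact_mod_cast ht1
  have h1 : (t : ℝ) ≤ (N + a + 1) * b ^ 2 := by
    have h2 : (t : ℝ) ≤ N + lateCap n s d j b := by exact_mod_cast ht
    have h3 := hcap b hb1.le
    have h4 : (1 : ℝ) ≤ b ^ 2 := one_le_pow₀ hb1.le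
    have h5 : (N : ℝ) * 1 ≤ N * b ^ 2 := by gcongr
    linarith
  have h2 : Real.log (5 * n * (t : ℝ) ^ 2 / δ) ≤
      Real.log (5 * n * (N + a + 1) ^ 2 / δ * b ^ 4) := by
    refine Real.log_le_log (by positivity) ?_
    calc 5 * n * (t : ℝ) ^ 2 / δ ≤ 5 * n * ((N + a + 1) * b ^ 2) ^ 2 / δ := by gcongr
      _ = _ := by ring
  rw [Real.log_mul (by positivity) (by positivity), Real.log_pow] at h2
  rw [Real.norm_eq_abs, Real.norm_eq_abs, abs_of_pos hb0] at hbl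
  have h3 := (le_abs_self _).trans hbl
  push_cast at h2
  linarith

/-- Recursive choice of the confidence parameters after epoch `i₀`. -/
lemma exists_beta {s : ℝ} (hs : 0 < s) (hd : 0 < d) (n : ℕ) (hn : 0 < n) {δ : ℝ} (hδ : 0 < δ)
    {β : ℝ} (hβ : 1 < β) (i₀ N₀ : ℕ) : ∃ beta : ℕ → ℝ, (∀ i, 1 < beta i) ∧ (∀ i, β ≤ beta i) ∧
      (∀ i ≤ i₀, beta i = β) ∧ ∀ i, i₀ < i → ∀ t : ℕ, 1 ≤ t →
        t ≤ N₀ + ∑ j ∈ Finset.Ioc i₀ i, lateCap n s d j (beta j) →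
          2 * Real.log (5 * n * (t : ℝ) ^ 2 / δ) ≤ beta i := by
  choose b hb1 hbβ hb using exists_late_beta hs hd n hn hδ β
  let N : ℕ → ℕ := fun k => Nat.rec N₀ (fun k N => N + lateCap n s d (i₀ + k + 1)
    (b N (i₀ + k + 1))) k
  have hN : ∀ k, N (k + 1) = N k + lateCap n s d (i₀ + k + 1) (b (N k) (i₀ + k + 1)) :=
    fun k => rfl
  let beta : ℕ → ℝ := fun i => if i ≤ i₀ then β else b (N (i - i₀ - 1)) i
  have hbeta : ∀ k, beta (i₀ + k + 1) = b (N k) (i₀ + k + 1) := fun k => by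
    simp only [beta]
    rw [if_neg (by omega), show i₀ + k + 1 - i₀ - 1 = k by omega]
  have hsum : ∀ k, N₀ + ∑ j ∈ Finset.Ioc i₀ (i₀ + k), lateCap n s d j (beta j) = N k := by
    intro k
    induction k with
    | zero => simp [N]
    | succ k ih =>
      rw [← add_assoc, Finset.sum_Ioc_succ_top (by omega), ← add_assoc, ih, hN, hbeta]
  refine ⟨beta, fun i => ?_, fun i => ?_, fun i hi => if_pos hi, fun i hi t ht1 ht => ?_⟩
  · simp only [beta]; split_ifs
    exacts [hβ, hb1 _ _]
  · simp only [beta]; split_ifs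
    exacts [le_rfl, hbβ _ _]
  · obtain ⟨k, rfl⟩ : ∃ k, i = i₀ + k + 1 := ⟨i - i₀ - 1, by omega⟩
    rw [add_assoc, hsum, hN] at ht
    rw [hbeta]
    exact hb _ _ t ht1 ht

end Numeric

section Schedule

lemma sum_Ioc_pred (F : ℕ → ℕ) (n : ℕ) :
    ∑ j ∈ Finset.Ioc 0 n, F (j - 1) = ∑ i ∈ Finset.range n, F i := by
  induction n with
  | zero => simp
  | succ n ih => rw [Finset.sum_Ioc_succ_top (by omega), Finset.sum_range_succ, ih]; rfl

variable {D : Type*} [Fintype D] [Nonempty D] {k : D → D → ℝ} {s d : ℝ}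

/-- `sampleCount` many samples reach the target of the epoch. -/
lemma exists_sampleCount_points (hk : (Matrix.of k).PosSemidef) (hk1 : ∀ x, k x x = 1)
    (hs : 0 < s) {β : ℝ} (hβ : 0 < β) {T i : ℕ}
    (hT : sampleCount (infoGain k s T) β s i ≤ T) :
    ∃ q : Fin (sampleCount (infoGain k s T) β s i) → D,
      ∀ u, β * postVar k s q u ≤ ((1 / 2) ^ i) ^ 2 := by
  have h1 : (1 : ℝ) / (4 ^ i * β) / s = 1 / (4 ^ i * (β * s)) := by
    rw [div_div, mul_assoc]
  have hl : 0 < Real.log (1 + 1 / (4 ^ i * (β * s))) := Real.log_pos (by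
    have : 0 < 1 / (4 ^ i * (β * s)) := by positivity
    linarith)
  obtain ⟨q, hq⟩ := exists_postVar_le hk hk1 hs (v := 1 / (4 ^ i * β)) (by positivity) hT (by
    rw [h1, ← div_lt_iff₀ hl, sampleCount]
    push_cast
    exact Nat.lt_floor_add_one _)
  refine ⟨q, fun u => ?_⟩
  rw [half_pow_sq]
  calc β * postVar k s q u ≤ β * (1 / (4 ^ i * β)) := by gcongr; exact hq u
    _ = _ := by field_simp

variable [DecidableEq D] {beta : ℕ → ℝ} {task : Task} {sel : ℕ → Finset D → D} {f : D → ℝ}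
  {z : ℕ → ℝ}

/-- The bound `lateCap` applies to every epoch, with the number of samples from
`exists_postVar_le_div`. -/
lemma stepCount_lt_lateCap (hk : (Matrix.of k).PosSemidef) (hk1 : ∀ x, k x x = 1) (hs : 0 < s)
    (hsub : SubmodularVarReduction k s) (hsel : ∀ t A, A.Nonempty → sel t A ∈ A) (hd : 0 < d)
    (hbeta : ∀ i, 1 < beta i) {t : ℕ}
    (hM : ((halvingParams k s d beta).run task sel f z t).M.Nonempty) {j : ℕ}
    (hj : ((halvingParams k s d beta).run task sel f z t).epoch = j) :
    (halvingParams k s d beta).stepCount task sel f z j t <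
      lateCap (Fintype.card D) s d j (beta j) := by
  rcases Nat.eq_zero_or_pos t with rfl | ht
  · simp [Params.stepCount, lateCap]
  have hn : (0 : ℝ) < Fintype.card D := by exact_mod_cast Fintype.card_pos
  have hb : 0 < beta j := zero_lt_one.trans (hbeta j)
  have hm : 0 < ⌈s * beta j * 4 ^ (j - 1)⌉₊ := Nat.ceil_pos.2 (by positivity)
  obtain ⟨q, hq⟩ := exists_postVar_le_div hk hs hm
  have h := Params.stepCount_lt_of_nonempty (P := halvingParams k s d beta) hk hk1 hs hsub hsel hd
    hbeta (halvingParams_eta k s d beta) ht hM (Nat.mul_pos Fintype.card_pos hm) hj q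
    (fun u => ?_) (Λ := Real.log (1 + Fintype.card D * beta j * 4 ^ (j - 1) / (d ^ 2 + 2 * d))) ?_
  · rw [lateCap]
    exact Nat.lt_succ_of_le (by exact_mod_cast (h.trans_le (Nat.le_ceil _)).le)
  · rw [halvingParams_eta, half_pow_sq]
    have h1 := hq u
    have h2 := Nat.le_ceil (s * beta j * 4 ^ (j - 1))
    calc beta j * postVar k s q u ≤ beta j * (s / ⌈s * beta j * 4 ^ (j - 1)⌉₊) := by gcongr
      _ ≤ beta j * (s / (s * beta j * 4 ^ (j - 1))) := by gcongr
      _ = _ := by field_simp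
  · rw [Real.exp_log (by positivity), halvingParams_eta, half_pow_sq]
    have : (1 + Fintype.card D * beta j * 4 ^ (j - 1) / (d ^ 2 + 2 * d)) *
        ((d ^ 2 + 2 * d) * (1 / 4 ^ (j - 1))) =
        (d ^ 2 + 2 * d) * (1 / 4 ^ (j - 1)) + Fintype.card D * beta j := by
      field_simp
    rw [this]
    have : 0 ≤ (d ^ 2 + 2 * d) * (1 / 4 ^ (j - 1) : ℝ) := by positivity
    linarith

/-- With the confidence parameters of `exists_beta`, the parameter in use at time `t` is at least
what the union bound needs, provided that the epochs up to `i₀` are over at time `N₀`. -/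
lemma le_beta_epoch (hk : (Matrix.of k).PosSemidef) (hk1 : ∀ x, k x x = 1) (hs : 0 < s)
    (hsub : SubmodularVarReduction k s) (hsel : ∀ t A, A.Nonempty → sel t A ∈ A) (hd : 0 < d)
    (hbeta : ∀ i, 1 < beta i) {δ : ℝ} {i₀ N₀ : ℕ}
    (hlate : ∀ i, i₀ < i → ∀ t : ℕ, 1 ≤ t →
        t ≤ N₀ + ∑ j ∈ Finset.Ioc i₀ i, lateCap (Fintype.card D) s d j (beta j) →
          2 * Real.log (5 * Fintype.card D * (t : ℝ) ^ 2 / δ) ≤ beta i)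
    (hlow : ∀ t, ((halvingParams k s d beta).run task sel f z t).M.Nonempty →
      ((halvingParams k s d beta).run task sel f z t).epoch ≤ i₀ → t < N₀) {t : ℕ}
    (hM : ((halvingParams k s d beta).run task sel f z t).M.Nonempty) (ht : N₀ < t + 1) :
    2 * Real.log (5 * Fintype.card D * ((t + 1 : ℕ) : ℝ) ^ 2 / δ) ≤
      beta ((halvingParams k s d beta).run task sel f z t).epoch := by
  set P := halvingParams k s d beta
  have hM' : ∀ r < t + 1, (P.run task sel f z r).M.Nonempty := fun r hr =>
    hM.mono (P.run_M_antitone task sel f z (Nat.lt_succ_iff.1 hr))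
  refine hlate _ ?_ (t + 1) (by omega) ?_
  · by_contra h
    exact absurd (hlow t hM (not_lt.1 h)) (by omega)
  · exact P.le_add_sum_of_stepCount_lt task sel f z
      (fun j => lateCap (Fintype.card D) s d j (beta j))
      (fun r hr => P.run_epoch_monotone task sel f z (Nat.lt_succ_iff.1 hr))
      (fun r hr h => hlow r (hM' r hr) h)
      (fun r hr _ => stepCount_lt_lateCap hk hk1 hs hsub hsel hd hbeta (hM' r hr) rfl)

/-- Confidence parameters for which the run reaches half-widths `ε / 4` by time `T`, and which
dominate the union bound with `betaT` up to a time `N₀ ≤ T²` and a faster growing one afterwards. -/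
theorem exists_schedule (hD : 2 ≤ Fintype.card D) (hk : (Matrix.of k).PosSemidef)
    (hk1 : ∀ x, k x x = 1) {σ : ℝ} (hσ : 0 < σ) (hsub : SubmodularVarReduction k (σ ^ 2))
    (hd : 0 < d) {δ : ℝ} (hδ0 : 0 < δ) (hδ1 : δ < 1) {ε : ℝ} (hε0 : 0 < ε)
    (hε1 : ε < 4 * (1 + d)) {T : ℕ} (hT : 1 ≤ T)
    (hTB : improvedBound (Fintype.card D) σ d ε (infoGain k (σ ^ 2) T)
      (betaT (Fintype.card D) δ T) ≤ T) :
    ∃ (beta : ℕ → ℝ) (N₀ : ℕ), (∀ i, 1 < beta i) ∧ (∀ i, betaT (Fintype.card D) δ T ≤ beta i) ∧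
      N₀ ≤ T ^ 2 ∧ ∀ (task : Task) (sel : ℕ → Finset D → D) (f : D → ℝ) (z : ℕ → ℝ),
        (∀ t A, A.Nonempty → sel t A ∈ A) →
        (∀ t, ((halvingParams k (σ ^ 2) d beta).run task sel f z t).M.Nonempty → N₀ < t + 1 →
          2 * Real.log (5 * Fintype.card D * ((t + 1 : ℕ) : ℝ) ^ 2 / δ) ≤
            beta ((halvingParams k (σ ^ 2) d beta).run task sel f z t).epoch) ∧
        ∃ t₀, t₀ + 1 ≤ T ∧
          ∀ u ∈ ((halvingParams k (σ ^ 2) d beta).run task sel f z (t₀ + 1)).M,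
            Real.sqrt (beta ((halvingParams k (σ ^ 2) d beta).run task sel f z t₀).epoch) *
              Real.sqrt ((halvingParams k (σ ^ 2) d beta).var
                ((halvingParams k (σ ^ 2) d beta).run task sel f z (t₀ + 1)).hist u) ≤ ε / 4 := by
  have hs : 0 < σ ^ 2 := by positivity
  set n := Fintype.card D with hn
  set β := betaT n δ T with hβdef
  have hβ : 2.15 ≤ β := betaT_ge hD hδ0 hδ1 hT
  have hβ0 : 0 < β := by linarith
  rcases lt_or_ge (ε ^ 2) (16 * β) with hwide | hnarrow
  · obtain ⟨M, hM1, hm1, hm2⟩ := exists_target_index hd hε0 hε1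
    obtain ⟨beta, hb1, hbβ, hbase, hlate⟩ := exists_beta hs hd n (by omega) hδ0 (β := β)
      (by linarith) (M + 1) (T ^ 2)
    refine ⟨beta, T ^ 2, hb1, hbβ, le_rfl, fun task sel f z hsel => ?_⟩
    set P := halvingParams k (σ ^ 2) d beta with hP
    have hηP : ∀ i, P.eta i = (1 / 2) ^ (i - 1) := halvingParams_eta k (σ ^ 2) d beta
    obtain ⟨hT3, hKT, hsum⟩ := sum_epochLength_le hD hσ hd hε0
      (log_one_add_inv_le_infoGain hk hk1 hs hT) hβ hwide hM1 hm1 hm2 hTB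
    set γ := infoGain k (σ ^ 2) T with hγ
    set Λ := logFactor n d ε β with hΛ
    have hΛ0 : 0 < Λ := by
      have h1 : 1 < Real.exp Λ := by
        linarith [two_lt_exp_logFactor hD hd hε0 hβ0 hwide]
      exact Real.one_lt_exp_iff.1 h1
    have hq : ∀ j, j ≤ M + 1 → ∃ q : Fin (sampleCount γ β (σ ^ 2) (j - 1)) → D,
        ∀ u, β * postVar k (σ ^ 2) q u ≤ P.eta j ^ 2 := fun j hj => by
      rw [hηP]
      exact exists_sampleCount_points hk hk1 hs hβ0 (hKT (j - 1) (by omega))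
    constructor
    · -- the epochs up to `M + 1` take at most `3 T ≤ T²` steps
      intro t hMt hNt
      refine le_beta_epoch hk hk1 hs hsub hsel hd hb1 hlate (fun t hMt hle => ?_) hMt hNt
      have hMr : ∀ r < t + 1, (P.run task sel f z r).M.Nonempty := fun r hr =>
        hMt.mono (P.run_M_antitone task sel f z (Nat.lt_succ_iff.1 hr))
      have hle' : ∀ r < t + 1, (P.run task sel f z r).epoch ≤ M + 1 := fun r hr =>
        (P.run_epoch_monotone task sel f z (Nat.lt_succ_iff.1 hr)).trans hle
      have h1 := P.le_add_sum_of_stepCount_lt task sel f z (t := t + 1) (m := M + 1) (i₀ := 0)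
        (N₀ := 0) (fun j => 3 * ⌈sampleCount γ β (σ ^ 2) (j - 1) * Λ⌉₊) hle'
        (fun r _ h => absurd (P.one_le_run_epoch task sel f z r) (by omega)) (fun r hr _ => ?_)
      · rw [← Finset.mul_sum, sum_Ioc_pred (fun i => ⌈sampleCount γ β (σ ^ 2) i * Λ⌉₊)] at h1
        nlinarith
      · generalize hj : (P.run task sel f z r).epoch = j
        have hjm : j ≤ M + 1 := hj ▸ hle' r hr
        have hK0 : (0 : ℝ) < sampleCount γ β (σ ^ 2) (j - 1) := by
          exact_mod_cast Nat.succ_pos _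
        rcases Nat.eq_zero_or_pos r with rfl | hr0
        · have : 0 < ⌈sampleCount γ β (σ ^ 2) (j - 1) * Λ⌉₊ := Nat.ceil_pos.2 (by positivity)
          simpa [Params.stepCount] using this
        · obtain ⟨q, hq⟩ := hq j hjm
          have h2 := Params.stepCount_lt_of_nonempty (P := P) hk hk1 hs hsub hsel hd hb1 hηP hr0
            (hMr r hr) (K := sampleCount γ β (σ ^ 2) (j - 1)) (Nat.succ_pos _) hj q
            (by rw [show P.beta j = β from hbase j hjm]; exact hq)
            (Λ := 3 * Λ) (by
              rw [hηP, show P.beta j = β from hbase j hjm]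
              exact card_mul_le_exp_three_mul hD hd hε0 hβ0 hwide hm2 (by omega))
          have h3 := Nat.le_ceil (sampleCount γ β (σ ^ 2) (j - 1) * Λ)
          have h4 : (P.stepCount task sel f z j r : ℝ) <
              ((3 * ⌈sampleCount γ β (σ ^ 2) (j - 1) * Λ⌉₊ : ℕ) : ℝ) := by
            push_cast
            linarith
          exact_mod_cast h4
    · -- the width condition at time `r`
      let Good : ℕ → Prop := fun r => ∀ u ∈ (P.run task sel f z r).M,
        Real.sqrt β * Real.sqrt (P.var (P.run task sel f z r).hist u) ≤ ε / 4
      have hmono : ∀ {r r'}, r ≤ r' → Good r → Good r' := fun {r r'} hrr' h u hu =>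
        (mul_le_mul_of_nonneg_left (Real.sqrt_le_sqrt
          (Params.run_var_antitone hk hs task sel f z u hrr')) (Real.sqrt_nonneg _)).trans
          (h u (P.run_M_antitone task sel f z hrr' hu))
      have hηm : (1 + P.dbar) * P.eta (M + 1) ≤ ε / 4 := by
        rw [hηP]; exact hm1
      have hepoch : ∀ r, ¬ Good r → (P.run task sel f z r).epoch ≤ M + 1 := by
        intro r hr
        by_contra h
        refine hr fun u hu => ?_
        have h1 := Params.run_epochDone_of_lt hk hs (Nat.succ_pos M) (not_le.1 h) u hu
        rw [show P.beta (M + 1) = β from hbase _ le_rfl] at h1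
        exact h1.trans hηm
      have hgoodT : Good T := by
        by_contra hT
        have hbad : ∀ r < T + 1, ¬ Good r := fun r hr h => hT (hmono (Nat.lt_succ_iff.1 hr) h)
        have h1 := P.le_add_sum_of_stepCount_lt task sel f z (t := T + 1) (m := M + 1) (i₀ := 0)
          (N₀ := 0) (fun j => ⌈sampleCount γ β (σ ^ 2) (j - 1) * Λ⌉₊)
          (fun r hr => hepoch r (hbad r hr))
          (fun r _ h => absurd (P.one_le_run_epoch task sel f z r) (by omega)) (fun r hr _ => ?_)
        · rw [sum_Ioc_pred (fun i => ⌈sampleCount γ β (σ ^ 2) i * Λ⌉₊)] at h1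
          omega
        · have hjm := hepoch r (hbad r hr)
          have hj1 := P.one_le_run_epoch task sel f z r
          generalize hj : (P.run task sel f z r).epoch = j at hjm hj1
          obtain ⟨q, hq⟩ := hq j hjm
          have hbr := hbad r hr
          simp only [Good, not_forall, not_le] at hbr
          obtain ⟨u, hu, hlt⟩ := hbr
          have h2 := Params.stepCount_lt_of_wide (P := P) hk hk1 hs hsub hsel hd hηP hβ0 hε0 hbase
            hηm hj hjm hu hlt (K := sampleCount γ β (σ ^ 2) (j - 1)) (Nat.succ_pos _) q hq hΛ0
            (fun hlt => by
              rw [hηP]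
              exact card_mul_le_exp_of_lt hD hd hε0 hβ0 hm2 (by omega))
            (by rw [hηP]; exact card_mul_le_exp_target hD hd hε0 hβ0 hm1)
          exact Nat.lt_ceil.2 h2
      classical
      have hex : ∃ r, Good r := ⟨T, hgoodT⟩
      have hle : Nat.find hex ≤ T := Nat.find_min' hex hgoodT
      rcases Nat.eq_zero_or_pos (Nat.find hex) with h0 | h0
      · refine ⟨0, hT, fun u hu => ?_⟩
        have h1 : Good 0 := h0 ▸ Nat.find_spec hex
        have h2 : beta (P.run task sel f z 0).epoch = β := hbase 1 (by omega)
        rw [h2]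
        exact hmono (Nat.zero_le 1) h1 u hu
      · refine ⟨Nat.find hex - 1, by omega, ?_⟩
        have h1 := hepoch _ (Nat.find_min hex (m := Nat.find hex - 1) (by omega))
        rw [hbase _ h1, Nat.sub_add_cancel h0]
        exact Nat.find_spec hex
  · obtain ⟨beta, hb1, hbβ, hbase, hlate⟩ := exists_beta hs hd n (by omega) hδ0 (β := β)
      (by linarith) 1 1
    refine ⟨beta, 1, hb1, hbβ, Nat.one_le_pow _ _ hT, fun task sel f z hsel => ?_⟩
    set P := halvingParams k (σ ^ 2) d beta with hP
    -- with `√β ≤ ε / 4` already the prior widths suffice, and the first step completes epoch `1`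
    have hsqrt : Real.sqrt β ≤ ε / 4 := by
      rw [Real.sqrt_le_left (by positivity)]
      linarith
    have hw : ∀ l u, Real.sqrt β * Real.sqrt (P.var l u) ≤ ε / 4 := fun l u =>
      (mul_le_of_le_one_right (Real.sqrt_nonneg _) (Real.sqrt_le_one.2
        (Params.var_le_one hk hk1 hs l u))).trans hsqrt
    constructor
    · intro t hMt hNt
      refine le_beta_epoch hk hk1 hs hsub hsel hd hb1 hlate (fun t hMt hle => ?_) hMt hNt
      by_contra ht
      refine Params.run_not_epochDone (by omega) (Params.exists_not_epochDone hk hk1 hs hb1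
        (halvingParams_eta k (σ ^ 2) d beta) hMt _) fun u _ => ?_
      have h1 : (P.run task sel f z t).epoch = 1 :=
        le_antisymm hle (P.one_le_run_epoch task sel f z t)
      rw [h1, halvingParams_eta, show P.beta 1 = β from hbase 1 le_rfl]
      have := hw (P.run task sel f z t).hist u
      simp only [Nat.sub_self, pow_zero, mul_one]
      change _ ≤ 1 + d
      linarith
    · refine ⟨0, hT, fun u _ => ?_⟩
      have h2 : beta (P.run task sel f z 0).epoch = β := hbase 1 le_rfl
      rw [h2]
      exact hw _ u

end Schedule

/-! ### Gaussian tails and residuals -/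

section Gaussian

open scoped ENNReal NNReal

/-- The upper tail of the standard Gaussian at `c ≥ 0`: shift the density by `c`. -/
lemma gaussianReal_Ioi_le {c : ℝ} (hc : 0 ≤ c) :
    gaussianReal 0 1 (Set.Ioi c) ≤
      ENNReal.ofReal (Real.exp (-c ^ 2 / 2)) * gaussianReal 0 1 (Set.Ioi 0) := by
  have h1 : gaussianReal 0 1 (Set.Ioi c) = gaussianReal (-c) 1 (Set.Ioi 0) := by
    have := gaussianReal_map_add_const (μ := 0) (v := 1) (-c)
    rw [zero_add] at this
    rw [← this, Measure.map_apply (by fun_prop) measurableSet_Ioi]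
    congr 1
    ext x
    simp
  rw [h1, gaussianReal_apply _ one_ne_zero, gaussianReal_apply _ one_ne_zero,
    ← lintegral_const_mul _ (measurable_gaussianPDF 0 1)]
  refine setLIntegral_mono ((measurable_gaussianPDF 0 1).const_mul _) fun x hx => ?_
  rw [gaussianPDF, gaussianPDF, ← ENNReal.ofReal_mul (Real.exp_pos _).le]
  refine ENNReal.ofReal_le_ofReal ?_
  rw [gaussianPDFReal, gaussianPDFReal, mul_left_comm, ← Real.exp_add]
  refine mul_le_mul_of_nonneg_left (Real.exp_le_exp.2 ?_) (by positivity)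
  have : 0 ≤ c * x := mul_nonneg hc (le_of_lt hx)
  simp only [NNReal.coe_one]
  nlinarith

/-- The two tails together carry at most the factor one, since the two half-lines are disjoint. -/
lemma gaussianReal_abs_gt_le {c : ℝ} (hc : 0 ≤ c) :
    gaussianReal 0 1 {x | c < |x|} ≤ ENNReal.ofReal (Real.exp (-c ^ 2 / 2)) := by
  have hsymm : ∀ a : ℝ, gaussianReal 0 1 (Set.Iio (-a)) = gaussianReal 0 1 (Set.Ioi a) := by
    intro a
    have := gaussianReal_map_neg (μ := 0) (v := 1)
    rw [neg_zero] at this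
    conv_rhs => rw [← this, Measure.map_apply measurable_neg measurableSet_Ioi]
    congr 1
    ext x
    simp
  have h1 : {x : ℝ | c < |x|} = Set.Ioi c ∪ Set.Iio (-c) := by
    ext x
    simp [lt_abs, lt_neg]
  have h2 : gaussianReal 0 1 (Set.Ioi 0) + gaussianReal 0 1 (Set.Iio 0) ≤ 1 := by
    rw [← measure_union (Set.Ioi_disjoint_Iio_same) measurableSet_Iio]
    exact prob_le_one
  have h3 := hsymm 0
  rw [neg_zero] at h3
  rw [h1]
  refine (measure_union_le _ _).trans ?_
  rw [hsymm]
  calc _ ≤ ENNReal.ofReal (Real.exp (-c ^ 2 / 2)) * gaussianReal 0 1 (Set.Ioi 0) +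
        ENNReal.ofReal (Real.exp (-c ^ 2 / 2)) * gaussianReal 0 1 (Set.Ioi 0) :=
        add_le_add (gaussianReal_Ioi_le hc) (gaussianReal_Ioi_le hc)
    _ = ENNReal.ofReal (Real.exp (-c ^ 2 / 2)) *
        (gaussianReal 0 1 (Set.Ioi 0) + gaussianReal 0 1 (Set.Iio 0)) := by rw [h3, mul_add]
    _ ≤ ENNReal.ofReal (Real.exp (-c ^ 2 / 2)) * 1 := by gcongr
    _ = _ := mul_one _

/-- `P(|X| > √b √v) ≤ exp(-b / 2)` for `X ∼ N(0, v)`. -/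
lemma gaussianReal_abs_gt_sqrt_le {b v : ℝ} (hb : 0 ≤ b) (hv : 0 < v) :
    gaussianReal 0 v.toNNReal {x | Real.sqrt b * Real.sqrt v < |x|} ≤
      ENNReal.ofReal (Real.exp (-b / 2)) := by
  have h1 : gaussianReal 0 v.toNNReal = (gaussianReal 0 1).map (Real.sqrt v * ·) := by
    rw [gaussianReal_map_const_mul, mul_zero, mul_one]
    congr 1
    ext
    simp [hv.le]
  have hm : MeasurableSet {x : ℝ | Real.sqrt b * Real.sqrt v < |x|} :=
    measurableSet_lt measurable_const (by fun_prop)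
  rw [h1, Measure.map_apply (by fun_prop) hm]
  have hv' := Real.sqrt_pos.2 hv
  have h2 : (Real.sqrt v * ·) ⁻¹' {x : ℝ | Real.sqrt b * Real.sqrt v < |x|} =
      {x | Real.sqrt b < |x|} := by
    ext x
    simp only [Set.mem_preimage, Set.mem_ofPred_eq, abs_mul, abs_of_pos hv']
    rw [mul_comm (Real.sqrt v), mul_lt_mul_iff_left₀ hv']
  rw [h2]
  have := gaussianReal_abs_gt_le (Real.sqrt_nonneg b)
  rwa [Real.sq_sqrt hb] at this

end Gaussian

section Residual

/-- A Gaussian process `f` with mean zero and covariance `k`, and independent Gaussian noise `z` of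
variance `s`. -/
structure GPModel {D Ω : Type*} [MeasurableSpace Ω] (k : D → D → ℝ) (s : ℝ) (f : D → Ω → ℝ)
    (z : ℕ → Ω → ℝ) (μ : Measure Ω) : Prop where
  psd : (Matrix.of k).PosSemidef
  pos : 0 < s
  gaussian : IsGaussianProcess f μ
  mean_zero : ∀ x, ∫ ω, f x ω ∂μ = 0
  cov_eq : ∀ x x', cov[f x, f x'; μ] = k x x'
  noise : ∀ t, HasLaw (z t) (gaussianReal 0 s.toNNReal) μ
  noise_indep : iIndepFun z μ
  indep : IndepFun (fun ω x => f x ω) (fun ω t => z t ω) μ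

/-- The observations at the deterministic points `p`, in the order of time. -/
def obs {D Ω : Type*} (f : D → Ω → ℝ) (z : ℕ → Ω → ℝ) {t : ℕ} (p : Fin t → D) (r : Fin t)
    (ω : Ω) : ℝ :=
  f (p r) ω + z r ω

/-- The error of the posterior mean at `x`, for deterministic points `p`. -/
noncomputable def resid {D Ω : Type*} (k : D → D → ℝ) (s : ℝ) (f : D → Ω → ℝ) (z : ℕ → Ω → ℝ)
    {t : ℕ} (p : Fin t → D) (x : D) (ω : Ω) : ℝ :=
  f x ω - ∑ r, postWeights k s p x r * obs f z p r ω

lemma resid_eq {D Ω : Type*} {k : D → D → ℝ} {s : ℝ} {f : D → Ω → ℝ} {z : ℕ → Ω → ℝ}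
    (hk : (Matrix.of k).PosSemidef) {t : ℕ} (p : Fin t → D) (x : D) (ω : Ω) :
    resid k s f z p x ω = f x ω - postMean k s p (fun r => obs f z p r ω) x := by
  rw [postMean_eq hk]; rfl

namespace GPModel

variable {D : Type*} {k : D → D → ℝ} {s : ℝ} {Ω : Type*} [MeasurableSpace Ω]
  {μ : Measure Ω} {f : D → Ω → ℝ} {z : ℕ → Ω → ℝ}

lemma memLp_reward (h : GPModel k s f z μ) (x : D) : MemLp (f x) 2 μ :=
  (h.gaussian.hasGaussianLaw_eval x).memLp_two

lemma memLp_noise (h : GPModel k s f z μ) (t : ℕ) : MemLp (z t) 2 μ :=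
  (h.noise t).hasGaussianLaw.memLp_two

lemma memLp_obs (h : GPModel k s f z μ) {t : ℕ} (p : Fin t → D) (r : Fin t) :
    MemLp (obs f z p r) 2 μ :=
  (h.memLp_reward _).add (h.memLp_noise _)

lemma covariance_reward_noise (h : GPModel k s f z μ) (x : D) (r : ℕ) : cov[f x, z r; μ] = 0 :=
  (h.indep.comp (measurable_pi_apply x) (measurable_pi_apply r)).covariance_eq_zero
    (h.memLp_reward x) (h.memLp_noise r)

lemma memLp_resid (h : GPModel k s f z μ) {t : ℕ} (p : Fin t → D) (x : D) :
    MemLp (resid k s f z p x) 2 μ := by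
  have e : resid k s f z p x = f x - ∑ r, postWeights k s p x r • obs f z p r := by
    ext ω
    simp [resid]
  rw [e]
  exact (h.memLp_reward x).sub (memLp_finsetSum' _ fun r _ => (h.memLp_obs p r).const_smul _)

variable [IsProbabilityMeasure μ]

lemma covariance_reward_obs (h : GPModel k s f z μ) {t : ℕ} (p : Fin t → D) (x : D) (r : Fin t) :
    cov[f x, obs f z p r; μ] = k x (p r) := by
  have e : obs f z p r = f (p r) + z r := rfl
  rw [e, covariance_add_right (h.memLp_reward x) (h.memLp_reward _) (h.memLp_noise _), h.cov_eq,
    h.covariance_reward_noise, add_zero]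

lemma covariance_obs_obs (h : GPModel k s f z μ) {t : ℕ} (p : Fin t → D) (q r : Fin t) :
    cov[obs f z p q, obs f z p r; μ] = noisyGram k s p q r := by
  have e : obs f z p q = f (p q) + z q := rfl
  have e' : obs f z p r = f (p r) + z r := rfl
  rw [e, covariance_add_left (h.memLp_reward _) (h.memLp_noise _) (h.memLp_obs p r),
    h.covariance_reward_obs, e', covariance_add_right (h.memLp_noise _)
    (h.memLp_reward _) (h.memLp_noise _), covariance_comm,
    h.covariance_reward_noise, zero_add]
  simp only [noisyGram, gram, Matrix.add_apply, Matrix.of_apply, Matrix.diagonal_apply]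
  congr 1
  split_ifs with hqr
  · subst hqr
    rw [covariance_self (h.noise _).aemeasurable, (h.noise _).variance_eq, variance_id_gaussianReal,
      Real.coe_toNNReal _ h.pos.le]
  · exact (h.noise_indep.indepFun (fun h => hqr (Fin.ext h))).covariance_eq_zero (h.memLp_noise _)
      (h.memLp_noise _)

lemma covariance_resid_left (h : GPModel k s f z μ) {t : ℕ} (p : Fin t → D) (x : D)
    {Y : Ω → ℝ} (hY : MemLp Y 2 μ) :
    cov[resid k s f z p x, Y; μ] =
      cov[f x, Y; μ] - ∑ r, postWeights k s p x r * cov[obs f z p r, Y; μ] := by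
  have e : resid k s f z p x = f x - ∑ r, postWeights k s p x r • obs f z p r := by
    ext ω
    simp [resid]
  rw [e, covariance_sub_left (h.memLp_reward x) (memLp_finsetSum' _ fun r _ =>
    (h.memLp_obs p r).const_smul _) hY,
    covariance_sum_left (fun r => (h.memLp_obs p r).const_smul _) hY]
  simp only [covariance_smul_left]

lemma covariance_resid_obs (h : GPModel k s f z μ) {t : ℕ} (p : Fin t → D) (x : D)
    (r : Fin t) : cov[resid k s f z p x, obs f z p r; μ] = 0 := by
  rw [h.covariance_resid_left p x (h.memLp_obs p r), h.covariance_reward_obs]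
  simp only [h.covariance_obs_obs]
  have e := congrFun (noisyGram_mulVec_postWeights h.psd h.pos p x) r
  rw [Matrix.mulVec, dotProduct] at e
  rw [kernel_symm h.psd x, ← e, sub_eq_zero]
  refine Finset.sum_congr rfl fun q _ => ?_
  rw [mul_comm, ← congrFun (congrFun (noisyGram_transpose h.psd p) q) r, Matrix.transpose_apply]

lemma variance_resid (h : GPModel k s f z μ) {t : ℕ} (p : Fin t → D) (x : D) :
    Var[resid k s f z p x; μ] = postVar k s p x := by
  have hR := h.memLp_resid p x
  rw [← covariance_self hR.aemeasurable, h.covariance_resid_left p x hR]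
  have h1 : ∀ r, cov[obs f z p r, resid k s f z p x; μ] = 0 := fun r => by
    rw [covariance_comm]; exact h.covariance_resid_obs p x r
  simp only [h1, mul_zero, Finset.sum_const_zero, sub_zero]
  rw [covariance_comm, h.covariance_resid_left p x (h.memLp_reward x), h.cov_eq, postVar_eq,
    dotProduct]
  congr 1
  refine Finset.sum_congr rfl fun r _ => ?_
  rw [covariance_comm, h.covariance_reward_obs, mul_comm, kernel_symm h.psd x]

lemma integral_resid (h : GPModel k s f z μ) {t : ℕ} (p : Fin t → D) (x : D) :
    ∫ ω, resid k s f z p x ω ∂μ = 0 := by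
  have hi : ∀ r, Integrable (obs f z p r) μ := fun r => (h.memLp_obs p r).integrable one_le_two
  have h0 : ∀ r, ∫ ω, obs f z p r ω ∂μ = 0 := fun r => by
    simp only [obs]
    rw [integral_add ((h.memLp_reward _).integrable one_le_two)
      ((h.memLp_noise _).integrable one_le_two), h.mean_zero, (h.noise _).integral_eq,
      integral_id_gaussianReal,
      add_zero]
  simp only [resid]
  rw [integral_sub ((h.memLp_reward _).integrable one_le_two)
    (integrable_finsetSum _ fun r _ => (hi r).const_mul _), h.mean_zero,
    integral_finsetSum _ fun r _ => (hi r).const_mul _]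
  simp [integral_const_mul, h0]

variable [Fintype D]

omit [IsProbabilityMeasure μ] in
lemma hasGaussianLaw_prod (h : GPModel k s f z μ) (t : ℕ) :
    HasGaussianLaw (fun ω => ((fun x => f x ω), fun r : Fin t => z r ω)) μ := by
  refine IndepFun.hasGaussianLaw ?_ ?_ ?_
  · let L : (↥(Finset.univ : Finset D) → ℝ) →L[ℝ] (D → ℝ) :=
      ContinuousLinearMap.pi fun x => .proj ⟨x, Finset.mem_univ x⟩
    exact (h.gaussian.hasGaussianLaw Finset.univ).map L
  · exact iIndepFun.hasGaussianLaw (X := fun (r : Fin t) => z r)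
      (fun r => (h.noise r).hasGaussianLaw) (h.noise_indep.precomp Fin.val_injective)
  · exact h.indep.comp measurable_id (ψ := fun (v : ℕ → ℝ) (r : Fin t) => v r) (by fun_prop)

omit [IsProbabilityMeasure μ] in
lemma hasGaussianLaw_resid_obs (h : GPModel k s f z μ) {t : ℕ} (p : Fin t → D) (x : D) :
    HasGaussianLaw (fun ω => ((fun _ : Unit => resid k s f z p x ω),
      fun r => obs f z p r ω)) μ := by
  let L : ((D → ℝ) × (Fin t → ℝ)) →ₗ[ℝ] (Unit → ℝ) × (Fin t → ℝ) :=
    { toFun := fun v => ((fun _ => v.1 x - ∑ r, postWeights k s p x r * (v.1 (p r) + v.2 r)),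
        fun r => v.1 (p r) + v.2 r)
      map_add' := fun v w => by
        refine Prod.ext (funext fun _ => ?_) (funext fun r => ?_)
        · simp only [Prod.fst_add, Prod.snd_add, Pi.add_apply]
          rw [sub_add_sub_comm, ← Finset.sum_add_distrib]
          congr 1
          exact Finset.sum_congr rfl fun r _ => by ring
        · simp only [Prod.fst_add, Prod.snd_add, Pi.add_apply]
          ring
      map_smul' := fun c v => by
        refine Prod.ext (funext fun _ => ?_) (funext fun r => ?_)
        · simp only [Prod.smul_fst, Prod.smul_snd, Pi.smul_apply, smul_eq_mul, RingHom.id_apply]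
          rw [mul_sub, Finset.mul_sum]
          congr 1
          exact Finset.sum_congr rfl fun r _ => by ring
        · simp only [Prod.smul_fst, Prod.smul_snd, Pi.smul_apply, smul_eq_mul, RingHom.id_apply]
          ring }
  exact (h.hasGaussianLaw_prod t).map (LinearMap.toContinuousLinearMap L)

/-- The posterior error is independent of the observations, because they are jointly Gaussian and
uncorrelated. -/
lemma indepFun_resid_obs (h : GPModel k s f z μ) {t : ℕ} (p : Fin t → D) (x : D) :
    IndepFun (resid k s f z p x) (fun ω r => obs f z p r ω) μ := by
  have hI := (h.hasGaussianLaw_resid_obs p x).indepFun_of_covariance_eval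
    (X := fun _ => resid k s f z p x) (Y := fun r => obs f z p r)
    fun _ r => h.covariance_resid_obs p x r
  exact hI.comp (φ := fun v : Unit → ℝ => v ()) (measurable_pi_apply ()) measurable_id

lemma map_resid (h : GPModel k s f z μ) {t : ℕ} (p : Fin t → D) (x : D) :
    μ.map (resid k s f z p x) = gaussianReal 0 (postVar k s p x).toNNReal := by
  have hG : HasGaussianLaw (resid k s f z p x) μ :=
    (h.hasGaussianLaw_resid_obs p x).fst.eval
      (X := fun _ : Unit => resid k s f z p x) ()
  rw [hG.map_eq_gaussianReal, h.variance_resid, h.integral_resid]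

end GPModel

end Residual

/-! ### Runs as functions of the history -/

section Equiv

variable {D ι κ : Type*} [Fintype ι] [Fintype κ] [DecidableEq ι] [DecidableEq κ]
  {k : D → D → ℝ} {s : ℝ}

lemma postMean_equiv {p : ι → D} {q : κ → D} {v : ι → ℝ} {w : κ → ℝ} (e : ι ≃ κ)
    (hpq : ∀ i, q (e i) = p i) (hvw : ∀ i, w (e i) = v i) (x : D) :
    postMean k s q w x = postMean k s p v x := by
  have hG : noisyGram k s p = (noisyGram k s q).submatrix e e := by
    ext i j
    simp [noisyGram, gram, Matrix.diagonal_apply, hpq]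
  have hv : v ∘ e.symm = w := by
    ext j
    simp [← hvw]
  have hk : (fun i => k (p i) x) = (fun j => k (q j) x) ∘ e := by
    ext i
    simp [hpq]
  rw [postMean, postMean, hG, Matrix.inv_submatrix_equiv, Matrix.submatrix_mulVec_equiv, hv, hk,
    comp_equiv_dotProduct_comp_equiv]

end Equiv

section Replay

variable {D : Type*} {P : Params D} {task : Task}

lemma Params.var_congr (hk : (Matrix.of P.k).PosSemidef) (hs : 0 < P.s) {l l' : List (D × ℝ)}
    (h : l.map Prod.fst = l'.map Prod.fst) (u : D) : P.var l u = P.var l' u := by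
  have hlen : l'.length = l.length := by simpa using congrArg List.length h.symm
  refine postVar_equiv hk hs (finCongr hlen) (fun i => ?_) u
  have : (l.map Prod.fst)[(i : ℕ)]'(by simp [← hlen]) =
      (l'.map Prod.fst)[(i : ℕ)]'(by simp) := by simp only [h]
  simpa [pts] using this

lemma Params.varAfter_congr (hk : (Matrix.of P.k).PosSemidef) (hs : 0 < P.s)
    {l l' : List (D × ℝ)} (h : l.map Prod.fst = l'.map Prod.fst) (x u : D) :
    P.varAfter l x u = P.varAfter l' x u := by
  rw [← Params.var_cons hk hs l x 0, ← Params.var_cons hk hs l' x 0]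
  exact Params.var_congr hk hs (by simp [h]) u

lemma Params.nextEpoch_congr (hk : (Matrix.of P.k).PosSemidef) (hs : 0 < P.s)
    {l l' : List (D × ℝ)} (h : l.map Prod.fst = l'.map Prod.fst) (M : Finset D) (i : ℕ) :
    P.nextEpoch l M i = P.nextEpoch l' M i := by
  have : P.EpochDone l M = P.EpochDone l' M := by
    ext j
    simp only [Params.EpochDone, Params.var_congr hk hs h]
  rw [Params.nextEpoch, Params.nextEpoch, this]

/-- The points and observations of the first `t` steps as a history, latest first. -/
def history (a : ℕ → D) (v : ℕ → ℝ) (t : ℕ) : List (D × ℝ) :=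
  ((List.range t).map fun r => (a r, v r)).reverse

lemma history_succ (a : ℕ → D) (v : ℕ → ℝ) (t : ℕ) :
    history a v (t + 1) = (a t, v t) :: history a v t := by
  simp [history, List.range_succ]

lemma length_history (a : ℕ → D) (v : ℕ → ℝ) (t : ℕ) : (history a v t).length = t := by
  simp [history]

lemma map_fst_history (a : ℕ → D) (v w : ℕ → ℝ) (t : ℕ) :
    (history a v t).map Prod.fst = (history a w t).map Prod.fst := by
  simp [history, Function.comp_def]

lemma history_congr {a a' : ℕ → D} {v v' : ℕ → ℝ} {t : ℕ} (ha : ∀ r < t, a r = a' r)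
    (hv : ∀ r < t, v r = v' r) : history a v t = history a' v' t := by
  rw [history, history]
  congr 1
  refine List.map_congr_left fun r hr => ?_
  rw [ha r (List.mem_range.1 hr), hv r (List.mem_range.1 hr)]

/-- Positions in a history, which lists the latest step first. -/
def historyEquiv (a : ℕ → D) (v : ℕ → ℝ) (t : ℕ) : Fin t ≃ Fin (history a v t).length :=
  Fin.revPerm.trans (finCongr (length_history a v t).symm)

lemma get_history (a : ℕ → D) (v : ℕ → ℝ) (t : ℕ) (r : Fin t) :
    (history a v t).get (historyEquiv a v t r) = (a r, v r) := by
  have h1 : ((historyEquiv a v t r : Fin _) : ℕ) = t - (r + 1) := by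
    simp [historyEquiv, Fin.val_rev]
  have h2 : t - 1 - (t - (r + 1)) = r := by omega
  have h3 : ∀ (i : ℕ) (hi : i < (history a v t).length),
      (history a v t)[i] = (a (t - 1 - i), v (t - 1 - i)) := by simp [history]
  rw [List.get_eq_getElem, h3, h1, h2]

lemma Params.mean_history (P : Params D) (a : ℕ → D) (v : ℕ → ℝ) (t : ℕ) (x : D) :
    P.mean (history a v t) x =
      postMean P.k P.s (fun r : Fin t => a r) (fun r : Fin t => v r) x :=
  postMean_equiv (historyEquiv a v t) (fun r => by rw [pts, get_history])
    (fun r => by rw [vals, get_history]) x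

lemma Params.var_history (hk : (Matrix.of P.k).PosSemidef) (hs : 0 < P.s) (a : ℕ → D) (v : ℕ → ℝ)
    (t : ℕ) (x : D) :
    P.var (history a v t) x = postVar P.k P.s (fun r : Fin t => a r) x :=
  postVar_equiv hk hs (historyEquiv a v t) (fun r => by rw [pts, get_history]) x

variable [Fintype D]

/-- The state that results from a history. -/
noncomputable def Params.replay (P : Params D) (task : Task) : List (D × ℝ) → State D
  | [] => State.init D
  | (x, y) :: l => P.update task (P.replay task l) x y

lemma Params.replay_hist (P : Params D) (task : Task) (l : List (D × ℝ)) :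
    (P.replay task l).hist = l := by
  induction l with
  | nil => rfl
  | cons a l ih => rw [Params.replay, Params.update, ih]

/-- The point sampled after a history. -/
noncomputable def Params.choice (P : Params D) (task : Task) (sel : ℕ → Finset D → D)
    (l : List (D × ℝ)) : D :=
  sel l.length (P.argmaxAcq (P.replay task l))

variable {sel : ℕ → Finset D → D} {f : D → ℝ} {z : ℕ → ℝ}

lemma Params.length_run_hist (P : Params D) (task : Task) (sel : ℕ → Finset D → D) (f : D → ℝ)
    (z : ℕ → ℝ) (t : ℕ) : (P.run task sel f z t).hist.length = t := by
  induction t with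
  | zero => rfl
  | succ t ih => rw [Params.run_succ, Params.update, List.length_cons, ih]

lemma Params.replay_run (P : Params D) (task : Task) (sel : ℕ → Finset D → D) (f : D → ℝ)
    (z : ℕ → ℝ) (t : ℕ) :
    P.replay task (P.run task sel f z t).hist = P.run task sel f z t := by
  induction t with
  | zero => rfl
  | succ t ih =>
    conv_lhs => rw [Params.run_succ, Params.update]
    dsimp only
    rw [Params.replay, ih, Params.run_succ]

lemma Params.run_succ_hist (P : Params D) (task : Task) (sel : ℕ → Finset D → D) (f : D → ℝ)
    (z : ℕ → ℝ) (t : ℕ) : (P.run task sel f z (t + 1)).hist =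
      (P.choice task sel (P.run task sel f z t).hist,
        f (P.choice task sel (P.run task sel f z t).hist) + z t) ::
          (P.run task sel f z t).hist := by
  rw [Params.choice, Params.length_run_hist, Params.replay_run]; rfl

/-- A sequence of points that is consistent with the choices of the algorithm is the sequence of
points of the run. -/
lemma Params.run_hist_eq_history {a : ℕ → D} {v : ℕ → ℝ} {t : ℕ}
    (ha : ∀ r < t, P.choice task sel (history a v r) = a r) (hv : ∀ r < t, v r = f (a r) + z r) :
    (P.run task sel f z t).hist = history a v t := by
  induction t with
  | zero => rfl
  | succ t ih =>
    rw [Params.run_succ_hist, ih (fun r hr => ha r (by omega)) (fun r hr => hv r (by omega)),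
      ha t (by omega), history_succ, hv t (by omega)]

lemma Params.run_hist_eq_history_choice (P : Params D) (task : Task) (sel : ℕ → Finset D → D)
    (f : D → ℝ) (z : ℕ → ℝ) (t : ℕ) : (P.run task sel f z t).hist =
      history (fun r => P.choice task sel (P.run task sel f z r).hist)
        (fun r => f (P.choice task sel (P.run task sel f z r).hist) + z r) t := by
  induction t with
  | zero => rfl
  | succ t ih => rw [history_succ, ← ih, Params.run_succ_hist]

end Replay

/-! ### Measurability of the choices -/

section Measurable

variable {D : Type*} {P : Params D}

lemma Params.measurable_mean_history (hk : (Matrix.of P.k).PosSemidef) (a : ℕ → D) (t : ℕ)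
    (x : D) : Measurable fun v : ℕ → ℝ => P.mean (history a v t) x := by
  simp only [P.mean_history, postMean_eq hk, dotProduct]
  fun_prop

lemma Params.measurable_upper_history (hk : (Matrix.of P.k).PosSemidef) (hs : 0 < P.s)
    (a : ℕ → D) (t i : ℕ) (x : D) :
    Measurable fun v : ℕ → ℝ => P.upper (history a v t) i x := by
  simp only [Params.upper, Params.var_history hk hs]
  exact (P.measurable_mean_history hk a t x).add_const _

lemma Params.measurable_lower_history (hk : (Matrix.of P.k).PosSemidef) (hs : 0 < P.s)
    (a : ℕ → D) (t i : ℕ) (x : D) :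
    Measurable fun v : ℕ → ℝ => P.lower (history a v t) i x := by
  simp only [Params.lower, Params.var_history hk hs]
  exact (P.measurable_mean_history hk a t x).sub_const _

variable [Fintype D]

lemma Params.measurableSet_newM_history (hk : (Matrix.of P.k).PosSemidef) (hs : 0 < P.s)
    (task : Task) (S : State D) (a : ℕ → D) (t : ℕ) (A : Finset D) :
    MeasurableSet {v : ℕ → ℝ | P.newM task S (history a v t) = A} := by
  have hu := Params.measurable_upper_history hk hs a t S.epoch
  have hl := Params.measurable_lower_history hk hs a t S.epoch
  simp only [Finset.ext_iff]
  refine measurableSet_setOfPred.2 (Measurable.forall fun x => Measurable.iff ?_ measurable_const)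
  cases task with
  | bo =>
    simp only [Params.mem_newM_bo]
    exact measurable_const.and (Measurable.forall fun x' => measurable_const.imp
      (measurableSet_setOfPred.1 (measurableSet_le (hl x') (hu x))))
  | lse τ =>
    simp only [Params.mem_newM_lse]
    exact measurable_const.and ((measurableSet_setOfPred.1 (measurableSet_le measurable_const
      (hu x))).and (measurableSet_setOfPred.1 (measurableSet_le (hl x) measurable_const)))

/-- For fixed points, the state after `t` steps depends measurably on the observed values: the
posterior variances are constant, and the posterior mean is linear. -/
lemma Params.measurableSet_replay_history (hk : (Matrix.of P.k).PosSemidef) (hs : 0 < P.s)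
    (task : Task) (a : ℕ → D) (t : ℕ) (A : Finset D) (i : ℕ) :
    MeasurableSet {v : ℕ → ℝ | (P.replay task (history a v t)).M = A ∧
      (P.replay task (history a v t)).epoch = i} := by
  induction t generalizing A i with
  | zero => exact MeasurableSet.const ((State.init D).M = A ∧ (State.init D).epoch = i)
  | succ t ih =>
    have h : {v : ℕ → ℝ | (P.replay task (history a v (t + 1))).M = A ∧
        (P.replay task (history a v (t + 1))).epoch = i} =
        ⋃ (B : Finset D) (j : ℕ), {v : ℕ → ℝ | (P.replay task (history a v t)).M = B ∧
          (P.replay task (history a v t)).epoch = j} ∩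
          ({v : ℕ → ℝ | P.newM task ⟨[], B, ∅, ∅, j⟩ (history a v (t + 1)) = A} ∩
            {_v : ℕ → ℝ | P.nextEpoch (history a 0 (t + 1)) A j = i}) := by
      ext v
      have hM : (P.replay task (history a v (t + 1))).M =
          P.newM task ⟨[], (P.replay task (history a v t)).M, ∅, ∅,
            (P.replay task (history a v t)).epoch⟩ (history a v (t + 1)) := by
        conv_lhs => rw [history_succ, Params.replay, Params.update]
        dsimp only
        rw [P.replay_hist, ← history_succ]
        cases task <;> rfl
      have he : (P.replay task (history a v (t + 1))).epoch =
          P.nextEpoch (history a 0 (t + 1)) (P.replay task (history a v (t + 1))).M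
            (P.replay task (history a v t)).epoch := by
        rw [Params.nextEpoch_congr hk hs (map_fst_history a 0 v (t + 1)), history_succ,
          Params.replay, Params.update]
        dsimp only
        rw [P.replay_hist]
      simp only [Set.mem_ofPred_eq, Set.mem_iUnion, Set.mem_inter_iff]
      constructor
      · rintro ⟨h1, h2⟩
        exact ⟨_, _, ⟨rfl, rfl⟩, hM ▸ h1, by rw [← h1, ← he, h2]⟩
      · rintro ⟨B, j, ⟨rfl, rfl⟩, h1, h2⟩
        rw [he, hM, h1]
        exact ⟨rfl, h2⟩
    rw [h]
    exact MeasurableSet.iUnion fun B => MeasurableSet.iUnion fun j => (ih B j).inter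
      ((Params.measurableSet_newM_history hk hs task _ a (t + 1) A).inter (MeasurableSet.const _))

lemma Params.measurableSet_choice_history (hk : (Matrix.of P.k).PosSemidef) (hs : 0 < P.s)
    (task : Task) (sel : ℕ → Finset D → D) (a : ℕ → D) (t : ℕ) (x : D) :
    MeasurableSet {v : ℕ → ℝ | P.choice task sel (history a v t) = x} := by
  have h : {v : ℕ → ℝ | P.choice task sel (history a v t) = x} =
      ⋃ (B : Finset D) (j : ℕ), {v : ℕ → ℝ | (P.replay task (history a v t)).M = B ∧
        (P.replay task (history a v t)).epoch = j} ∩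
          {_v : ℕ → ℝ | sel t (P.argmaxAcq ⟨history a 0 t, B, ∅, ∅, j⟩) = x} := by
    ext v
    have hc : P.choice task sel (history a v t) = sel t (P.argmaxAcq ⟨history a 0 t,
        (P.replay task (history a v t)).M, ∅, ∅, (P.replay task (history a v t)).epoch⟩) := by
      rw [Params.choice, length_history]
      congr 1
      simp only [Params.argmaxAcq, Params.acq, P.replay_hist,
        Params.var_congr hk hs (map_fst_history a v 0 t),
        Params.varAfter_congr hk hs (map_fst_history a v 0 t)]
    simp only [Set.mem_ofPred_eq, Set.mem_iUnion, Set.mem_inter_iff]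
    constructor
    · intro h1
      exact ⟨_, _, ⟨rfl, rfl⟩, hc ▸ h1⟩
    · rintro ⟨B, j, ⟨rfl, rfl⟩, h1⟩
      rw [hc, h1]
  rw [h]
  exact MeasurableSet.iUnion fun B => MeasurableSet.iUnion fun j =>
    (Params.measurableSet_replay_history hk hs task a t B j).inter (MeasurableSet.const _)

end Measurable

/-! ### Validity of a single confidence bound -/

section Confidence

variable {D : Type*} [Fintype D] {P : Params D} {Ω : Type*} [MeasurableSpace Ω]
  {μ : Measure Ω} [IsProbabilityMeasure μ] {f : D → Ω → ℝ} {z : ℕ → Ω → ℝ}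

/-- Extends a finite sequence by a constant. -/
def extend {α : Type*} {t : ℕ} (c : α) (v : Fin t → α) (r : ℕ) : α :=
  if h : r < t then v ⟨r, h⟩ else c

lemma extend_val {α : Type*} {t : ℕ} (c : α) (v : Fin t → α) (r : Fin t) : extend c v r = v r := by
  simp [extend]

lemma measurable_extend (t : ℕ) : Measurable (extend (0 : ℝ) : (Fin t → ℝ) → ℕ → ℝ) := by
  refine measurable_pi_lambda _ fun r => ?_
  by_cases h : r < t
  · simpa [extend, h] using measurable_pi_apply _
  · simp [extend, h]

/-- At each time, the confidence interval of half-width `√b σ_t(x)` fails with probability at most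
`exp(-b / 2)`. On the event that the run samples given points, which is determined by the
observations at these points, the error of the posterior mean is independent of that event. -/
theorem GPModel.measure_error_le (h : GPModel P.k P.s f z μ) (hk1 : ∀ x, P.k x x = 1) (task : Task)
    (sel : ℕ → Finset D → D) (t : ℕ) (x : D) {b : ℝ} (hb : 0 ≤ b) :
    μ {ω | Real.sqrt b * Real.sqrt
        (P.var (P.run task sel (fun x => f x ω) (fun t => z t ω) t).hist x) <
      |f x ω - P.mean (P.run task sel (fun x => f x ω) (fun t => z t ω) t).hist x|} ≤
      ENNReal.ofReal (Real.exp (-b / 2)) := by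
  set hist : Ω → ℕ → List (D × ℝ) :=
    fun ω r => (P.run task sel (fun x => f x ω) (fun t => z t ω) r).hist with hhist
  let A : (Fin t → D) → Set (Fin t → ℝ) := fun p =>
    {v | ∀ r : Fin t, P.choice task sel (history (extend x p) (extend 0 v) r) = p r}
  let E : (Fin t → D) → Set Ω := fun p => (fun ω r => obs f z p r ω) ⁻¹' A p
  let F : (Fin t → D) → Set Ω := fun p => resid P.k P.s f z p x ⁻¹'
    {y | Real.sqrt b * Real.sqrt (postVar P.k P.s p x) < |y|}
  have hA : ∀ p, MeasurableSet (A p) := fun p => by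
    refine measurableSet_setOfPred.2 (Measurable.forall fun r => measurableSet_setOfPred.1 ?_)
    exact measurable_extend t (Params.measurableSet_choice_history h.psd h.pos task sel
      (extend x p) r (p r))
  have hobs : ∀ p : Fin t → D, AEMeasurable (fun ω r => obs f z p r ω) μ := fun p =>
    aemeasurable_pi_lambda _ fun r => (h.memLp_obs p r).aemeasurable
  have hE : ∀ p, NullMeasurableSet (E p) μ := fun p => (hobs p).nullMeasurable (hA p)
  have hEhist : ∀ p, ∀ ω ∈ E p, ∀ r : Fin t, p r = P.choice task sel (hist ω r) := by
    intro p ω hω r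
    have h1 : hist ω r = history (extend x p) (extend 0 fun r => obs f z p r ω) r := by
      refine Params.run_hist_eq_history (fun q hq => ?_) fun q hq => ?_
      · have := hω ⟨q, hq.trans r.2⟩
        rw [← extend_val x p] at this
        exact this
      · simp [extend, hq.trans r.2, obs]
    rw [h1]
    exact (hω r).symm
  have hdisj : Pairwise (Function.onFun (AEDisjoint μ) E) := by
    intro p q hpq
    refine Disjoint.aedisjoint (Set.disjoint_left.2 fun ω hp hq => hpq (funext fun r => ?_))
    rw [hEhist p ω hp r, hEhist q ω hq r]
  have hsum : ∑ p, μ (E p) ≤ 1 := by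
    rw [← measure_univ (μ := μ)]
    exact sum_measure_le_measure_univ (fun p _ => hE p) fun p _ q _ hpq => hdisj hpq
  have hF : ∀ p, μ (F p) ≤ ENNReal.ofReal (Real.exp (-b / 2)) := by
    intro p
    have hm : MeasurableSet {y : ℝ | Real.sqrt b * Real.sqrt (postVar P.k P.s p x) < |y|} :=
      measurableSet_lt measurable_const (by fun_prop)
    have hr : AEMeasurable (resid P.k P.s f z p x) μ := (h.memLp_resid p x).aemeasurable
    rw [← Measure.map_apply_of_aemeasurable hr hm, h.map_resid]
    exact gaussianReal_abs_gt_sqrt_le hb (postVar_pos h.psd hk1 h.pos p x)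
  have hEF : ∀ p, μ (E p ∩ F p) ≤ μ (E p) * ENNReal.ofReal (Real.exp (-b / 2)) := by
    intro p
    have hm : MeasurableSet {y : ℝ | Real.sqrt b * Real.sqrt (postVar P.k P.s p x) < |y|} :=
      measurableSet_lt measurable_const (by fun_prop)
    rw [(h.indepFun_resid_obs p x).symm.measure_inter_preimage_eq_mul _ _ (hA p) hm]
    exact mul_le_mul_right (hF p) _
  have hsub : {ω | Real.sqrt b * Real.sqrt (P.var (hist ω t) x) <
      |f x ω - P.mean (hist ω t) x|} ⊆ ⋃ p, E p ∩ F p := by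
    intro ω hω
    let c : ℕ → D := fun r => P.choice task sel (hist ω r)
    let p : Fin t → D := fun r => c r
    have h1 : ∀ r ≤ t, hist ω r = history (extend x p) (extend 0 fun r => obs f z p r ω) r := by
      intro r hr
      refine (P.run_hist_eq_history_choice task sel _ _ r).trans
        (history_congr (fun q hq => ?_) fun q hq => ?_)
      · simp [extend, hq.trans_le hr, p, c, hhist]
      · simp [extend, hq.trans_le hr, p, c, obs, hhist]
    refine Set.mem_iUnion.2 ⟨p, fun r => ?_, ?_⟩
    · rw [← h1 r r.2.le]
    · have h2 : (fun r : Fin t => extend x p r) = p := funext fun r => extend_val x p r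
      have h3 : (fun r : Fin t => extend 0 (fun r => obs f z p r ω) r) =
        fun r => obs f z p r ω := funext fun r => extend_val 0 _ r
      rw [Set.mem_ofPred_eq, h1 t le_rfl, Params.var_history h.psd h.pos, P.mean_history, h2, h3]
        at hω
      rw [Set.mem_preimage, Set.mem_ofPred_eq, resid_eq h.psd]
      exact hω
  calc _ ≤ μ (⋃ p, E p ∩ F p) := measure_mono hsub
    _ ≤ ∑ p, μ (E p ∩ F p) := measure_iUnion_fintype_le _ _
    _ ≤ ∑ p, μ (E p) * ENNReal.ofReal (Real.exp (-b / 2)) := Finset.sum_le_sum fun p _ => hEF p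
    _ = (∑ p, μ (E p)) * ENNReal.ofReal (Real.exp (-b / 2)) := (Finset.sum_mul _ _ _).symm
    _ ≤ 1 * ENNReal.ofReal (Real.exp (-b / 2)) := mul_le_mul_left hsum _
    _ = _ := one_mul _

end Confidence

/-! ### The union bound over time -/

section UnionBound

lemma exp_neg_betaT_half {n : ℕ} (hn : 0 < n) {δ : ℝ} (hδ : 0 < δ) {T : ℕ} (hT : 1 ≤ T) :
    n * Real.exp (-betaT n δ T / 2) = 6 * δ / (Real.pi ^ 2 * T ^ 2) := by
  have hn' : (0 : ℝ) < n := by exact_mod_cast hn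
  have hT' : (0 : ℝ) < T := by exact_mod_cast hT
  have h : -betaT n δ T / 2 = -Real.log (n * (T : ℝ) ^ 2 * Real.pi ^ 2 / (6 * δ)) := by
    rw [betaT]; ring
  rw [h, Real.exp_neg, Real.exp_log (by positivity)]
  field_simp

lemma exp_neg_late_half {n : ℕ} (hn : 0 < n) {δ : ℝ} (hδ : 0 < δ) (t : ℕ) :
    n * Real.exp (-(2 * Real.log (5 * n * ((t + 1 : ℕ) : ℝ) ^ 2 / δ)) / 2) =
      δ / 5 * (1 / ((t + 1 : ℕ) : ℝ) ^ 2) := by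
  have hn' : (0 : ℝ) < n := by exact_mod_cast hn
  have ht : (0 : ℝ) < ((t + 1 : ℕ) : ℝ) := by positivity
  have h : -(2 * Real.log (5 * n * ((t + 1 : ℕ) : ℝ) ^ 2 / δ)) / 2 =
      -Real.log (5 * n * ((t + 1 : ℕ) : ℝ) ^ 2 / δ) := by ring
  rw [h, Real.exp_neg, Real.exp_log (by positivity)]
  field_simp

/-- The total failure probability: at most `6 δ / π²` up to time `N₀ ≤ T²`, and at most
`δ π² / 30` afterwards. -/
lemma tsum_failure_le {δ : ℝ} (hδ : 0 < δ) {N₀ T : ℕ} (hT : 1 ≤ T) (hN : N₀ ≤ T ^ 2) :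
    ∑' t : ℕ, ENNReal.ofReal ((if t < N₀ then 6 * δ / (Real.pi ^ 2 * T ^ 2) else 0) +
      δ / 5 * (1 / ((t + 1 : ℕ) : ℝ) ^ 2)) ≤ ENNReal.ofReal δ := by
  have hT' : (0 : ℝ) < T := by exact_mod_cast hT
  set c := 6 * δ / (Real.pi ^ 2 * T ^ 2) with hc
  have hc0 : 0 ≤ c := by positivity
  have h1 : HasSum (fun t : ℕ => if t < N₀ then c else 0) (N₀ * c) := by
    have h : HasSum (fun t : ℕ => if t < N₀ then c else 0)
        (∑ t ∈ Finset.range N₀, if t < N₀ then c else 0) :=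
      hasSum_sum_of_ne_finset_zero fun t ht => if_neg (by simpa using ht)
    have h' : ∑ t ∈ Finset.range N₀, (if t < N₀ then c else 0) = N₀ * c := by
      rw [Finset.sum_congr rfl fun t ht => if_pos (Finset.mem_range.1 ht)]
      simp
    rwa [h'] at h
  have h2 : HasSum (fun t : ℕ => 1 / ((t + 1 : ℕ) : ℝ) ^ 2) (Real.pi ^ 2 / 6) := by
    have h := (hasSum_nat_add_iff' (f := fun t : ℕ => 1 / (t : ℝ) ^ 2) 1).2 hasSum_zeta_two
    simpa using h
  have h3 := h1.add (h2.mul_left (δ / 5))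
  rw [← ENNReal.ofReal_tsum_of_nonneg (fun t => by split_ifs <;> positivity) h3.summable,
    h3.tsum_eq]
  refine ENNReal.ofReal_le_ofReal ?_
  have hN' : (N₀ : ℝ) ≤ (T : ℝ) ^ 2 := by exact_mod_cast hN
  have h4 : N₀ * c ≤ 6 * δ / Real.pi ^ 2 := by
    refine (mul_le_mul_of_nonneg_right hN' hc0).trans (le_of_eq ?_)
    rw [hc]
    field_simp
  have hpi1 : 9.8 ≤ Real.pi ^ 2 := by nlinarith [Real.pi_gt_d4]
  have hpi2 : Real.pi ^ 2 ≤ 9.9 := by nlinarith [Real.pi_lt_d4, Real.pi_pos]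
  have h5 : 6 * δ / Real.pi ^ 2 ≤ 6 * δ / 9.8 := by gcongr
  have h6 : δ / 5 * (Real.pi ^ 2 / 6) ≤ δ / 5 * (9.9 / 6) := by gcongr
  have h7 : 6 * δ / 9.8 + δ / 5 * (9.9 / 6) ≤ δ := by
    norm_num
    linarith
  linarith

variable {D : Type*} [Fintype D]

/-- The union bound over all times and points, with the confidence parameter `b t` at time
`t + 1`. -/
lemma measure_iUnion_error_le {P : Params D} {Ω : Type*} [MeasurableSpace Ω] {μ : Measure Ω}
    [IsProbabilityMeasure μ] {f : D → Ω → ℝ} {z : ℕ → Ω → ℝ} (h : GPModel P.k P.s f z μ)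
    (hk1 : ∀ x, P.k x x = 1) (task : Task) (sel : ℕ → Finset D → D) {b g : ℕ → ℝ}
    (hb : ∀ t, 0 ≤ b t) (hg : ∀ t, Fintype.card D * Real.exp (-b t / 2) ≤ g t) {c : ENNReal}
    (hc : ∑' t, ENNReal.ofReal (g t) ≤ c) :
    μ (⋃ (t : ℕ) (x : D), {ω | Real.sqrt (b t) * Real.sqrt
        (P.var (P.run task sel (fun x => f x ω) (fun t => z t ω) (t + 1)).hist x) <
      |f x ω - P.mean (P.run task sel (fun x => f x ω) (fun t => z t ω) (t + 1)).hist x|}) ≤ c := by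
  refine (measure_iUnion_le _).trans (le_trans (ENNReal.tsum_le_tsum fun t => ?_) hc)
  refine (measure_iUnion_fintype_le _ _).trans ((Finset.sum_le_sum fun x _ =>
    h.measure_error_le hk1 task sel (t + 1) x (hb t)).trans ?_)
  rw [Finset.sum_const, Finset.card_univ, nsmul_eq_mul, ← ENNReal.ofReal_natCast,
    ← ENNReal.ofReal_mul (by positivity)]
  exact ENNReal.ofReal_le_ofReal (hg t)

variable [DecidableEq D]

/-- One choice of the confidence parameters works for all times `T' ≥ T`, if `T` satisfies the
sampling bound. -/
theorem exists_beta_accurate (hD : 2 ≤ Fintype.card D) {k : D → D → ℝ}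
    (hk : (Matrix.of k).PosSemidef) (hk1 : ∀ x, k x x = 1) {σ : ℝ} (hσ : 0 < σ)
    (hsub : SubmodularVarReduction k (σ ^ 2)) {dbar : ℝ} (hd : 0 < dbar) {δ : ℝ} (hδ0 : 0 < δ)
    (hδ1 : δ < 1) {ε : ℝ} (hε0 : 0 < ε) (hε1 : ε < 4 * (1 + dbar)) {T : ℕ} (hT : 1 ≤ T)
    (hTB : improvedBound (Fintype.card D) σ dbar ε (infoGain k (σ ^ 2) T)
      (betaT (Fintype.card D) δ T) ≤ T) :
    ∃ beta : ℕ → ℝ, (∀ i, 1 < beta i) ∧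
      ∀ (Ω : Type*) [MeasurableSpace Ω] (μ : Measure Ω) [IsProbabilityMeasure μ]
        (f : D → Ω → ℝ) (z : ℕ → Ω → ℝ), GPModel k (σ ^ 2) f z μ →
        ∀ sel : ℕ → Finset D → D, (∀ t A, A.Nonempty → sel t A ∈ A) →
        ∀ (task : Task) (T' : ℕ), T ≤ T' →
          1 - δ ≤ μ.real {ω | ∀ t, T' ≤ t → Accurate task (fun x => f x ω) ε
            ((halvingParams k (σ ^ 2) dbar beta).run task sel (fun x => f x ω)
              (fun t => z t ω) t)} := by
  have : Nonempty D := Fintype.card_pos_iff.1 (by omega)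
  have hn : 0 < Fintype.card D := by omega
  obtain ⟨beta, N₀, hb1, hbβ, hN, hrun⟩ :=
    exists_schedule hD hk hk1 hσ hsub hd hδ0 hδ1 hε0 hε1 hT hTB
  refine ⟨beta, hb1, fun Ω _ μ _ f z hGP sel hsel task T' hT' => ?_⟩
  set P := halvingParams k (σ ^ 2) dbar beta with hP
  set β := betaT (Fintype.card D) δ T with hβ
  have hβ0 : 0 ≤ β := by linarith [betaT_ge hD hδ0 hδ1 hT]
  -- the confidence parameter that the union bound needs at time `t + 1`
  let b : ℕ → ℝ := fun t =>
    if t < N₀ then β else 2 * Real.log (5 * Fintype.card D * ((t + 1 : ℕ) : ℝ) ^ 2 / δ)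
  have hb0 : ∀ t, 0 ≤ b t := by
    intro t
    simp only [b]
    split_ifs
    · exact hβ0
    · refine mul_nonneg zero_le_two (Real.log_nonneg ?_)
      have h1 : (1 : ℝ) ≤ Fintype.card D := by exact_mod_cast hn
      have h2 : (1 : ℝ) ≤ ((t + 1 : ℕ) : ℝ) := by exact_mod_cast Nat.succ_pos t
      rw [le_div_iff₀ hδ0]
      nlinarith [mul_le_mul h1 (one_le_pow₀ h2 (n := 2)) zero_le_one (by positivity)]
  have hg : ∀ t, Fintype.card D * Real.exp (-b t / 2) ≤
      (if t < N₀ then 6 * δ / (Real.pi ^ 2 * T ^ 2) else 0) +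
        δ / 5 * (1 / ((t + 1 : ℕ) : ℝ) ^ 2) := by
    intro t
    simp only [b]
    split_ifs
    · rw [hβ, exp_neg_betaT_half hn hδ0 hT]
      exact le_add_of_nonneg_right (by positivity)
    · rw [exp_neg_late_half hn hδ0, zero_add]
  set bad := ⋃ (t : ℕ) (x : D), {ω | Real.sqrt (b t) * Real.sqrt
        (P.var (P.run task sel (fun x => f x ω) (fun t => z t ω) (t + 1)).hist x) <
      |f x ω - P.mean (P.run task sel (fun x => f x ω) (fun t => z t ω) (t + 1)).hist x|}
    with hbad
  have hbadle : μ bad ≤ ENNReal.ofReal δ :=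
    measure_iUnion_error_le (P := P) hGP hk1 task sel hb0 hg (tsum_failure_le hδ0 hT hN)
  set good := {ω | ∀ t, T' ≤ t → Accurate task (fun x => f x ω) ε
    (P.run task sel (fun x => f x ω) (fun t => z t ω) t)} with hgood
  have hcover : Set.univ ⊆ good ∪ bad := by
    intro ω _
    by_cases hω : ω ∈ bad
    · exact Or.inr hω
    left
    simp only [hbad, Set.mem_iUnion, Set.mem_ofPred_eq, not_exists, not_lt] at hω
    obtain ⟨hlate, t₀, ht₀, hw⟩ := hrun task sel (fun x => f x ω) (fun t => z t ω) hsel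
    have hconf : P.Confident task sel (fun x => f x ω) (fun t => z t ω) := by
      intro t hM x
      have h1 : b t ≤ beta (P.run task sel (fun x => f x ω) (fun t => z t ω) t).epoch := by
        simp only [b]
        split_ifs with h
        · exact hbβ _
        · exact hlate t hM (by omega)
      have h2 := abs_le.1 ((hω t x).trans (mul_le_mul_of_nonneg_right (Real.sqrt_le_sqrt h1)
        (Real.sqrt_nonneg _)))
      rw [Params.lower, Params.upper]
      constructor <;> linarith [h2.1, h2.2]
    exact fun t ht => hconf.accurate hw (ht₀.trans (hT'.trans ht))
  have h1 : (1 : ℝ) ≤ μ.real good + μ.real bad := by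
    rw [← probReal_univ (μ := μ)]
    exact (measureReal_mono hcover).trans (measureReal_union_le _ _)
  have h2 : μ.real bad ≤ δ := ENNReal.toReal_le_of_le_ofReal hδ0.le hbadle
  linarith

end UnionBound

/-! ### The order of the sampling bound -/

section Order

lemma C1_nonneg (σ : ℝ) : 0 ≤ C1 σ :=
  one_div_nonneg.2 (Real.log_nonneg (le_add_of_nonneg_right (by positivity)))

lemma two_mul_leadingOrder_mul_le {n : ℕ} {σ dbar ε γ β : ℝ} (hd : 0 < dbar) (hγ : 0 ≤ γ)
    (hβ : 0 ≤ β) (hΛ : 0 ≤ logFactor n dbar ε β) :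
    2 * leadingOrder σ ε γ β * logFactor n dbar ε β ≤ improvedBound n σ dbar ε γ β := by
  rw [improvedBound, leadingOrder]
  refine mul_le_mul_of_nonneg_right ?_ hΛ
  have hA : 1 ≤ (1 + dbar) ^ 2 := one_le_pow₀ (by linarith)
  have h1 : 0 ≤ σ ^ 2 * γ * β / ε ^ 2 := by positivity
  have h2 : 0 ≤ C1 σ * γ * β / σ ^ 2 := by have := C1_nonneg σ; positivity
  have h3 : (1 : ℝ) ≤ ((max 1 ⌈Real.logb 2 (32 * (1 + dbar) ^ 2 / (ε * σ))⌉ : ℤ) : ℝ) := by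
    exact_mod_cast le_max_left _ _
  have h4 : 2 * σ ^ 2 * γ * β * (96 * (1 + dbar) ^ 2 / ε ^ 2) =
    192 * (1 + dbar) ^ 2 * (σ ^ 2 * γ * β / ε ^ 2) := by ring
  have h5 : C1 σ * γ * β * (6 * (1 + dbar) ^ 2 / σ ^ 2) =
    6 * (1 + dbar) ^ 2 * (C1 σ * γ * β / σ ^ 2) := by ring
  rw [h4, h5]
  nlinarith [mul_le_mul_of_nonneg_right hA h1, mul_le_mul_of_nonneg_right hA h2]

lemma improvedBound_le_mul_leadingOrder {n : ℕ} {σ dbar ε γ β : ℝ} (hd : 0 < dbar) (hγ : 0 ≤ γ)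
    (hβ : 0 ≤ β) (hΛ : 0 ≤ logFactor n dbar ε β) :
    improvedBound n σ dbar ε γ β ≤ 192 * (1 + dbar) ^ 2 * leadingOrder σ ε γ β *
      (1 + |Real.logb 2 (32 * (1 + dbar) ^ 2 / (ε * σ))|) * logFactor n dbar ε β := by
  rw [improvedBound, leadingOrder]
  refine mul_le_mul_of_nonneg_right ?_ hΛ
  set A := (1 + dbar) ^ 2 with hAdef
  have hA : 1 ≤ A := one_le_pow₀ (by linarith)
  set L := Real.logb 2 (32 * A / (ε * σ)) with hL
  have h1 : 0 ≤ σ ^ 2 * γ * β / ε ^ 2 := by positivity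
  have h2 : 0 ≤ C1 σ * γ * β / σ ^ 2 := by have := C1_nonneg σ; positivity
  have hL0 := abs_nonneg L
  have h3 : ((max 1 ⌈L⌉ : ℤ) : ℝ) ≤ 1 + |L| := by
    rw [Int.cast_max, Int.cast_one]
    refine max_le (by linarith) ?_
    linarith [Int.ceil_lt_add_one L, le_abs_self L]
  have h4 : 2 * σ ^ 2 * γ * β * (96 * A / ε ^ 2) = 192 * A * (σ ^ 2 * γ * β / ε ^ 2) := by ring
  have h5 : C1 σ * γ * β * (6 * A / σ ^ 2) = 6 * A * (C1 σ * γ * β / σ ^ 2) := by ring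
  rw [h4, h5]
  set X := σ ^ 2 * γ * β / ε ^ 2
  set Y := C1 σ * γ * β / σ ^ 2
  have h6 : 0 ≤ A * X := by positivity
  have h7 : 0 ≤ A * Y := by positivity
  have h8 := mul_nonneg h6 hL0
  have h9 := mul_nonneg h7 hL0
  have h10 : 1 + |L| ≤ A * (1 + |L|) := le_mul_of_one_le_left (by linarith) hA
  nlinarith

end Order

end TruVaR

theorem corollary2 {D : Type*} [Fintype D] [DecidableEq D] (hD : 2 ≤ Fintype.card D)
    (k : D → D → ℝ) (hk : (Matrix.of k).PosSemidef) (hk1 : ∀ x, k x x = 1)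
    (σ : ℝ) (hσ : 0 < σ) (hsub : TruVaR.SubmodularVarReduction k (σ ^ 2))
    (dbar : ℝ) (hdbar : 0 < dbar) (δ : ℝ) (hδ0 : 0 < δ) (hδ1 : δ < 1)
    (ε : ℝ) (hε0 : 0 < ε) (hε1 : ε < 4 * (1 + dbar)) :
    (∃ beta : ℕ → ℝ, (∀ i, 1 < beta i) ∧
      ∀ (Ω : Type*) [MeasurableSpace Ω] (μ : Measure Ω) [IsProbabilityMeasure μ]
        (f : D → Ω → ℝ) (z : ℕ → Ω → ℝ),
        IsGaussianProcess f μ →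
        (∀ x, ∫ ω, f x ω ∂μ = 0) →
        (∀ x x', cov[f x, f x'; μ] = k x x') →
        (∀ t, HasLaw (z t) (gaussianReal 0 (Real.toNNReal (σ ^ 2))) μ) →
        iIndepFun z μ →
        IndepFun (fun ω x => f x ω) (fun ω t => z t ω) μ →
        ∀ sel : ℕ → Finset D → D, (∀ t A, A.Nonempty → sel t A ∈ A) →
        ∀ (task : TruVaR.Task) (T : ℕ), 1 ≤ T →
          TruVaR.improvedBound (Fintype.card D) σ dbar ε
            (TruVaR.infoGain k (σ ^ 2) T) (TruVaR.betaT (Fintype.card D) δ T) ≤ (T : ℝ) →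
          1 - δ ≤ μ.real {ω | ∀ t, T ≤ t →
            TruVaR.Accurate task (fun x => f x ω) ε
              (TruVaR.Params.run
                { k := k, s := σ ^ 2, dbar := dbar, r := 1 / 2, eta1 := 1, beta := beta }
                task sel (fun x => f x ω) (fun t => z t ω) t)})
    ∧ (∀ T : ℕ, 1 ≤ T →
        0 ≤ TruVaR.logFactor (Fintype.card D) dbar ε (TruVaR.betaT (Fintype.card D) δ T) →
        2 * TruVaR.leadingOrder σ ε
              (TruVaR.infoGain k (σ ^ 2) T) (TruVaR.betaT (Fintype.card D) δ T)
            * TruVaR.logFactor (Fintype.card D) dbar ε (TruVaR.betaT (Fintype.card D) δ T)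
          ≤ TruVaR.improvedBound (Fintype.card D) σ dbar ε
              (TruVaR.infoGain k (σ ^ 2) T) (TruVaR.betaT (Fintype.card D) δ T)
        ∧ TruVaR.improvedBound (Fintype.card D) σ dbar ε
              (TruVaR.infoGain k (σ ^ 2) T) (TruVaR.betaT (Fintype.card D) δ T)
          ≤ 192 * (1 + dbar) ^ 2 * TruVaR.leadingOrder σ ε
              (TruVaR.infoGain k (σ ^ 2) T) (TruVaR.betaT (Fintype.card D) δ T)
            * (1 + |Real.logb 2 (32 * (1 + dbar) ^ 2 / (ε * σ))|)
            * TruVaR.logFactor (Fintype.card D) dbar ε (TruVaR.betaT (Fintype.card D) δ T)) := by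
  have : Nonempty D := Fintype.card_pos_iff.1 (by omega)
  refine ⟨?_, fun T hT hΛ => ?_⟩
  · by_cases hex : ∃ T : ℕ, 1 ≤ T ∧
        TruVaR.improvedBound (Fintype.card D) σ dbar ε
          (TruVaR.infoGain k (σ ^ 2) T) (TruVaR.betaT (Fintype.card D) δ T) ≤ (T : ℝ)
    · classical
      -- The parameters are chosen for the least `T` that satisfies the bound.
      obtain ⟨hT, hTB⟩ := Nat.find_spec hex
      obtain ⟨beta, hb1, hacc⟩ := TruVaR.exists_beta_accurate hD hk hk1 hσ hsub hdbar hδ0 hδ1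
        hε0 hε1 hT hTB
      exact ⟨beta, hb1, fun Ω _ μ _ f z hf hf0 hfk hz hzi hfz sel hsel task T' hT' hTB' =>
        hacc Ω μ f z ⟨hk, by positivity, hf, hf0, hfk, hz, hzi, hfz⟩ sel hsel task T'
          (Nat.find_min' hex ⟨hT', hTB'⟩)⟩
    · exact ⟨fun _ => 2, fun _ => one_lt_two, fun Ω _ μ _ f z _ _ _ _ _ _ sel _ task T hT hTB =>
        absurd ⟨T, hT, hTB⟩ hex⟩
  · have hγ : 0 ≤ TruVaR.infoGain k (σ ^ 2) T := by
      have h1 := TruVaR.log_one_add_inv_le_infoGain hk hk1 (by positivity : 0 < σ ^ 2) hT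
      have h2 : 0 ≤ Real.log (1 + (σ ^ 2)⁻¹) :=
        Real.log_nonneg (le_add_of_nonneg_right (by positivity))
      linarith
    have hβ : 0 ≤ TruVaR.betaT (Fintype.card D) δ T := by
      linarith [TruVaR.betaT_ge hD hδ0 hδ1 hT]
    exact ⟨TruVaR.two_mul_leadingOrder_mul_le hdbar hγ hβ hΛ,
      TruVaR.improvedBound_le_mul_leadingOrder hdbar hγ hβ hΛ⟩
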